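/- Let $1<s<2$ and $\Omega=(0,1)$. For $\sigma>0$ let $({}_0I^{\sigma}_x w)(x)=\frac1{\Gamma(\sigma)}\int_0^x (x-y)^{\sigma-1}w(y)\,dy$ and $({}_xI^{\sigma}_1 w)(x)=\frac1{\Gamma(\sigma)}\int_x^1 (y-x)^{\sigma-1}w(y)\,dy$, and for $n-1<\sigma<n$ let ${}_0D^{\sigma}_x=D^n\,{}_0I^{n-\sigma}_x$ and ${}_xD^{\sigma}_1=(-1)^nD^n\,{}_xI^{n-\sigma}_1$ be the left and right Riemann–Liouville derivatives, with $D^n$ the weak derivative of order $n$ on $\Omega$. For $\alpha\ge 0$ let $H^\alpha(\Omega)$ be the Sobolev–Slobodeckij space, and $\tilde H^{\alpha}(\Omega)$ the set of $u\in H^\alpha(\Omega)$ whose extension by zero lies in $H^\alpha(\mathbb R)$. Let $g:\Omega\times\mathbb R\to\mathbb R$ be such that $g(\cdot,t)$ is measurable for every $t$; for a.e. $x\in\Omega$ the function $g(x,\cdot)$ is continuous, odd and strictly increasing with $g(x,0)=0$ and $\lim_{t\to\infty}g(x,t)=\infty$; and for every $M>0$ there is $l_M$ with $|g(x,t_1)-g(x,t_2)|\le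 l_M|t_1-t_2|$ for a.e. $x\in\Omega$ and all $|t_1|,|t_2|\le M$. Put $G(x,t)=\int_0^{|t|}g(x,r)\,dr$ and $U=\{u\in\tilde H^{s/2}(\Omega): G(\cdot,u(\cdot))\in L^1(\Omega)\}$, and let $f\in L^2(\Omega)$. Consider the problem $$-{}_0D^s_xu+g(x,u)=f\ \text{ in }\Omega,\qquad u(0)=u(1)=0. \tag{1}$$ A weak solution of (1) is a function $u\in U$ with $$-\int_\Omega {}_0D^{s/2}_xu\;{}_xD^{s/2}_1v\,dx+\int_\Omega g(x,u)\,v\,dx=\int_\Omega f v\,dx\qquad\text{for all }v\in U.$$ (i) There is a weak solution $u$ of (1), continuous on $[0,1]$ with $u(0)=u(1)=0$, that satisfies the differential equation in (1) a.e. in $\Omega$ and, for all $x\in[0,1]$, the nonlinear Volterra–Fredholm integral equation $$u(x)=x^{s-1}\big({}_0I^s_x(f-g(\cdot,u))\big)(1)-\big({}_0I^s_x(f-g(\cdot,u))\big)(x). \tag{2}$$ (ii) Every weak solution $u\in U$ of (1) satisfies (2) for a.e. $x\in\Omega$ and lies in $\{u\in H^\alpha(\Omega)\cap\tilde H^{s/2}(\Omega):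 G(\cdot,u(\cdot))\in L^1(\Omega)\}$ for every $0\le\alpha<s-\tfrac12$. -/

import Mathlib

open MeasureTheory Set Filter
open scoped ENNReal ContDiff

namespace FracBVP

noncomputable section

/-- The open unit interval. -/
abbrev Om : Set ℝ := Ioo 0 1

/-- Lebesgue measure on the unit interval. -/
abbrev muOm : Measure ℝ := volume.restrict Om

/-- Left Riemann–Liouville integral of order `s` with base point `0`. -/
def leftInt (s : ℝ) (u : ℝ → ℝ) (x : ℝ) : ℝ :=
  (1 / Real.Gamma s) * ∫ y in (0 : ℝ)..x, (x - y) ^ (s - 1) * u y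

/-- Right Riemann–Liouville integral of order `s` with end point `1`. -/
def rightInt (s : ℝ) (u : ℝ → ℝ) (x : ℝ) : ℝ :=
  (1 / Real.Gamma s) * ∫ y in x..(1 : ℝ), (y - x) ^ (s - 1) * u y

/-- `w` is the `k`-th weak (distributional) derivative of `u` on the open set `D`. -/
def HasWeakDeriv (k : ℕ) (D : Set ℝ) (u w : ℝ → ℝ) : Prop :=
  LocallyIntegrableOn u D ∧ LocallyIntegrableOn w D ∧
    ∀ φ : ℝ → ℝ, ContDiff ℝ ∞ φ → HasCompactSupport φ → tsupport φ ⊆ D →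
      ∫ x in D, u x * iteratedDeriv k φ x = (-1) ^ k * ∫ x in D, w x * φ x

/-- The square of the Slobodeckij seminorm of order `r ∈ (0, 1)` on `D`. -/
def slobodeckij (r : ℝ) (D : Set ℝ) (u : ℝ → ℝ) : ℝ≥0∞ :=
  ∫⁻ x in D, ∫⁻ y in D, ENNReal.ofReal ((u x - u y) ^ 2 / |x - y| ^ (1 + 2 * r))

/-- `u ∈ H^a(D)` for `a ≥ 0` and `D` open: the weak derivatives `w k` up to order `⌊a⌋` are in
`L²(D)`, and for non-integer `a` the one of order `⌊a⌋` has finite Slobodeckij seminorm of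
order `a - ⌊a⌋`. -/
def MemH (a : ℝ) (D : Set ℝ) (u : ℝ → ℝ) : Prop :=
  ∃ w : ℕ → ℝ → ℝ, w 0 = u ∧
    (∀ k ≤ ⌊a⌋₊, MemLp (w k) 2 (volume.restrict D) ∧ HasWeakDeriv k D u (w k)) ∧
    (Int.fract a ≠ 0 → slobodeckij (Int.fract a) D (w ⌊a⌋₊) < ⊤)

/-- `u ∈ H̃^a(0,1)`: `u` is in `H^a(0,1)` and its extension by zero is in `H^a(ℝ)`. -/
def MemHTilde (a : ℝ) (u : ℝ → ℝ) : Prop :=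
  MemH a Om u ∧ MemH a univ (Om.indicator u)

/-- `d ∈ L²(0,1)` is the left Riemann–Liouville derivative `Dⁿ I^{n-s} u` of non-integer order
`s > 0`, where `n - 1 < s < n` and `Dⁿ` is taken in the weak sense. -/
def HasLeftRLDeriv (s : ℝ) (u d : ℝ → ℝ) : Prop :=
  MemLp d 2 muOm ∧
    HasWeakDeriv (⌊s⌋₊ + 1) Om (leftInt (((⌊s⌋₊ + 1 : ℕ) : ℝ) - s) u) d

/-- `d ∈ L²(0,1)` is the right Riemann–Liouville derivative `(-1)ⁿ Dⁿ I^{n-s} u`. -/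
def HasRightRLDeriv (s : ℝ) (u d : ℝ → ℝ) : Prop :=
  MemLp d 2 muOm ∧
    HasWeakDeriv (⌊s⌋₊ + 1) Om (rightInt (((⌊s⌋₊ + 1 : ℕ) : ℝ) - s) u)
      (fun x => (-1) ^ (⌊s⌋₊ + 1) * d x)

open Classical in
/-- The left Riemann–Liouville derivative as a function (unique up to a null set); `0` if it
does not exist in `L²(0,1)`, which does not occur on `H̃^s(0,1)`. -/
def leftRLDeriv (s : ℝ) (u : ℝ → ℝ) : ℝ → ℝ :=
  if h : ∃ d, HasLeftRLDeriv s u d then h.choose else 0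

open Classical in
/-- The right Riemann–Liouville derivative as a function (unique up to a null set); `0` if it
does not exist in `L²(0,1)`, which does not occur on `H̃^s(0,1)`. -/
def rightRLDeriv (s : ℝ) (u : ℝ → ℝ) : ℝ → ℝ :=
  if h : ∃ d, HasRightRLDeriv s u d then h.choose else 0

/-- Structural assumptions on the nonlinearity `g(x,t)`. -/
structure NonlinAssumption (g : ℝ → ℝ → ℝ) : Prop where
  continuous : ∀ᵐ x ∂muOm, Continuous (g x)
  odd : ∀ᵐ x ∂muOm, ∀ t, g x (-t) = -g x t
  strictMono : ∀ᵐ x ∂muOm, StrictMono (g x)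
  zero : ∀ᵐ x ∂muOm, g x 0 = 0
  tendsto : ∀ᵐ x ∂muOm, Tendsto (g x) atTop atTop
  measurable : ∀ t, AEMeasurable (fun x => g x t) muOm

/-- Local Lipschitz condition in the second variable, uniform in the first one. -/
def LocLipschitz (g : ℝ → ℝ → ℝ) : Prop :=
  ∀ M : ℝ, 0 < M → ∃ l : ℝ, ∀ᵐ x ∂muOm, ∀ t₁ t₂ : ℝ, |t₁| ≤ M → |t₂| ≤ M →
    |g x t₁ - g x t₂| ≤ l * |t₁ - t₂|

/-- The primitive `G(x,t) = ∫₀^{|t|} g(x,r) dr`. -/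
def primG (g : ℝ → ℝ → ℝ) (x t : ℝ) : ℝ := ∫ r in (0 : ℝ)..|t|, g x r

/-- The energy space `U = {u ∈ H̃^{s/2}(0,1) : G(·,u) ∈ L¹(0,1)}`. -/
def MemU (s : ℝ) (g : ℝ → ℝ → ℝ) (u : ℝ → ℝ) : Prop :=
  MemHTilde (s / 2) u ∧ Integrable (fun x => primG g x (u x)) muOm

/-- The regularity class `{u ∈ H^a(0,1) ∩ H̃^{s/2}(0,1) : G(·,u) ∈ L¹(0,1)}`. -/
def MemUReg (a s : ℝ) (g : ℝ → ℝ → ℝ) (u : ℝ → ℝ) : Prop :=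
  MemH a Om u ∧ MemHTilde (s / 2) u ∧ Integrable (fun x => primG g x (u x)) muOm

/-- The bilinear form `A(u,v) = -(D^{s/2} u, D^{s/2} v)`, with the left derivative of `u` and the
right derivative of `v`. -/
def formA (s : ℝ) (u v : ℝ → ℝ) : ℝ :=
  -∫ x in Om, leftRLDeriv (s / 2) u x * rightRLDeriv (s / 2) v x

/-- The form `B(u,v) = (g(·,u), v)`. -/
def formB (g : ℝ → ℝ → ℝ) (u v : ℝ → ℝ) : ℝ := ∫ x in Om, g x (u x) * v x

/-- `u ∈ U` is a weak solution of `-D^s u + g(x,u) = f`, `u(0) = u(1) = 0`. -/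
def IsWeakSolution (s : ℝ) (g : ℝ → ℝ → ℝ) (f u : ℝ → ℝ) : Prop :=
  MemU s g u ∧ ∀ v, MemU s g v → formA s u v + formB g u v = ∫ x in Om, f x * v x

/-- `u` is continuous on `[0,1]`, vanishes at both end points and satisfies
`-D^s u + g(x,u) = f` almost everywhere in `(0,1)`. -/
def IsStrongSolution (s : ℝ) (g : ℝ → ℝ → ℝ) (f u : ℝ → ℝ) : Prop :=
  ContinuousOn u (Icc 0 1) ∧ u 0 = 0 ∧ u 1 = 0 ∧
    ∃ d, HasLeftRLDeriv s u d ∧ ∀ᵐ x ∂muOm, -d x + g x (u x) = f x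

/-- The Volterra–Fredholm integral equation at the point `x`. -/
def IntegralEqAt (s : ℝ) (g : ℝ → ℝ → ℝ) (f u : ℝ → ℝ) (x : ℝ) : Prop :=
  u x = x ^ (s - 1) * leftInt s (fun y => f y - g y (u y)) 1
    - leftInt s (fun y => f y - g y (u y)) x

end

end FracBVP

open MeasureTheory Set Filter
open scoped ENNReal ContDiff

namespace FracBVP

noncomputable section

section

/-! ### The Riemann–Liouville kernel -/

/-! Write `I^σ` for left fractional integration from `0` and regard it as convolution with `rk σ` on
the line (`fracInt`). For `h ∈ L²` the right-hand side of (2), with `h` in place of `f - g(·,u)`, is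
`green s h`; it is the order-`s` potential of the signed measure `c δ₀ - h dx`, where `c` is the
mass that makes it vanish at `1` (`green_eq`). The semigroup law holds for such potentials
(`fracInt_pot`), so applying `I^(2-s)` and differentiating twice leaves `-h`: `green s h` solves the
linear equation. Increment estimates for the kernel give it Hölder order `s - 1` and Sobolev order
below `s - 1/2`. Together with the zero boundary values this puts it in `H̃^(s/2)` (`memH_green`,
`memHTilde_green`).

Linear theory. A function `u ∈ H̃^(s/2)` has a left derivative `d ∈ L²` of order `s/2`
(`exists_hasLeftRLDeriv`: difference quotients bounded in `L²`, weak compactness). Moreover `u =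
I^(s/2) d`, and this integral vanishes at `1`, because a function whose zero extension has finite
seminorm of order `s/2 > 1/2` cannot stay away from zero near an end point
(`MemHTilde.ae_eq_fracInt`, `MemHTilde.fracInt_one_eq_zero`). Hence `u` is essentially bounded, the
integrability of `G(·,u)` is automatic, and Fubini gives `A(green s h, v) = ∫ h v` (`formA_green`).

Part (ii). By reflection, the reflected Green potential of the reflected `p` satisfies `A(w, ·) = ∫
p w` for all `w` in the space. Inserting it as a test function identifies any weak solution with
`green s (f - g(·,u))` (`IsWeakSolution.ae_eq_green`). Neither coercivity nor uniqueness enters, and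
regularity is inherited from the Green potential.

Part (i). One needs `h = f - g(·, green s h)`, an equation of Hammerstein type. With `W` the
derivative of `green s h`, the pairing `∫ h · green s h` is a double integral of `W(x) W(y)` against
a one-sided power kernel; its symmetrization is a multiple of `‖I^(1-s/2) W‖²`. Since `green s h =
I^(s/2) I^(1-s/2) W` and `s/2 > 1/2`, the pairing controls the square of the maximum norm
(`exists_green_coercive`). After truncation `g` is monotone and Lipschitz, and a resolvent turns the
equation into a contraction (`exists_eq_map_sub`). Coercivity and the sign of `t g(x,t)` give a
maximum bound independent of the truncation level, so a high enough level is never reached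
(`exists_green_solution`). -/

/-- The Riemann–Liouville kernel `t₊^(σ-1) / Γ(σ)`. -/
def rk (σ t : ℝ) : ℝ := if 0 < t then t ^ (σ - 1) / Real.Gamma σ else 0

lemma rk_of_pos {σ t : ℝ} (ht : 0 < t) : rk σ t = t ^ (σ - 1) / Real.Gamma σ := if_pos ht

lemma rk_of_nonpos {σ t : ℝ} (ht : t ≤ 0) : rk σ t = 0 := if_neg ht.not_gt

lemma rk_one_of_pos {t : ℝ} (ht : 0 < t) : rk 1 t = 1 := by simp [rk_of_pos ht]

@[fun_prop]
lemma measurable_rk (σ : ℝ) : Measurable (rk σ) :=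
  Measurable.ite measurableSet_Ioi (by fun_prop) (by fun_prop)

lemma rk_nonneg {σ : ℝ} (hσ : 0 < σ) (t : ℝ) : 0 ≤ rk σ t := by
  unfold rk
  split_ifs with h
  · have := Real.Gamma_pos_of_pos hσ
    positivity
  · rfl

lemma lintegral_scale {L : ℝ} (hL : 0 < L) (F : ℝ → ℝ≥0∞) (hF : Measurable F) :
    ∫⁻ y, F y = ENNReal.ofReal L * ∫⁻ t, F (L * t) := by
  have h := Real.smul_map_volume_mul_left hL.ne'
  conv_lhs => rw [← h]
  rw [lintegral_smul_measure, lintegral_map hF (by fun_prop), abs_of_pos hL, smul_eq_mul]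

/-- Substituting `y = z + L t` with `L = x - z` turns the product into a multiple of the Beta
density, whose total mass is one. Working with `lintegral` yields integrability and the value at the
same time. -/
lemma lintegral_rk_mul_rk {a b : ℝ} (ha : 0 < a) (hb : 0 < b) (x z : ℝ) :
    ∫⁻ y, ENNReal.ofReal (rk a (x - y) * rk b (y - z)) = ENNReal.ofReal (rk (a + b) (x - z)) := by
  rcases le_or_gt (x - z) 0 with h | h
  · rw [rk_of_nonpos h, ENNReal.ofReal_zero]
    refine lintegral_eq_zero_of_ae_eq_zero (ae_of_all _ fun y => ?_)
    rcases le_or_gt (x - y) 0 with h1 | h1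
    · simp [rk_of_nonpos h1]
    · have h2 : y - z ≤ 0 := by linarith
      simp [rk_of_nonpos h2]
  · set L := x - z with hL
    have key : ∀ t, rk a (x - (L * t + z)) * rk b (L * t + z - z)
        = L ^ (a + b - 2) / Real.Gamma (a + b) * ProbabilityTheory.betaPDFReal b a t := by
      intro t
      have e1 : x - (L * t + z) = L * (1 - t) := by rw [hL]; ring
      rw [e1, add_sub_cancel_right]
      have hGa := Real.Gamma_pos_of_pos ha
      have hGb := Real.Gamma_pos_of_pos hb
      have hGab := Real.Gamma_pos_of_pos (add_pos ha hb)
      unfold ProbabilityTheory.betaPDFReal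
      split_ifs with ht
      · have h1 : 0 < 1 - t := by linarith [ht.2]
        rw [rk_of_pos (mul_pos h h1), rk_of_pos (mul_pos h ht.1),
          Real.mul_rpow h.le h1.le, Real.mul_rpow h.le ht.1.le]
        have e2 : L ^ (a + b - 2) = L ^ (a - 1) * L ^ (b - 1) := by
          rw [← Real.rpow_add h]; congr 1; ring
        rw [e2, ProbabilityTheory.beta, add_comm b a]
        field_simp
      · rw [mul_zero]
        by_cases h0 : 0 < t
        · have h1 : 1 - t ≤ 0 := by by_contra hc; exact ht ⟨h0, by linarith⟩
          rw [rk_of_nonpos (mul_nonpos_of_nonneg_of_nonpos h.le h1), zero_mul]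
        · rw [rk_of_nonpos (mul_nonpos_of_nonneg_of_nonpos h.le (not_lt.1 h0)), mul_zero]
    rw [← lintegral_add_right_eq_self _ z, lintegral_scale h _ (by fun_prop)]
    simp_rw [key]
    have hc : 0 ≤ L ^ (a + b - 2) / Real.Gamma (a + b) := by
      have := Real.Gamma_pos_of_pos (add_pos ha hb); positivity
    simp_rw [ENNReal.ofReal_mul hc]
    rw [lintegral_const_mul _ (by fun_prop)]
    have := ProbabilityTheory.lintegral_betaPDF_eq_one hb ha
    unfold ProbabilityTheory.betaPDF at this
    rw [this, mul_one, ← ENNReal.ofReal_mul h.le, rk_of_pos h]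
    congr 1
    have e3 : L ^ (a + b - 1) = L * L ^ (a + b - 2) := by
      nth_rw 2 [← Real.rpow_one L]
      rw [← Real.rpow_add h]; congr 1; ring
    rw [e3]; ring

lemma integrable_rk_mul_rk {a b : ℝ} (ha : 0 < a) (hb : 0 < b) (x z : ℝ) :
    Integrable fun y => rk a (x - y) * rk b (y - z) := by
  refine ⟨by fun_prop, ?_⟩
  rw [hasFiniteIntegral_iff_ofReal
    (ae_of_all _ fun y => mul_nonneg (rk_nonneg ha _) (rk_nonneg hb _)), lintegral_rk_mul_rk ha hb]
  exact ENNReal.ofReal_lt_top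

lemma integral_rk_mul_rk {a b : ℝ} (ha : 0 < a) (hb : 0 < b) (x z : ℝ) :
    ∫ y, rk a (x - y) * rk b (y - z) = rk (a + b) (x - z) := by
  rw [integral_eq_lintegral_of_nonneg_ae
    (ae_of_all _ fun y => mul_nonneg (rk_nonneg ha _) (rk_nonneg hb _))
    (by fun_prop), lintegral_rk_mul_rk ha hb,
    ENNReal.toReal_ofReal (rk_nonneg (add_pos ha hb) _)]

/-- The Riemann–Liouville integral from `-∞` of a function on the line. -/
def fracInt (σ : ℝ) (W : ℝ → ℝ) (x : ℝ) : ℝ := ∫ y, rk σ (x - y) * W y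

/-- By Tonelli: integrating in `y` first merges the two kernels into `rk (a + b)`, so the hypothesis
is exactly what absolute convergence requires. -/
lemma integrable_prod_rk {a b : ℝ} (ha : 0 < a) (hb : 0 < b) {W : ℝ → ℝ}
    (hW : AEStronglyMeasurable W volume) {x : ℝ}
    (h : Integrable fun z => rk (a + b) (x - z) * W z) :
    Integrable (fun p : ℝ × ℝ => rk a (x - p.1) * (rk b (p.1 - p.2) * W p.2))
      (volume.prod volume) := by
  have hm : AEStronglyMeasurable (fun p : ℝ × ℝ => rk a (x - p.1) * (rk b (p.1 - p.2) * W p.2))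
      (volume.prod volume) := by
    refine AEStronglyMeasurable.mul ?_ (AEStronglyMeasurable.mul ?_ hW.comp_snd)
    all_goals exact Measurable.aestronglyMeasurable (by fun_prop)
  rw [integrable_prod_iff' hm]
  refine ⟨ae_of_all _ fun z => ?_, ?_⟩
  · simpa only [mul_assoc] using (integrable_rk_mul_rk ha hb x z).mul_const (W z)
  · refine h.norm.congr (ae_of_all _ fun z => ?_)
    have : ∀ y, ‖rk a (x - y) * (rk b (y - z) * W z)‖ = rk a (x - y) * rk b (y - z) * ‖W z‖ := by
      intro y
      rw [norm_mul, norm_mul, Real.norm_of_nonneg (rk_nonneg ha _),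
        Real.norm_of_nonneg (rk_nonneg hb _), mul_assoc]
    simp only [this]
    rw [integral_mul_const, integral_rk_mul_rk ha hb, norm_mul,
      Real.norm_of_nonneg (rk_nonneg (add_pos ha hb) _)]

lemma integrable_rk_mul_fracInt {a b : ℝ} (ha : 0 < a) (hb : 0 < b) {W : ℝ → ℝ}
    (hW : AEStronglyMeasurable W volume) {x : ℝ}
    (h : Integrable fun z => rk (a + b) (x - z) * W z) :
    Integrable fun y => rk a (x - y) * fracInt b W y := by
  have := (integrable_prod_rk ha hb hW h).integral_prod_left
  simpa only [integral_const_mul, fracInt] using this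

/-- The semigroup property of fractional integration. -/
theorem fracInt_fracInt {a b : ℝ} (ha : 0 < a) (hb : 0 < b) {W : ℝ → ℝ}
    (hW : AEStronglyMeasurable W volume) {x : ℝ}
    (h : Integrable fun z => rk (a + b) (x - z) * W z) :
    fracInt a (fracInt b W) x = fracInt (a + b) W x := by
  have h1 := integral_integral_swap (f := fun y z => rk a (x - y) * (rk b (y - z) * W z))
    (integrable_prod_rk ha hb hW h)
  simp only [integral_const_mul] at h1
  unfold fracInt
  rw [h1]
  refine integral_congr_ae (ae_of_all _ fun z => ?_)
  simp only [← mul_assoc]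
  rw [integral_mul_const, integral_rk_mul_rk ha hb]

lemma rk_le_of_one_le {σ : ℝ} (hσ : 1 ≤ σ) {t x : ℝ} (h : t ≤ x) (hx : 0 ≤ x) :
    rk σ t ≤ x ^ (σ - 1) / Real.Gamma σ := by
  have hG := Real.Gamma_pos_of_pos (zero_lt_one.trans_le hσ)
  rcases le_or_gt t 0 with h0 | h0
  · rw [rk_of_nonpos h0]; positivity
  · rw [rk_of_pos h0]
    gcongr

/-- From order one on the kernel is bounded on the relevant range. This is why the semigroup law can
be used at every point, not merely almost everywhere, once the total order is at least one. -/
lemma integrable_rk_mul_of_one_le {σ : ℝ} (hσ : 1 ≤ σ) {W : ℝ → ℝ} (hW : Integrable W)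
    (hs : ∀ z < 0, W z = 0) (x : ℝ) : Integrable fun z => rk σ (x - z) * W z := by
  refine (hW.norm.const_mul (|x| ^ (σ - 1) / Real.Gamma σ)).mono'
    (AEStronglyMeasurable.mul (Measurable.aestronglyMeasurable (by fun_prop)) hW.1) (ae_of_all _ fun z => ?_)
  rcases lt_or_ge z 0 with h | h
  · simp [hs z h]
  · rw [norm_mul, Real.norm_of_nonneg (rk_nonneg (by linarith) _)]
    gcongr
    exact rk_le_of_one_le hσ (by linarith [le_abs_self x]) (abs_nonneg x)

/-- The kernel `rk 1 (b - ·)` is the indicator of `Iio b`, so this is an instance of the convergence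
of an iterated integral of total order `1 + σ`. -/
lemma integrableOn_fracInt {σ : ℝ} (hσ : 0 < σ) {W : ℝ → ℝ} (hW : Integrable W)
    (hs : ∀ z < 0, W z = 0) (b : ℝ) : IntegrableOn (fracInt σ W) (Iio b) := by
  have := integrable_rk_mul_fracInt one_pos hσ hW.1 (x := b)
    (integrable_rk_mul_of_one_le (by linarith) hW hs b)
  rw [← integrable_indicator_iff measurableSet_Iio]
  refine this.congr (ae_of_all _ fun y => ?_)
  by_cases h : y < b
  · rw [indicator_of_mem (mem_Iio.2 h)]; simp [rk_one_of_pos (sub_pos.2 h)]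
  · rw [indicator_of_notMem (by simpa using h)]
    simp [rk_of_nonpos (show b - y ≤ 0 by linarith [not_lt.1 h])]

lemma fracInt_of_nonpos {σ : ℝ} {W : ℝ → ℝ} (hs : ∀ z ≤ 0, W z = 0) {x : ℝ} (hx : x ≤ 0) :
    fracInt σ W x = 0 := by
  unfold fracInt
  refine integral_eq_zero_of_ae (ae_of_all _ fun y => ?_)
  rcases le_or_gt y 0 with h | h
  · simp [hs y h]
  · simp [rk_of_nonpos (show x - y ≤ 0 by linarith)]

lemma fracInt_congr {σ : ℝ} {W V : ℝ → ℝ} {x : ℝ} (h : ∀ᵐ y, y < x → W y = V y) :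
    fracInt σ W x = fracInt σ V x := by
  refine integral_congr_ae ?_
  filter_upwards [h] with y hy
  rcases le_or_gt x y with h1 | h1
  · simp [rk_of_nonpos (sub_nonpos.2 h1)]
  · simp [hy h1]

lemma fracInt_indicator {σ : ℝ} {w : ℝ → ℝ} {x : ℝ} :
    fracInt σ (Om.indicator w) x = ∫ y in Om, rk σ (x - y) * w y := by
  unfold fracInt
  rw [← integral_indicator measurableSet_Ioo]
  congr 1; ext y
  rw [indicator_mul_right]

/-- The cutoff at `1` costs nothing because the kernel vanishes beyond `x ≤ 1`. This is the bridge
from the interval to convolutions on the line. -/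
lemma leftInt_eq_fracInt (σ : ℝ) (w : ℝ → ℝ) {x : ℝ} (hx : x ∈ Icc (0 : ℝ) 1) :
    leftInt σ w x = fracInt σ (Om.indicator w) x := by
  rw [leftInt, intervalIntegral.integral_of_le hx.1, integral_Ioc_eq_integral_Ioo,
    ← integral_const_mul, fracInt_indicator, ← integral_indicator measurableSet_Ioo,
    ← integral_indicator measurableSet_Ioo]
  congr 1; ext y
  by_cases h : y ∈ Om
  · rw [indicator_of_mem h]
    by_cases h1 : y < x
    · rw [indicator_of_mem (show y ∈ Ioo 0 x from ⟨h.1, h1⟩), rk_of_pos (sub_pos.2 h1)]; ring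
    · rw [indicator_of_notMem (fun hc => h1 hc.2), rk_of_nonpos (by linarith [not_lt.1 h1])]; ring
  · rw [indicator_of_notMem h, indicator_of_notMem (fun hc => h ⟨hc.1, hc.2.trans_le hx.2⟩)]

lemma fracInt_rk {a b : ℝ} (ha : 0 < a) (hb : 0 < b) (x : ℝ) :
    fracInt a (rk b) x = rk (a + b) x := by
  simpa [fracInt] using integral_rk_mul_rk ha hb x 0

end

section

/-! ### Weak derivatives on the unit interval -/

/-- Smooth functions with compact support in the unit interval. -/
structure IsTest (φ : ℝ → ℝ) : Prop where
  smooth : ContDiff ℝ ∞ φ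
  compact : HasCompactSupport φ
  supp : tsupport φ ⊆ Om

namespace IsTest

variable {φ ψ : ℝ → ℝ}

lemma deriv (h : IsTest φ) : IsTest (deriv φ) :=
  ⟨((contDiff_infty_iff_deriv.1 h.smooth).2), h.compact.deriv,
    tsupport_deriv_subset.trans h.supp⟩

lemma continuous (h : IsTest φ) : Continuous φ := h.smooth.continuous

lemma eq_zero (h : IsTest φ) {x : ℝ} (hx : x ∉ Om) : φ x = 0 :=
  image_eq_zero_of_notMem_tsupport fun hc => hx (h.supp hc)

lemma indicator_eq (h : IsTest φ) : Om.indicator φ = φ :=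
  indicator_eq_self.2 ((subset_tsupport φ).trans h.supp)

lemma integrable (h : IsTest φ) : Integrable φ :=
  h.continuous.integrable_of_hasCompactSupport h.compact

lemma exists_bound (h : IsTest φ) : ∃ C, ∀ x, ‖φ x‖ ≤ C :=
  h.compact.exists_bound_of_continuous h.continuous

lemma integrable_mul (h : IsTest φ) {v : ℝ → ℝ} {μ : Measure ℝ} (hv : Integrable v μ) :
    Integrable (fun x => v x * φ x) μ := by
  obtain ⟨C, hC⟩ := h.exists_bound
  exact hv.mul_bdd h.continuous.aestronglyMeasurable (ae_of_all _ hC)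

lemma setIntegral_mul (h : IsTest φ) (v : ℝ → ℝ) :
    ∫ x in Om, v x * φ x = ∫ x, v x * φ x := by
  rw [← integral_indicator measurableSet_Ioo]
  congr 1; ext x
  rw [indicator_mul_right, h.indicator_eq]

lemma integral_deriv (h : IsTest φ) : ∫ x, _root_.deriv φ x = 0 :=
  integral_eq_zero_of_hasDerivAt_of_integrable
    (fun x => ((h.smooth.differentiable (by simp)) x).hasDerivAt) h.deriv.integrable h.integrable

lemma integral_rk_one_mul_deriv (h : IsTest φ) (y : ℝ) :
    ∫ x, rk 1 (x - y) * _root_.deriv φ x = - φ y := by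
  rw [← h.compact.integral_Ioi_deriv_eq (h.smooth.of_le (by exact_mod_cast le_top)) y,
    ← integral_indicator measurableSet_Ioi]
  congr 1; ext x
  by_cases hx : y < x
  · rw [indicator_of_mem (mem_Ioi.2 hx), rk_one_of_pos (sub_pos.2 hx), one_mul]
  · rw [indicator_of_notMem (by simpa using hx), rk_of_nonpos (by linarith [not_lt.1 hx]), zero_mul]

end IsTest

lemma hasWeakDeriv_iff {k : ℕ} {u w : ℝ → ℝ} : HasWeakDeriv k Om u w ↔
    LocallyIntegrableOn u Om ∧ LocallyIntegrableOn w Om ∧ ∀ φ, IsTest φ →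
      ∫ x in Om, u x * iteratedDeriv k φ x = (-1) ^ k * ∫ x in Om, w x * φ x :=
  ⟨fun h => ⟨h.1, h.2.1, fun φ hφ => h.2.2 φ hφ.1 hφ.2 hφ.3⟩,
    fun h => ⟨h.1, h.2.1, fun φ h1 h2 h3 => h.2.2 φ ⟨h1, h2, h3⟩⟩⟩

lemma HasWeakDeriv.congr_ae {k : ℕ} {u w u' w' : ℝ → ℝ} (h : HasWeakDeriv k Om u w)
    (hu : u =ᵐ[muOm] u') (hw : w =ᵐ[muOm] w') : HasWeakDeriv k Om u' w' := by
  refine ⟨h.1.congr hu, h.2.1.congr hw, fun φ h1 h2 h3 => ?_⟩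
  have e1 : ∫ x in Om, u' x * iteratedDeriv k φ x = ∫ x in Om, u x * iteratedDeriv k φ x :=
    integral_congr_ae (hu.symm.mono fun x hx => by simp only [hx])
  have e2 : ∫ x in Om, w' x * φ x = ∫ x in Om, w x * φ x :=
    integral_congr_ae (hw.symm.mono fun x hx => by simp only [hx])
  rw [e1, e2]
  exact h.2.2 φ h1 h2 h3

lemma HasWeakDeriv.comp_one {u v w : ℝ → ℝ} (h : HasWeakDeriv 1 Om u v)
    (h' : HasWeakDeriv 1 Om v w) : HasWeakDeriv 2 Om u w := by
  rw [hasWeakDeriv_iff] at *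
  refine ⟨h.1, h'.2.1, fun φ hφ => ?_⟩
  have e1 := h.2.2 _ hφ.deriv
  have e2 := h'.2.2 _ hφ
  rw [iteratedDeriv_succ', e1, ← iteratedDeriv_one, e2]
  ring

lemma ae_eq_zero_of_test {w : ℝ → ℝ} (hw : LocallyIntegrableOn w Om)
    (h : ∀ φ, IsTest φ → ∫ x in Om, w x * φ x = 0) : w =ᵐ[muOm] 0 := by
  refine (ae_restrict_iff' measurableSet_Ioo).2 ?_
  refine isOpen_Ioo.ae_eq_zero_of_integral_contDiff_smul_eq_zero hw fun φ h1 h2 h3 => ?_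
  have hφ : IsTest φ := ⟨h1, h2, h3⟩
  rw [← h φ hφ, hφ.setIntegral_mul]
  simp [mul_comm]

lemma ae_eq_of_test {v w : ℝ → ℝ} (hv : IntegrableOn v Om) (hw : IntegrableOn w Om)
    (h : ∀ φ, IsTest φ → ∫ x in Om, v x * φ x = ∫ x in Om, w x * φ x) : v =ᵐ[muOm] w := by
  have := ae_eq_zero_of_test (w := fun x => v x - w x) (hv.sub hw).locallyIntegrableOn fun φ hφ => by
    simp_rw [sub_mul]
    rw [integral_sub (hφ.integrable_mul hv) (hφ.integrable_mul hw), h φ hφ, sub_self]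
  filter_upwards [this] with x hx
  simpa [sub_eq_zero] using hx

lemma HasWeakDeriv.ae_unique {k : ℕ} {u v w : ℝ → ℝ} (h : HasWeakDeriv k Om u v)
    (h' : HasWeakDeriv k Om u w) (hv : IntegrableOn v Om) (hw : IntegrableOn w Om) :
    v =ᵐ[muOm] w := by
  rw [hasWeakDeriv_iff] at *
  refine ae_eq_of_test hv hw fun φ hφ => ?_
  have := (h.2.2 φ hφ).symm.trans (h'.2.2 φ hφ)
  exact mul_left_cancel₀ (by simp) this

lemma indicator_Om_of_neg (w : ℝ → ℝ) : ∀ z < 0, Om.indicator w z = 0 :=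
  fun z hz => indicator_of_notMem (fun h => by linarith [h.1]) _

lemma indicator_Om_of_nonpos (w : ℝ → ℝ) : ∀ z ≤ 0, Om.indicator w z = 0 :=
  fun z hz => indicator_of_notMem (fun h => by linarith [h.1]) _

lemma integrable_indicator_Om {w : ℝ → ℝ} (hw : IntegrableOn w Om) :
    Integrable (Om.indicator w) := (integrable_indicator_iff measurableSet_Ioo).2 hw

lemma integrableOn_fracInt_Om {σ : ℝ} (hσ : 0 < σ) {w : ℝ → ℝ} (hw : IntegrableOn w Om) :
    IntegrableOn (fracInt σ (Om.indicator w)) Om :=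
  (integrableOn_fracInt hσ (integrable_indicator_Om hw) (indicator_Om_of_neg w) 1).mono_set
    fun _ h => h.2

/-- Fubini moves the step kernel onto `φ'`, and the integral of `φ'` over `(y, ∞)` is `-φ y`. -/
lemma IsTest.integral_fracInt_one_mul_deriv {φ w : ℝ → ℝ} (hφ : IsTest φ)
    (hw : IntegrableOn w Om) :
    ∫ x in Om, fracInt 1 (Om.indicator w) x * _root_.deriv φ x = - ∫ x in Om, w x * φ x := by
  set W := Om.indicator w
  have hW : Integrable W := integrable_indicator_Om hw
  rw [hφ.deriv.setIntegral_mul]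
  unfold fracInt
  have hint : Integrable (fun p : ℝ × ℝ => rk 1 (p.1 - p.2) * W p.2 * _root_.deriv φ p.1)
      (volume.prod volume) := by
    have h0 := hφ.deriv.integrable.mul_prod hW
    refine h0.mono ?_ (ae_of_all _ fun p => ?_)
    · exact ((Measurable.aestronglyMeasurable (by fun_prop)).mul hW.1.comp_snd).mul
        hφ.deriv.integrable.1.comp_fst
    · simp only [norm_mul]
      have : ‖rk 1 (p.1 - p.2)‖ ≤ 1 := by
        rw [Real.norm_of_nonneg (rk_nonneg one_pos _)]
        rcases le_or_gt (p.1 - p.2) 0 with h | h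
        · simp [rk_of_nonpos h]
        · simp [rk_one_of_pos h]
      calc _ ≤ 1 * ‖W p.2‖ * ‖_root_.deriv φ p.1‖ := by gcongr
        _ = _ := by ring
  have hsw := integral_integral_swap
    (f := fun x y => rk 1 (x - y) * W y * _root_.deriv φ x) hint
  simp only [integral_mul_const] at hsw
  rw [hsw, hφ.setIntegral_mul, ← integral_neg]
  congr 1; ext y
  have : ∀ x, rk 1 (x - y) * W y * _root_.deriv φ x = rk 1 (x - y) * _root_.deriv φ x * W y :=
    fun x => by ring
  simp only [this]
  rw [integral_mul_const, hφ.integral_rk_one_mul_deriv]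
  by_cases hy : y ∈ Om
  · rw [show W y = w y from indicator_of_mem hy _]; ring
  · rw [hφ.eq_zero hy]; ring

/-- A primitive has the expected weak derivative. -/
lemma hasWeakDeriv_primitive {v w : ℝ → ℝ} (hw : IntegrableOn w Om) (c : ℝ)
    (hv : v =ᵐ[muOm] fun x => c + fracInt 1 (Om.indicator w) x) : HasWeakDeriv 1 Om v w := by
  have hI := integrableOn_fracInt_Om one_pos hw
  have hc : IntegrableOn (fun _ : ℝ => c) Om := integrableOn_const (by simp)
  refine HasWeakDeriv.congr_ae ?_ hv.symm (EventuallyEq.rfl)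
  rw [hasWeakDeriv_iff]
  refine ⟨(hc.add hI).locallyIntegrableOn, hw.locallyIntegrableOn, fun φ hφ => ?_⟩
  simp only [iteratedDeriv_one, add_mul]
  rw [integral_add (hφ.deriv.integrable_mul hc) (hφ.deriv.integrable_mul hI),
    hφ.integral_fracInt_one_mul_deriv hw, hφ.deriv.setIntegral_mul (fun _ => c),
    integral_const_mul, hφ.integral_deriv]
  ring

/-! ### Primitives of test functions and the du Bois-Reymond lemma. -/

lemma exists_isTest_integral_eq_one : ∃ η, IsTest η ∧ ∫ x, η x = 1 := by
  let b : ContDiffBump (1 / 2 : ℝ) := ⟨1 / 8, 1 / 4, by norm_num, by norm_num⟩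
  refine ⟨b.normed volume, ⟨b.contDiff_normed, b.hasCompactSupport_normed, ?_⟩, b.integral_normed⟩
  rw [b.tsupport_normed_eq]
  intro x hx
  have : |x - 1 / 2| ≤ 1 / 4 := by
    rw [Metric.mem_closedBall, Real.dist_eq] at hx
    exact hx
  rw [abs_le] at this
  constructor <;> linarith [this.1, this.2]

lemma IsTest.exists_Icc {φ : ℝ → ℝ} (h : IsTest φ) :
    ∃ a b, 0 < a ∧ a < b ∧ b < 1 ∧ tsupport φ ⊆ Icc a b := by
  rcases (tsupport φ).eq_empty_or_nonempty with he | hne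
  · exact ⟨1 / 4, 1 / 2, by norm_num, by norm_num, by norm_num, by simp [he]⟩
  · obtain ⟨m, hm, hm'⟩ := h.compact.isCompact.exists_isLeast hne
    obtain ⟨M, hM, hM'⟩ := h.compact.isCompact.exists_isGreatest hne
    have h1 := h.supp hm
    have h2 := h.supp hM
    have h3 : m ≤ M := hm' hM
    exact ⟨m / 2, M, by linarith [h1.1], by linarith [h1.1], h2.2,
      fun x hx => ⟨by linarith [hm' hx, h1.1], hM' hx⟩⟩

/-- Zero mean is what makes the primitive vanish to the right of the support as well. -/
lemma IsTest.exists_primitive {θ : ℝ → ℝ} (h : IsTest θ) (h0 : ∫ x, θ x = 0) :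
    ∃ Θ, IsTest Θ ∧ _root_.deriv Θ = θ := by
  obtain ⟨a, b, ha, hab, hb, hsub⟩ := h.exists_Icc
  let Θ : ℝ → ℝ := fun x => ∫ t in a..x, θ t
  have hd : ∀ x, HasDerivAt Θ (θ x) x := fun x =>
    intervalIntegral.integral_hasDerivAt_right (h.continuous.intervalIntegrable _ _)
      (h.continuous.stronglyMeasurableAtFilter _ _) h.continuous.continuousAt
  have hderiv : _root_.deriv Θ = θ := funext fun x => (hd x).deriv
  have hz : ∀ x, x ∉ Icc a b → θ x = 0 := fun x hx =>
    image_eq_zero_of_notMem_tsupport fun hc => hx (hsub hc)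
  have hsupp : ∀ x, x ∉ Icc a b → Θ x = 0 := by
    intro x hx
    rw [mem_Icc, not_and_or, not_le, not_le] at hx
    rcases hx with hx | hx
    · refine intervalIntegral.integral_zero_ae (ae_of_all _ fun t ht => ?_)
      rw [uIoc_of_ge hx.le] at ht
      -- The end point `a` may belong to the support of `θ`; there `θ a = 0` follows by continuity,
      -- since `θ` vanishes to the left of `a`.
      by_cases hta : t = a
      · subst hta
        by_contra hne
        have : t ∈ closure (Iio t) := by simp
        have hc : θ t ∈ closure ({0} : Set ℝ) := by
          refine map_mem_closure h.continuous this fun y hy => ?_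
          exact hz y fun hc => by simp at hy; linarith [hc.1]
        simp at hc; exact hne hc
      · exact hz t fun hc => hta (le_antisymm ht.2 hc.1)
    · have : ∫ t in a..x, θ t = ∫ t, θ t := by
        rw [intervalIntegral.integral_of_le (by linarith), ← integral_Icc_eq_integral_Ioc,
          setIntegral_eq_integral_of_forall_compl_eq_zero]
        exact fun t ht => hz t fun hc => ht ⟨hc.1, hc.2.trans hx.le⟩
      exact this.trans h0
  have hts : tsupport Θ ⊆ Icc a b :=
    closure_minimal (fun x hx => by_contra fun hc => hx (hsupp x hc)) isClosed_Icc
  refine ⟨Θ, ⟨?_, isCompact_Icc.of_isClosed_subset (isClosed_tsupport _) hts,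
    hts.trans fun x hx => ⟨by linarith [hx.1], by linarith [hx.2]⟩⟩, hderiv⟩
  rw [contDiff_infty_iff_deriv, hderiv]
  exact ⟨fun x => (hd x).differentiableAt, h.smooth⟩

/-- A function with an integrable weak derivative is, up to a constant, its primitive. -/
lemma HasWeakDeriv.exists_ae_eq {v w : ℝ → ℝ} (h : HasWeakDeriv 1 Om v w)
    (hv : IntegrableOn v Om) (hw : IntegrableOn w Om) :
    ∃ c, v =ᵐ[muOm] fun x => c + fracInt 1 (Om.indicator w) x := by
  have hI := integrableOn_fracInt_Om one_pos hw
  obtain ⟨η, hη, hη1⟩ := exists_isTest_integral_eq_one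
  set v0 : ℝ → ℝ := fun x => v x - fracInt 1 (Om.indicator w) x with hv0def
  have hv0 : IntegrableOn v0 Om := hv.sub hI
  have key : ∀ φ, IsTest φ → ∫ x in Om, v0 x * _root_.deriv φ x = 0 := by
    intro φ hφ
    have h1 := (hasWeakDeriv_iff.1 h).2.2 φ hφ
    rw [iteratedDeriv_one] at h1
    simp only [hv0def, sub_mul]
    rw [integral_sub (hφ.deriv.integrable_mul hv) (hφ.deriv.integrable_mul hI), h1,
      hφ.integral_fracInt_one_mul_deriv hw]
    ring
  refine ⟨∫ x in Om, v0 x * η x, ?_⟩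
  set c := ∫ x in Om, v0 x * η x with hc
  have hcI : IntegrableOn (fun _ : ℝ => c) Om := integrableOn_const (by simp)
  have : v0 =ᵐ[muOm] fun _ => c := by
    refine ae_eq_of_test hv0 hcI fun ψ hψ => ?_
    -- Subtracting the multiple of `η` with the same mean leaves a test function that is itself a
    -- derivative of a test function, against which `v0` integrates to zero.
    have hθ : IsTest fun x => ψ x - (∫ y, ψ y) * η x := by
      refine ⟨hψ.smooth.sub (contDiff_const.mul hη.smooth), hψ.compact.sub hη.compact.mul_left, ?_⟩
      refine (tsupport_sub _ _).trans (union_subset hψ.supp ?_)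
      exact (tsupport_mul_subset_right).trans hη.supp
    obtain ⟨Θ, hΘ, hd⟩ := hθ.exists_primitive (by
      rw [integral_sub hψ.integrable (hη.integrable.const_mul _), integral_const_mul, hη1]; ring)
    have := key Θ hΘ
    rw [hd] at this
    have e : ∀ x, v0 x * (ψ x - (∫ y, ψ y) * η x) = v0 x * ψ x - (∫ y, ψ y) * (v0 x * η x) :=
      fun x => by ring
    simp only [e] at this
    rw [integral_sub (hψ.integrable_mul hv0) ((hη.integrable_mul hv0).const_mul _),
      integral_const_mul, ← hc, sub_eq_zero] at this
    rw [this, hψ.setIntegral_mul (fun _ => c), integral_const_mul, mul_comm]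
  filter_upwards [this] with x hx
  simp only [hv0def] at hx
  linarith

/-- A function whose primitive vanishes is zero almost everywhere. -/
lemma ae_eq_zero_of_fracInt_one {w : ℝ → ℝ} (hw : IntegrableOn w Om)
    (h : ∀ x ∈ Om, fracInt 1 (Om.indicator w) x = 0) : w =ᵐ[muOm] 0 := by
  refine ae_eq_of_test hw (integrable_zero _ _ _) fun φ hφ => ?_
  have h1 := hφ.integral_fracInt_one_mul_deriv hw
  rw [setIntegral_congr_fun (g := fun _ => 0) measurableSet_Ioo
    (fun x hx => by simp only [h x hx, zero_mul])] at h1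
  simp only [Pi.zero_apply, zero_mul, integral_zero] at h1 ⊢
  linarith

end

section

/-! ### Square integrals -/

lemma sq_integral_mul_le {X : Type*} [MeasurableSpace X] {μ : Measure X} {f g : X → ℝ}
    (hf : MemLp f 2 μ) (hg : MemLp g 2 μ) :
    (∫ x, f x * g x ∂μ) ^ 2 ≤ (∫ x, f x ^ 2 ∂μ) * ∫ x, g x ^ 2 ∂μ := by
  have hfg : Integrable (fun x => f x * g x) μ := hf.integrable_mul hg
  have h : ∀ t : ℝ, 0 ≤ (∫ x, g x ^ 2 ∂μ) * (t * t) + (2 * ∫ x, f x * g x ∂μ) * t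
      + ∫ x, f x ^ 2 ∂μ := by
    intro t
    have h0 : 0 ≤ ∫ x, (f x + t * g x) ^ 2 ∂μ := integral_nonneg fun x => sq_nonneg _
    have e : ∀ x, (f x + t * g x) ^ 2 = (t * t) * g x ^ 2 + (2 * t) * (f x * g x) + f x ^ 2 :=
      fun x => by ring
    simp only [e] at h0
    have i1 : Integrable (fun x => (t * t) * g x ^ 2 + (2 * t) * (f x * g x)) μ :=
      (hg.integrable_sq.const_mul _).add (hfg.const_mul _)
    rw [integral_add i1 hf.integrable_sq, integral_add (hg.integrable_sq.const_mul _) (hfg.const_mul _), integral_const_mul,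
      integral_const_mul] at h0
    linarith
  have := discrim_le_zero h
  unfold discrim at this
  nlinarith [this]

/-! ### Estimates for the kernel -/

/-- Squaring keeps the family of kernels and sends the order to `2σ - 1`. This is the source of
every threshold `1/2` below: the kernel is locally square integrable once `σ > 1/2`. -/
lemma rk_sq {σ : ℝ} (hσ : 1 / 2 < σ) (t : ℝ) :
    rk σ t ^ 2 = Real.Gamma (2 * σ - 1) / Real.Gamma σ ^ 2 * rk (2 * σ - 1) t := by
  have h1 := Real.Gamma_pos_of_pos (show 0 < 2 * σ - 1 by linarith)
  have h2 := Real.Gamma_pos_of_pos (show 0 < σ by linarith)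
  rcases le_or_gt t 0 with h | h
  · simp [rk_of_nonpos h]
  · rw [rk_of_pos h, rk_of_pos h, div_pow, ← Real.rpow_natCast, ← Real.rpow_mul h.le]
    rw [show (σ - 1) * ((2 : ℕ) : ℝ) = 2 * σ - 1 - 1 by push_cast; ring]
    field_simp

lemma indicator_rk_one {y : ℝ} (x : ℝ) (hx : x ≤ 1) (τ : ℝ) :
    Om.indicator (fun y => rk τ (x - y)) y = rk τ (x - y) * rk 1 (y - 0) := by
  by_cases hy : y ∈ Om
  · rw [indicator_of_mem hy, sub_zero, rk_one_of_pos hy.1, mul_one]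
  · rw [indicator_of_notMem hy, sub_zero]
    rcases le_or_gt y 0 with h | h
    · simp [rk_of_nonpos h]
    · have : 1 ≤ y := by by_contra hc; exact hy ⟨h, not_le.1 hc⟩
      simp [rk_of_nonpos (show x - y ≤ 0 by linarith)]

lemma integrableOn_rk {τ : ℝ} (hτ : 0 < τ) {x : ℝ} (hx : x ≤ 1) :
    IntegrableOn (fun y => rk τ (x - y)) Om := by
  rw [← integrable_indicator_iff measurableSet_Ioo]
  simp_rw [funext fun y => indicator_rk_one (y := y) x hx τ]
  exact integrable_rk_mul_rk hτ one_pos x 0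

lemma setIntegral_rk {τ : ℝ} (hτ : 0 < τ) {x : ℝ} (hx : x ≤ 1) :
    ∫ y in Om, rk τ (x - y) = rk (τ + 1) x := by
  rw [← integral_indicator measurableSet_Ioo]
  simp_rw [funext fun y => indicator_rk_one (y := y) x hx τ]
  rw [integral_rk_mul_rk hτ one_pos x 0, sub_zero]

lemma memLp_rk {σ : ℝ} (hσ : 1 / 2 < σ) {x : ℝ} (hx : x ≤ 1) :
    MemLp (fun y => rk σ (x - y)) 2 muOm := by
  rw [memLp_two_iff_integrable_sq (Measurable.aestronglyMeasurable (by fun_prop))]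
  simp_rw [rk_sq hσ]
  exact (integrableOn_rk (by linarith) hx).const_mul _

/-- A bound for the square integral of the kernel of order `σ > 1/2` over the unit interval. -/
def rkBound (σ : ℝ) : ℝ := Real.Gamma (2 * σ - 1) / Real.Gamma σ ^ 2 / Real.Gamma (2 * σ)

lemma rkBound_pos {σ : ℝ} (hσ : 1 / 2 < σ) : 0 < rkBound σ := by
  have h1 := Real.Gamma_pos_of_pos (show 0 < 2 * σ - 1 by linarith)
  have h2 := Real.Gamma_pos_of_pos (show 0 < σ by linarith)
  have h3 := Real.Gamma_pos_of_pos (show 0 < 2 * σ by linarith)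
  unfold rkBound
  positivity

lemma setIntegral_rk_sq_le {σ : ℝ} (hσ : 1 / 2 < σ) {x : ℝ} (hx : x ≤ 1) :
    ∫ y in Om, rk σ (x - y) ^ 2 ≤ rkBound σ := by
  simp_rw [rk_sq hσ]
  have h1 := Real.Gamma_pos_of_pos (show 0 < 2 * σ - 1 by linarith)
  have h2 := Real.Gamma_pos_of_pos (show 0 < σ by linarith)
  rw [integral_const_mul, setIntegral_rk (by linarith) hx, rkBound, div_eq_mul_one_div _
    (Real.Gamma (2 * σ)), sub_add_cancel]
  gcongr
  have := rk_le_of_one_le (show 1 ≤ 2 * σ by linarith) hx zero_le_one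
  simpa using this

lemma integrable_rk_mul {σ : ℝ} (hσ : 1 / 2 < σ) {w : ℝ → ℝ} (hw : MemLp w 2 muOm) {x : ℝ}
    (hx : x ≤ 1) : IntegrableOn (fun y => rk σ (x - y) * w y) Om :=
  (memLp_rk hσ hx).integrable_mul hw

/-- Cauchy–Schwarz: fractional integration of order above `1/2` maps `L²` into bounded functions, at
every point. -/
lemma sq_fracInt_le {σ : ℝ} (hσ : 1 / 2 < σ) {w : ℝ → ℝ} (hw : MemLp w 2 muOm) {x : ℝ}
    (hx : x ≤ 1) : fracInt σ (Om.indicator w) x ^ 2 ≤ rkBound σ * ∫ y in Om, w y ^ 2 := by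
  rw [fracInt_indicator]
  refine (sq_integral_mul_le (memLp_rk hσ hx) hw).trans ?_
  gcongr
  exact setIntegral_rk_sq_le hσ hx

/-- For `y ≤ x/2` one has `x ≤ 2(x - y)` and `y ≤ x - y`, so each power can be estimated separately.
For `y > x/2` the mean value theorem gives a full factor `x - y`, of which the surplus `(x -
y)^(1-θ)` is at most `y^(1-θ)`. -/
lemma abs_rpow_sub_rpow_le {γ θ : ℝ} (hγ : γ ≤ 1) (h0 : 0 ≤ θ) (h1 : θ ≤ 1) {x y : ℝ}
    (hy : 0 < y) (hyx : y < x) :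
    |x ^ γ - y ^ γ| ≤ (2 + |γ|) * ((x - y) ^ θ * (x ^ (γ - θ) + y ^ (γ - θ))) := by
  have hx : 0 < x := hy.trans hyx
  have hxy : 0 < x - y := sub_pos.2 hyx
  have ex : x ^ γ = x ^ θ * x ^ (γ - θ) := by rw [← Real.rpow_add hx]; congr 1; ring
  have ey : y ^ γ = y ^ θ * y ^ (γ - θ) := by rw [← Real.rpow_add hy]; congr 1; ring
  have px : 0 < x ^ (γ - θ) := by positivity
  have py : 0 < y ^ (γ - θ) := by positivity
  have pd : 0 < (x - y) ^ θ := by positivity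
  rcases le_or_gt y (x / 2) with h | h
  · have i1 : x ^ θ ≤ 2 * (x - y) ^ θ := by
      calc x ^ θ ≤ (2 * (x - y)) ^ θ := by gcongr; linarith
        _ = 2 ^ θ * (x - y) ^ θ := Real.mul_rpow (by norm_num) hxy.le
        _ ≤ 2 ^ (1 : ℝ) * (x - y) ^ θ := by gcongr; norm_num
        _ = _ := by rw [Real.rpow_one]
    have i2 : y ^ θ ≤ (x - y) ^ θ := by gcongr; linarith
    have i3 : |x ^ γ - y ^ γ| ≤ x ^ γ + y ^ γ := by
      rw [abs_le]
      constructor <;> linarith [Real.rpow_pos_of_pos hx γ, Real.rpow_pos_of_pos hy γ]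
    rw [ex, ey] at i3 ⊢
    have hg : 0 ≤ |γ| * ((x - y) ^ θ * (x ^ (γ - θ) + y ^ (γ - θ))) := by positivity
    nlinarith [mul_le_mul_of_nonneg_right i1 px.le, mul_le_mul_of_nonneg_right i2 py.le,
      mul_pos pd py, mul_pos pd px]
  · have hm : |x ^ γ - y ^ γ| ≤ |γ| * y ^ (γ - 1) * (x - y) := by
      have hb := (convex_Icc y x).norm_image_sub_le_of_norm_hasDerivWithin_le
        (f := fun t : ℝ => t ^ γ) (f' := fun t => γ * t ^ (γ - 1)) (C := |γ| * y ^ (γ - 1))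
        (fun t ht => (Real.hasDerivAt_rpow_const (Or.inl (by linarith [ht.1]))).hasDerivWithinAt)
        (fun t ht => ?_) (left_mem_Icc.2 hyx.le) (right_mem_Icc.2 hyx.le)
      · simpa [Real.norm_eq_abs, abs_of_pos hxy] using hb
      · have ht0 : 0 < t := hy.trans_le ht.1
        rw [norm_mul, Real.norm_eq_abs, Real.norm_of_nonneg (by positivity)]
        exact mul_le_mul_of_nonneg_left
          (Real.rpow_le_rpow_of_nonpos hy ht.1 (sub_nonpos.2 hγ)) (abs_nonneg _)
    have e1 : y ^ (γ - 1) * (x - y) = y ^ (γ - θ) * (x - y) ^ θ *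
        (y ^ (θ - 1) * (x - y) ^ (1 - θ)) := by
      have a1 : y ^ (γ - 1) = y ^ (γ - θ) * y ^ (θ - 1) := by
        rw [← Real.rpow_add hy]; congr 1; ring
      have a2 : x - y = (x - y) ^ θ * (x - y) ^ (1 - θ) := by
        rw [← Real.rpow_add hxy]; simp
      rw [a1]
      nth_rw 1 [a2]
      ring
    have e2 : y ^ (θ - 1) * (x - y) ^ (1 - θ) ≤ 1 := by
      calc y ^ (θ - 1) * (x - y) ^ (1 - θ) ≤ y ^ (θ - 1) * y ^ (1 - θ) := by
            gcongr; linarith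
        _ = 1 := by rw [← Real.rpow_add hy]; simp
    have e3 : y ^ (γ - 1) * (x - y) ≤ y ^ (γ - θ) * (x - y) ^ θ := by
      rw [e1]; exact mul_le_of_le_one_right (by positivity) e2
    have e4 : |γ| * (y ^ (γ - 1) * (x - y)) ≤ |γ| * (y ^ (γ - θ) * (x - y) ^ θ) := by gcongr
    have : 0 ≤ |γ| * ((x - y) ^ θ * x ^ (γ - θ)) := by positivity
    nlinarith [mul_pos pd py, mul_pos pd px]

lemma abs_rk_sub_rk_le {σ θ : ℝ} (hσ0 : 0 < σ) (hσ : σ ≤ 2) (h0 : 0 ≤ θ) (h1 : θ ≤ 1) :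
    ∃ C, 0 ≤ C ∧ ∀ x y, |rk σ x - rk σ y| ≤
      C * (|x - y| ^ θ * (|x| ^ (σ - 1 - θ) + |y| ^ (σ - 1 - θ))) := by
  have hG := Real.Gamma_pos_of_pos hσ0
  have hC : 0 ≤ (2 + |σ - 1|) / Real.Gamma σ := by positivity
  refine ⟨(2 + |σ - 1|) / Real.Gamma σ, hC, ?_⟩
  have main : ∀ x y, y < x → |rk σ x - rk σ y| ≤
      (2 + |σ - 1|) / Real.Gamma σ *
        (|x - y| ^ θ * (|x| ^ (σ - 1 - θ) + |y| ^ (σ - 1 - θ))) := by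
    intro x y hyx
    rcases le_or_gt x 0 with hx | hx
    · rw [rk_of_nonpos hx, rk_of_nonpos (hyx.le.trans hx), sub_zero, abs_zero]
      positivity
    have hd : 0 < x - y := sub_pos.2 hyx
    rw [abs_of_pos hd, abs_of_pos hx]
    -- Across the origin only one kernel value survives, and `x ≤ x - y` provides the factor `(x -
    -- y)^θ`.
    rcases le_or_gt y 0 with hy | hy
    · rw [rk_of_nonpos hy, sub_zero, abs_of_nonneg (rk_nonneg hσ0 _), rk_of_pos hx]
      have e : x ^ (σ - 1) = x ^ θ * x ^ (σ - 1 - θ) := by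
        rw [← Real.rpow_add hx]; congr 1; ring
      have i : x ^ θ ≤ (x - y) ^ θ := by gcongr; linarith
      rw [e, div_mul_eq_mul_div]
      refine div_le_div_of_nonneg_right ?_ hG.le
      have p1 : 0 ≤ |y| ^ (σ - 1 - θ) := by positivity
      have p2 : 0 < x ^ (σ - 1 - θ) := by positivity
      have p3 : 0 < (x - y) ^ θ := by positivity
      calc x ^ θ * x ^ (σ - 1 - θ) ≤ 1 * ((x - y) ^ θ * (x ^ (σ - 1 - θ) + |y| ^ (σ - 1 - θ))) := by
            rw [one_mul]; gcongr; linarith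
        _ ≤ _ := by gcongr; linarith [abs_nonneg (σ - 1)]
    · rw [abs_of_pos hy, rk_of_pos hx, rk_of_pos hy, ← sub_div, abs_div, abs_of_pos hG,
        div_mul_eq_mul_div]
      gcongr
      exact abs_rpow_sub_rpow_le (by linarith) h0 h1 hy hyx
  intro x y
  rcases lt_trichotomy x y with h | h | h
  · rw [abs_sub_comm, abs_sub_comm x y, add_comm (|x| ^ _)]
    exact main y x h
  · subst h; rw [sub_self, abs_zero]; positivity
  · exact main x y h

lemma integrableOn_abs_rpow {ρ : ℝ} (hρ : -1 < ρ) (c : ℝ) :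
    IntegrableOn (fun t : ℝ => |t| ^ ρ) (Ioo (-c) c) := by
  rcases le_or_gt c 0 with hc | hc
  · rw [Ioo_eq_empty (by linarith)]; exact integrableOn_empty
  have h1 : IntegrableOn (fun t : ℝ => |t| ^ ρ) (Ioo 0 c) :=
    ((intervalIntegral.integrableOn_Ioo_rpow_iff hc).2 hρ).congr_fun
      (fun t ht => by rw [abs_of_pos ht.1]) measurableSet_Ioo
  have h2 : IntegrableOn (fun t : ℝ => |t| ^ ρ) (Ioo (-c) 0) := by
    have := ((Measure.measurePreserving_neg (volume : Measure ℝ)).integrableOn_comp_preimage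
      (MeasurableEquiv.neg ℝ).measurableEmbedding (f := fun t : ℝ => |t| ^ ρ) (s := Ioo 0 c)).2 h1
    simpa [Function.comp_def] using this
  have h3 : IntegrableOn (fun t : ℝ => |t| ^ ρ) {0} := 
    integrableOn_singleton (by simp) (by simp)
  refine ((h2.union h3).union h1).mono_set fun t ht => ?_
  rcases lt_trichotomy t 0 with h | h | h
  · exact Or.inl (Or.inl ⟨ht.1, h⟩)
  · exact Or.inl (Or.inr h)
  · exact Or.inr ⟨h, ht.2⟩

/-- Translation by `x` maps `(-1, 1)` into `(-2, 2)`, which makes the bound uniform in `x`. -/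
lemma exists_lintegral_abs_sub_rpow_le {ρ : ℝ} (hρ : -1 < ρ) : ∃ C : ℝ≥0∞, C ≠ ⊤ ∧
    ∀ x ∈ Icc (-1 : ℝ) 1, ∫⁻ y in Ioo (-1 : ℝ) 1, ENNReal.ofReal (|x - y| ^ ρ) ≤ C := by
  refine ⟨∫⁻ t in Ioo (-2 : ℝ) 2, ENNReal.ofReal (|t| ^ ρ), ?_, fun x hx => ?_⟩
  · have := (integrableOn_abs_rpow hρ 2).2
    rw [hasFiniteIntegral_iff_ofReal (ae_of_all _ fun t => by positivity)] at this
    exact this.ne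
  · rw [← lintegral_indicator measurableSet_Ioo, ← lintegral_indicator measurableSet_Ioo,
      ← lintegral_sub_left_eq_self (fun t => (Ioo (-2 : ℝ) 2).indicator
        (fun t => ENNReal.ofReal (|t| ^ ρ)) t) x]
    refine lintegral_mono fun y => ?_
    by_cases hy : y ∈ Ioo (-1 : ℝ) 1
    · rw [indicator_of_mem hy, indicator_of_mem]
      constructor <;> linarith [hy.1, hy.2, hx.1, hx.2]
    · rw [indicator_of_notMem hy]; exact zero_le

end

section

/-! ### Slobodeckij and Hölder regularity of fractional integrals -/

lemma rpow_two_mul_abs (t κ : ℝ) : |t| ^ (2 * κ) = (|t| ^ κ) ^ 2 := by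
  rw [mul_comm, Real.rpow_mul (abs_nonneg t), ← Real.rpow_natCast]; norm_num

lemma exists_setIntegral_abs_sub_rpow_le {ρ : ℝ} (hρ : -1 < ρ) : ∃ C : ℝ,
    ∀ x ∈ Icc (0 : ℝ) 1, IntegrableOn (fun y => |x - y| ^ ρ) Om ∧
      ∫ y in Om, |x - y| ^ ρ ≤ C := by
  obtain ⟨C, hC, h⟩ := exists_lintegral_abs_sub_rpow_le hρ
  have hle : ∀ x ∈ Icc (0 : ℝ) 1, ∫⁻ y in Om, ENNReal.ofReal (|x - y| ^ ρ) ≤ C := fun x hx =>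
    (lintegral_mono_set (Ioo_subset_Ioo_left (by norm_num))).trans
      (h x ⟨by linarith [hx.1], hx.2⟩)
  refine ⟨C.toReal, fun x hx => ⟨⟨Measurable.aestronglyMeasurable (by fun_prop), ?_⟩, ?_⟩⟩
  · rw [hasFiniteIntegral_iff_ofReal (ae_of_all _ fun t => by positivity)]
    exact (hle x hx).trans_lt hC.lt_top
  · rw [integral_eq_lintegral_of_nonneg_ae (ae_of_all _ fun t => by positivity)
      (Measurable.aestronglyMeasurable (by fun_prop))]
    exact ENNReal.toReal_mono hC (hle x hx)

/-- Fractional integrals of square integrable functions are Hölder continuous. -/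
lemma exists_abs_fracInt_sub_le {σ θ : ℝ} (hσ0 : 1 / 2 < σ) (hσ : σ ≤ 2) (h0 : 0 ≤ θ) (h1 : θ ≤ 1)
    (hθ : θ < σ - 1 / 2) {w : ℝ → ℝ} (hw : MemLp w 2 muOm) :
    ∃ C, ∀ x ∈ Icc (0 : ℝ) 1, ∀ y ∈ Icc (0 : ℝ) 1,
      |fracInt σ (Om.indicator w) x - fracInt σ (Om.indicator w) y| ≤ C * |x - y| ^ θ := by
  obtain ⟨A, hA, hk⟩ := abs_rk_sub_rk_le (by linarith : 0 < σ) hσ h0 h1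
  obtain ⟨B, hB⟩ := exists_setIntegral_abs_sub_rpow_le
    (show -1 < 2 * (σ - 1 - θ) by linarith)
  refine ⟨A * (B + B + ∫ z in Om, w z ^ 2), fun x hx y hy => ?_⟩
  have ix := hB x hx
  have iy := hB y hy
  rw [fracInt_indicator, fracInt_indicator,
    ← integral_sub (integrable_rk_mul hσ0 hw hx.2) (integrable_rk_mul hσ0 hw hy.2)]
  have iI : IntegrableOn (fun z => |x - z| ^ (2 * (σ - 1 - θ)) + |y - z| ^ (2 * (σ - 1 - θ))) Om :=
    ix.1.add iy.1
  have hle : |∫ z in Om, (rk σ (x - z) * w z - rk σ (y - z) * w z)| ≤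
      ∫ z in Om, A * |x - y| ^ θ * (|x - z| ^ (2 * (σ - 1 - θ)) + |y - z| ^ (2 * (σ - 1 - θ))
        + w z ^ 2) := by
    rw [← Real.norm_eq_abs (∫ z in Om, _)]
    refine norm_integral_le_of_norm_le ((iI.add hw.integrable_sq).const_mul _)
      (ae_of_all _ fun z => ?_)
    rw [← sub_mul, norm_mul, Real.norm_eq_abs, Real.norm_eq_abs]
    have h2 := hk (x - z) (y - z)
    rw [show x - z - (y - z) = x - y by ring] at h2
    -- Young's inequality doubles the exponent of the kernel to `2(σ - 1 - θ)`, which exceeds `-1`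
    -- because `θ < σ - 1/2`.
    have h3 : (|x - z| ^ (σ - 1 - θ) + |y - z| ^ (σ - 1 - θ)) * |w z| ≤
        |x - z| ^ (2 * (σ - 1 - θ)) + |y - z| ^ (2 * (σ - 1 - θ)) + w z ^ 2 := by
      rw [rpow_two_mul_abs, rpow_two_mul_abs, ← sq_abs (w z)]
      nlinarith [sq_nonneg (|x - z| ^ (σ - 1 - θ) - |w z|),
        sq_nonneg (|y - z| ^ (σ - 1 - θ) - |w z|), sq_nonneg (|x - z| ^ (σ - 1 - θ)),
        sq_nonneg (|y - z| ^ (σ - 1 - θ))]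
    calc |rk σ (x - z) - rk σ (y - z)| * |w z| ≤ A * (|x - y| ^ θ *
          (|x - z| ^ (σ - 1 - θ) + |y - z| ^ (σ - 1 - θ))) * |w z| := by gcongr
      _ = A * |x - y| ^ θ * ((|x - z| ^ (σ - 1 - θ) + |y - z| ^ (σ - 1 - θ)) * |w z|) := by ring
      _ ≤ _ := by gcongr
  refine hle.trans ?_
  rw [integral_const_mul, integral_add iI hw.integrable_sq, integral_add ix.1 iy.1]
  calc _ ≤ A * |x - y| ^ θ * (B + B + ∫ z in Om, w z ^ 2) := by
        gcongr
        · exact ix.2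
        · exact iy.2
    _ = _ := by ring

lemma slobodeckij_rk_lt_top {σ r : ℝ} (hσ : σ ≤ 2) (hr0 : 0 < r) (hr1 : r < 1)
    (hr : r < σ - 1 / 2) : slobodeckij r (Ioo (-1) 1) (rk σ) < ⊤ := by
  -- The Hölder exponent is taken between `r` and `min 1 (σ - 1/2)`: `θ > r` makes `|x -
  -- y|^(2θ-1-2r)` integrable, and `θ < σ - 1/2` does the same for `|x|^(2(σ-1-θ))`.
  obtain ⟨θ, hθ1, hθ2⟩ := exists_between (lt_min hr1 hr)
  have hθ3 := hθ2.trans_le (min_le_left _ _)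
  have hθ4 := hθ2.trans_le (min_le_right _ _)
  obtain ⟨A, hA, hk⟩ := abs_rk_sub_rk_le (by linarith : 0 < σ) hσ (by linarith : 0 ≤ θ) hθ3.le
  set κ := σ - 1 - θ
  set ρ := 2 * θ - 1 - 2 * r with hρ
  obtain ⟨B, hB, hB'⟩ := exists_lintegral_abs_sub_rpow_le (show -1 < ρ by linarith)
  obtain ⟨D, hD, hD'⟩ := exists_lintegral_abs_sub_rpow_le
    (show -1 < 2 * κ by simp only [κ]; linarith)
  have hpt : ∀ x y : ℝ, ENNReal.ofReal ((rk σ x - rk σ y) ^ 2 / |x - y| ^ (1 + 2 * r)) ≤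
      ENNReal.ofReal (2 * A ^ 2) *
        (ENNReal.ofReal (|x| ^ (2 * κ)) * ENNReal.ofReal (|x - y| ^ ρ)) +
      ENNReal.ofReal (2 * A ^ 2) *
        (ENNReal.ofReal (|y| ^ (2 * κ)) * ENNReal.ofReal (|y - x| ^ ρ)) := by
    intro x y
    rw [← ENNReal.ofReal_mul (by positivity), ← ENNReal.ofReal_mul (by positivity),
      ← ENNReal.ofReal_mul (by positivity), ← ENNReal.ofReal_mul (by positivity),
      ← ENNReal.ofReal_add (by positivity) (by positivity)]
    refine ENNReal.ofReal_le_ofReal ?_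
    rcases eq_or_ne x y with h | h
    · subst h; simp only [sub_self, zero_div, ne_eq, OfNat.ofNat_ne_zero, not_false_eq_true,
        zero_pow]; positivity
    have hd : 0 < |x - y| := abs_pos.2 (sub_ne_zero.2 h)
    rw [div_le_iff₀ (by positivity), abs_sub_comm y x]
    have e : |x - y| ^ ρ * |x - y| ^ (1 + 2 * r) = (|x - y| ^ θ) ^ 2 := by
      rw [← Real.rpow_add hd, ← rpow_two_mul_abs]; congr 1; rw [hρ]; ring
    have h2 : (rk σ x - rk σ y) ^ 2 ≤ (A * (|x - y| ^ θ * (|x| ^ κ + |y| ^ κ))) ^ 2 := by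
      rw [← sq_abs]
      exact pow_le_pow_left₀ (abs_nonneg _) (hk x y) 2
    calc _ ≤ (A * (|x - y| ^ θ * (|x| ^ κ + |y| ^ κ))) ^ 2 := h2
      _ ≤ 2 * A ^ 2 * (|x| ^ (2 * κ) + |y| ^ (2 * κ)) * (|x - y| ^ θ) ^ 2 := by
        rw [rpow_two_mul_abs, rpow_two_mul_abs]
        have : 0 ≤ A ^ 2 * (|x - y| ^ θ) ^ 2 * (|x| ^ κ - |y| ^ κ) ^ 2 := by positivity
        linarith
      _ = _ := by rw [← e]; ring
  have hfin : ∫⁻ x in Ioo (-1 : ℝ) 1, ∫⁻ y in Ioo (-1 : ℝ) 1, ENNReal.ofReal (2 * A ^ 2) *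
        (ENNReal.ofReal (|x| ^ (2 * κ)) * ENNReal.ofReal (|x - y| ^ ρ)) < ⊤ := by
    calc _ ≤ ∫⁻ x in Ioo (-1 : ℝ) 1, ENNReal.ofReal (2 * A ^ 2) *
          (ENNReal.ofReal (|x| ^ (2 * κ)) * B) := by
          refine setLIntegral_mono' measurableSet_Ioo fun x hx => ?_
          rw [lintegral_const_mul _ (by fun_prop), lintegral_const_mul _ (by fun_prop)]
          gcongr
          exact hB' x ⟨hx.1.le, hx.2.le⟩
      _ = ENNReal.ofReal (2 * A ^ 2) *
          ((∫⁻ x in Ioo (-1 : ℝ) 1, ENNReal.ofReal (|x| ^ (2 * κ))) * B) := by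
          rw [lintegral_const_mul _ (by fun_prop), lintegral_mul_const _ (by fun_prop)]
      _ < ⊤ := by
          refine ENNReal.mul_lt_top ENNReal.ofReal_lt_top (ENNReal.mul_lt_top ?_ hB.lt_top)
          have := hD' 0 (by simp)
          simp only [zero_sub, abs_neg] at this
          exact this.trans_lt hD.lt_top
  unfold slobodeckij
  calc _ ≤ ∫⁻ x in Ioo (-1 : ℝ) 1, ∫⁻ y in Ioo (-1 : ℝ) 1, (ENNReal.ofReal (2 * A ^ 2) *
        (ENNReal.ofReal (|x| ^ (2 * κ)) * ENNReal.ofReal (|x - y| ^ ρ)) +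
        ENNReal.ofReal (2 * A ^ 2) *
        (ENNReal.ofReal (|y| ^ (2 * κ)) * ENNReal.ofReal (|y - x| ^ ρ))) :=
        lintegral_mono fun x => lintegral_mono fun y => hpt x y
    _ = (∫⁻ x in Ioo (-1 : ℝ) 1, ∫⁻ y in Ioo (-1 : ℝ) 1, ENNReal.ofReal (2 * A ^ 2) *
        (ENNReal.ofReal (|x| ^ (2 * κ)) * ENNReal.ofReal (|x - y| ^ ρ))) +
        ∫⁻ x in Ioo (-1 : ℝ) 1, ∫⁻ y in Ioo (-1 : ℝ) 1, ENNReal.ofReal (2 * A ^ 2) *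
        (ENNReal.ofReal (|y| ^ (2 * κ)) * ENNReal.ofReal (|y - x| ^ ρ)) := by
        rw [← lintegral_add_left]
        · congr 1; ext x
          rw [lintegral_add_left (by fun_prop)]
        · exact Measurable.lintegral_prod_right' (f := fun p : ℝ × ℝ => ENNReal.ofReal (2 * A ^ 2) *
            (ENNReal.ofReal (|p.1| ^ (2 * κ)) * ENNReal.ofReal (|p.1 - p.2| ^ ρ))) (by fun_prop)
    _ < ⊤ := by
        refine ENNReal.add_lt_top.2 ⟨hfin, ?_⟩
        rw [lintegral_lintegral_swap]
        · exact hfin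
        · exact Measurable.aemeasurable (by fun_prop)

lemma slobodeckij_mono {r : ℝ} {D E : Set ℝ} (h : D ⊆ E) (u : ℝ → ℝ) :
    slobodeckij r D u ≤ slobodeckij r E u :=
  (lintegral_mono_set h).trans (lintegral_mono fun _ => lintegral_mono_set h)

/-- Cauchy–Schwarz in the integration variable and Tonelli reduce the seminorm of the convolution to
that of the shifted kernels. Shifting by `z ∈ (0,1)` keeps the arguments in `(-1,1)`, so the
kernel's seminorm is needed there, across its singularity at `0`. -/
lemma slobodeckij_fracInt_lt_top {σ r : ℝ} (hσ0 : 1 / 2 < σ) (hσ : σ ≤ 2) (hr0 : 0 < r)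
    (hr1 : r < 1) (hr : r < σ - 1 / 2) {w : ℝ → ℝ} (hw : MemLp w 2 muOm) :
    slobodeckij r Om (fracInt σ (Om.indicator w)) < ⊤ := by
  have hS := slobodeckij_rk_lt_top hσ hr0 hr1 hr
  set S := slobodeckij r (Ioo (-1) 1) (rk σ)
  set A := ∫ z in Om, w z ^ 2 with hA
  have hA0 : 0 ≤ A := integral_nonneg fun _ => sq_nonneg _
  have hpt : ∀ x ∈ Om, ∀ y ∈ Om, ENNReal.ofReal ((fracInt σ (Om.indicator w) x -
      fracInt σ (Om.indicator w) y) ^ 2 / |x - y| ^ (1 + 2 * r)) ≤ ENNReal.ofReal A *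
      ∫⁻ z in Om, ENNReal.ofReal ((rk σ (x - z) - rk σ (y - z)) ^ 2 / |x - y| ^ (1 + 2 * r)) := by
    intro x hx y hy
    have m1 : MemLp (fun z => rk σ (x - z) - rk σ (y - z)) 2 muOm :=
      (memLp_rk hσ0 hx.2.le).sub (memLp_rk hσ0 hy.2.le)
    have e1 : fracInt σ (Om.indicator w) x - fracInt σ (Om.indicator w) y =
        ∫ z in Om, (rk σ (x - z) - rk σ (y - z)) * w z := by
      rw [fracInt_indicator, fracInt_indicator, ← integral_sub
        (integrable_rk_mul hσ0 hw hx.2.le) (integrable_rk_mul hσ0 hw hy.2.le)]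
      simp_rw [sub_mul]
    have e2 := sq_integral_mul_le m1 hw
    rw [← ofReal_integral_eq_lintegral_ofReal (m1.integrable_sq.div_const _)
      (ae_of_all _ fun z => by positivity), ← ENNReal.ofReal_mul hA0, integral_div, e1]
    refine ENNReal.ofReal_le_ofReal ?_
    rw [← mul_div_assoc, mul_comm A]
    gcongr
  have hz : ∀ z ∈ Om, ∫⁻ x in Om, ∫⁻ y in Om,
      ENNReal.ofReal ((rk σ (x - z) - rk σ (y - z)) ^ 2 / |x - y| ^ (1 + 2 * r)) ≤ S := by
    intro z hz
    have tr : ∀ F : ℝ → ℝ≥0∞, ∫⁻ x in Om, F (x - z) ≤ ∫⁻ x in Ioo (-1 : ℝ) 1, F x := by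
      intro F
      rw [← lintegral_indicator measurableSet_Ioo, ← lintegral_indicator measurableSet_Ioo,
        ← lintegral_sub_right_eq_self ((Ioo (-1 : ℝ) 1).indicator fun x => F x) z]
      refine lintegral_mono fun x => ?_
      by_cases hx : x ∈ Om
      · rw [indicator_of_mem hx, indicator_of_mem]
        constructor <;> linarith [hx.1, hx.2, hz.1, hz.2]
      · rw [indicator_of_notMem hx]; exact zero_le
    refine le_trans ?_ (tr fun x => ∫⁻ y in Ioo (-1 : ℝ) 1,
      ENNReal.ofReal ((rk σ x - rk σ y) ^ 2 / |x - y| ^ (1 + 2 * r)))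
    refine lintegral_mono fun x => ?_
    refine le_trans (le_of_eq ?_) (tr fun y =>
      ENNReal.ofReal ((rk σ (x - z) - rk σ y) ^ 2 / |x - z - y| ^ (1 + 2 * r)))
    simp only [sub_sub_sub_cancel_right]
  calc slobodeckij r Om (fracInt σ (Om.indicator w))
      ≤ ∫⁻ x in Om, ∫⁻ y in Om, ENNReal.ofReal A * ∫⁻ z in Om,
        ENNReal.ofReal ((rk σ (x - z) - rk σ (y - z)) ^ 2 / |x - y| ^ (1 + 2 * r)) :=
        setLIntegral_mono' measurableSet_Ioo fun x hx =>
          setLIntegral_mono' measurableSet_Ioo fun y hy => hpt x hx y hy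
    _ = ENNReal.ofReal A * ∫⁻ x in Om, ∫⁻ y in Om, ∫⁻ z in Om,
        ENNReal.ofReal ((rk σ (x - z) - rk σ (y - z)) ^ 2 / |x - y| ^ (1 + 2 * r)) := by
        simp_rw [lintegral_const_mul' _ _ ENNReal.ofReal_ne_top]
    _ = ENNReal.ofReal A * ∫⁻ z in Om, ∫⁻ x in Om, ∫⁻ y in Om,
        ENNReal.ofReal ((rk σ (x - z) - rk σ (y - z)) ^ 2 / |x - y| ^ (1 + 2 * r)) := by
        congr 1
        have : ∀ x, ∫⁻ y in Om, ∫⁻ z in Om,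
            ENNReal.ofReal ((rk σ (x - z) - rk σ (y - z)) ^ 2 / |x - y| ^ (1 + 2 * r)) =
            ∫⁻ z in Om, ∫⁻ y in Om,
            ENNReal.ofReal ((rk σ (x - z) - rk σ (y - z)) ^ 2 / |x - y| ^ (1 + 2 * r)) :=
          fun x => lintegral_lintegral_swap (Measurable.aemeasurable (by fun_prop))
        simp_rw [this]
        refine lintegral_lintegral_swap (Measurable.aemeasurable ?_)
        exact Measurable.lintegral_prod_right' (f := fun q : (ℝ × ℝ) × ℝ => ENNReal.ofReal
          ((rk σ (q.1.1 - q.1.2) - rk σ (q.2 - q.1.2)) ^ 2 / |q.1.1 - q.2| ^ (1 + 2 * r)))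
          (by fun_prop)
    _ ≤ ENNReal.ofReal A * ∫⁻ z in Om, S := by
        gcongr 1
        exact setLIntegral_mono' measurableSet_Ioo hz
    _ < ⊤ := by
        rw [setLIntegral_const]
        refine ENNReal.mul_lt_top ENNReal.ofReal_lt_top (ENNReal.mul_lt_top hS ?_)
        simp [Om]

lemma slobodeckij_sub_lt_top {r : ℝ} {D : Set ℝ} {u v : ℝ → ℝ} (hu : Measurable u) (c : ℝ)
    (h1 : slobodeckij r D u < ⊤) (h2 : slobodeckij r D v < ⊤) :
    slobodeckij r D (fun x => c * u x - v x) < ⊤ := by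
  unfold slobodeckij at *
  calc _ ≤ ∫⁻ x in D, ∫⁻ y in D, (ENNReal.ofReal (2 * c ^ 2) *
          ENNReal.ofReal ((u x - u y) ^ 2 / |x - y| ^ (1 + 2 * r)) + ENNReal.ofReal 2 *
          ENNReal.ofReal ((v x - v y) ^ 2 / |x - y| ^ (1 + 2 * r))) := by
        refine lintegral_mono fun x => lintegral_mono fun y => ?_
        rw [← ENNReal.ofReal_mul (by positivity), ← ENNReal.ofReal_mul (by positivity),
          ← ENNReal.ofReal_add (by positivity) (by positivity)]
        refine ENNReal.ofReal_le_ofReal ?_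
        rw [← mul_div_assoc, ← mul_div_assoc, ← add_div]
        gcongr
        nlinarith [sq_nonneg (c * (u x - u y) + (v x - v y))]
    _ = ENNReal.ofReal (2 * c ^ 2) * (∫⁻ x in D, ∫⁻ y in D,
          ENNReal.ofReal ((u x - u y) ^ 2 / |x - y| ^ (1 + 2 * r))) + ENNReal.ofReal 2 *
          ∫⁻ x in D, ∫⁻ y in D, ENNReal.ofReal ((v x - v y) ^ 2 / |x - y| ^ (1 + 2 * r)) := by
        rw [← lintegral_const_mul' _ _ ENNReal.ofReal_ne_top,
          ← lintegral_const_mul' _ _ ENNReal.ofReal_ne_top, ← lintegral_add_left]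
        · congr 1; ext x
          rw [lintegral_add_left (by fun_prop), lintegral_const_mul' _ _ ENNReal.ofReal_ne_top,
            lintegral_const_mul' _ _ ENNReal.ofReal_ne_top]
        · refine Measurable.const_mul ?_ _
          exact Measurable.lintegral_prod_right' (f := fun p : ℝ × ℝ =>
            ENNReal.ofReal ((u p.1 - u p.2) ^ 2 / |p.1 - p.2| ^ (1 + 2 * r))) (by fun_prop)
    _ < ⊤ := ENNReal.add_lt_top.2 ⟨ENNReal.mul_lt_top ENNReal.ofReal_lt_top h1,
        ENNReal.mul_lt_top ENNReal.ofReal_lt_top h2⟩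

end

section

/-! ### Potentials of a point mass at the origin minus a density -/

/-- The fractional integral of order `τ` of the measure `c δ₀ - h dx`. -/
def pot (c : ℝ) (h : ℝ → ℝ) (τ x : ℝ) : ℝ := c * rk τ x - fracInt τ (Om.indicator h) x

lemma pot_of_nonpos (c : ℝ) (h : ℝ → ℝ) (τ : ℝ) {x : ℝ} (hx : x ≤ 0) : pot c h τ x = 0 := by
  rw [pot, rk_of_nonpos hx, fracInt_of_nonpos (indicator_Om_of_nonpos h) hx]; simp

lemma integrableOn_rk_Om {τ : ℝ} (hτ : 0 < τ) : IntegrableOn (rk τ) Om := by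
  have h1 := (intervalIntegral.integrableOn_Ioo_rpow_iff one_pos).2 (show -1 < τ - 1 by linarith)
  have h2 : IntegrableOn (fun x : ℝ => x ^ (τ - 1) / Real.Gamma τ) Om := h1.div_const _
  exact h2.congr_fun (fun x hx => by simp only [rk_of_pos hx.1]) measurableSet_Ioo

lemma memLp_rk_Om {τ : ℝ} (hτ : 1 / 2 < τ) : MemLp (rk τ) 2 muOm := by
  rw [memLp_two_iff_integrable_sq (measurable_rk τ).aestronglyMeasurable]
  simp_rw [rk_sq hτ]
  exact (integrableOn_rk_Om (by linarith)).const_mul _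

lemma MemLp.integrableOn_Om {w : ℝ → ℝ} (hw : MemLp w 2 muOm) : IntegrableOn w Om :=
  hw.integrable (by norm_num)

lemma memLp_fracInt {τ : ℝ} (hτ : 1 / 2 < τ) {w : ℝ → ℝ} (hw : MemLp w 2 muOm) :
    MemLp (fracInt τ (Om.indicator w)) 2 muOm := by
  refine MemLp.of_bound (integrableOn_fracInt_Om (by linarith) (MemLp.integrableOn_Om hw)).1
    (Real.sqrt (rkBound τ * ∫ y in Om, w y ^ 2)) ?_
  filter_upwards [ae_restrict_mem measurableSet_Ioo] with x hx
  exact Real.abs_le_sqrt (sq_fracInt_le hτ hw hx.2.le)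

lemma integrableOn_pot (c : ℝ) {h : ℝ → ℝ} (hh : IntegrableOn h Om) {τ : ℝ} (hτ : 0 < τ) :
    IntegrableOn (pot c h τ) Om :=
  ((integrableOn_rk_Om hτ).const_mul c).sub (integrableOn_fracInt_Om hτ hh)

lemma memLp_pot (c : ℝ) {h : ℝ → ℝ} (hh : MemLp h 2 muOm) {τ : ℝ} (hτ : 1 / 2 < τ) :
    MemLp (pot c h τ) 2 muOm :=
  ((memLp_rk_Om hτ).const_mul c).sub (memLp_fracInt hτ hh)

/-- The semigroup law for a density and for the point mass at once. Restricting to the unit interval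
loses nothing, as the potential vanishes to the left of `0` and the kernel beyond `x ≤ 1`. -/
lemma fracInt_pot (c : ℝ) {h : ℝ → ℝ} (hh : IntegrableOn h Om) {a b : ℝ} (ha : 0 < a) (hb : 0 < b)
    (hab : 1 ≤ a + b) {x : ℝ} (hx : x ≤ 1) :
    fracInt a (Om.indicator (pot c h b)) x = pot c h (a + b) x := by
  have hH := integrable_indicator_Om hh
  have hi := integrable_rk_mul_of_one_le hab hH (indicator_Om_of_neg h) x
  have e : fracInt a (Om.indicator (pot c h b)) x =
      fracInt a (fun y => c * rk b y - fracInt b (Om.indicator h) y) x := by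
    refine fracInt_congr (ae_of_all _ fun y hy => ?_)
    by_cases hm : y ∈ Om
    · exact indicator_of_mem hm _
    · have hy0 : y ≤ 0 := by by_contra hc; exact hm ⟨not_le.1 hc, hy.trans_le hx⟩
      rw [indicator_of_notMem hm]
      exact (pot_of_nonpos c h b hy0).symm
  rw [e, pot, ← fracInt_fracInt ha hb hH.1 hi, ← fracInt_rk ha hb x]
  unfold fracInt
  rw [← integral_const_mul, ← integral_sub]
  · congr 1; ext y; ring
  · simpa using (integrable_rk_mul_rk ha hb x 0).const_mul c
  · exact integrable_rk_mul_fracInt ha hb hH.1 hi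

lemma hasWeakDeriv_pot (c : ℝ) {h : ℝ → ℝ} (hh : IntegrableOn h Om) {τ : ℝ} (hτ : 0 < τ)
    {v : ℝ → ℝ} (hv : ∀ x ∈ Om, v x = pot c h (1 + τ) x) : HasWeakDeriv 1 Om v (pot c h τ) := by
  refine hasWeakDeriv_primitive (integrableOn_pot c hh hτ) 0 ?_
  filter_upwards [ae_restrict_mem measurableSet_Ioo] with x hx
  rw [hv x hx, zero_add, fracInt_pot c hh one_pos hτ (by linarith) hx.2.le]

/-- At order one the point mass contributes a constant on `(0,1)`, so differentiation removes it and
only the density survives. -/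
lemma hasWeakDeriv_pot_one (c : ℝ) {h : ℝ → ℝ} (hh : IntegrableOn h Om) :
    HasWeakDeriv 1 Om (pot c h 1) (fun x => -h x) := by
  refine hasWeakDeriv_primitive hh.neg c ?_
  filter_upwards [ae_restrict_mem measurableSet_Ioo] with x hx
  rw [pot, rk_one_of_pos hx.1, mul_one, sub_eq_add_neg, fracInt_indicator, fracInt_indicator,
    ← integral_neg]
  simp

/-! ### The Green operator -/

/-- The right-hand side of the Volterra–Fredholm equation with source `h`. -/
def green (s : ℝ) (h : ℝ → ℝ) (x : ℝ) : ℝ := x ^ (s - 1) * leftInt s h 1 - leftInt s h x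

/-- The mass at the origin that makes the potential of order `s` vanish at `1`. -/
def greenMass (s : ℝ) (h : ℝ → ℝ) : ℝ := Real.Gamma s * fracInt s (Om.indicator h) 1

variable {s : ℝ} {h : ℝ → ℝ}

/-- The two sides agree at `0` as well, because `0 ^ (s - 1) = 0` and `rk s 0 = 0`. -/
lemma green_eq (hs : 1 < s) (h : ℝ → ℝ) {x : ℝ} (hx : x ∈ Icc (0 : ℝ) 1) :
    green s h x = pot (greenMass s h) h s x := by
  have hG := Real.Gamma_pos_of_pos (show 0 < s by linarith)
  rw [green, pot, leftInt_eq_fracInt s h hx, leftInt_eq_fracInt s h (right_mem_Icc.2 zero_le_one),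
    greenMass]
  rcases hx.1.eq_or_lt with h0 | h0
  · rw [← h0, rk_of_nonpos le_rfl, Real.zero_rpow (by linarith)]; ring
  · rw [rk_of_pos h0]; field_simp

lemma green_zero (hs : 1 < s) (h : ℝ → ℝ) : green s h 0 = 0 := by
  rw [green_eq hs h (left_mem_Icc.2 zero_le_one), pot_of_nonpos _ _ _ le_rfl]

lemma green_one (s : ℝ) (h : ℝ → ℝ) : green s h 1 = 0 := by simp [green]

lemma leftInt_green (hs : 1 < s) (hh : IntegrableOn h Om) {a : ℝ} (ha : 0 < a) {x : ℝ}
    (hx : x ∈ Icc (0 : ℝ) 1) :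
    leftInt a (green s h) x = pot (greenMass s h) h (a + s) x := by
  rw [leftInt_eq_fracInt a _ hx, ← fracInt_pot _ hh ha (by linarith) (by linarith) hx.2]
  congr 1
  exact indicator_congr fun y hy => green_eq hs h ⟨hy.1.le, hy.2.le⟩

lemma floor_half (hs2 : s < 2) : ⌊s / 2⌋₊ = 0 :=
  Nat.floor_eq_zero.2 (by linarith)

lemma floor_s (hs1 : 1 < s) (hs2 : s < 2) : ⌊s⌋₊ = 1 := by
  rw [Nat.floor_eq_iff (by linarith)]; norm_num; constructor <;> linarith

/-- The half-order derivative of a Green potential. -/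
lemma hasLeftRLDeriv_half_green (hs1 : 1 < s) (hs2 : s < 2) (hh : MemLp h 2 muOm) :
    HasLeftRLDeriv (s / 2) (green s h) (pot (greenMass s h) h (s / 2)) := by
  refine ⟨memLp_pot _ hh (by linarith), ?_⟩
  rw [floor_half hs2]
  refine hasWeakDeriv_pot _ (MemLp.integrableOn_Om hh) (by linarith) fun x hx => ?_
  rw [leftInt_green hs1 (MemLp.integrableOn_Om hh) (by norm_num; linarith) ⟨hx.1.le, hx.2.le⟩]
  congr 1; push_cast; ring

/-- A Green potential solves the linear equation. -/
lemma hasLeftRLDeriv_green (hs1 : 1 < s) (hs2 : s < 2) (hh : MemLp h 2 muOm) :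
    HasLeftRLDeriv s (green s h) (fun x => -h x) := by
  refine ⟨hh.neg, ?_⟩
  rw [floor_s hs1 hs2]
  refine HasWeakDeriv.comp_one (hasWeakDeriv_pot (greenMass s h) (MemLp.integrableOn_Om hh) one_pos
    fun x hx => ?_) (hasWeakDeriv_pot_one _ (MemLp.integrableOn_Om hh))
  rw [leftInt_green hs1 (MemLp.integrableOn_Om hh) (by norm_num; linarith) ⟨hx.1.le, hx.2.le⟩]
  congr 1; push_cast; ring

lemma memLp_green (hs1 : 1 < s) (hh : MemLp h 2 muOm) : MemLp (green s h) 2 muOm := by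
  refine (memLp_pot (greenMass s h) hh (show 1 / 2 < s by linarith)).ae_eq ?_
  filter_upwards [ae_restrict_mem measurableSet_Ioo] with x hx
  exact (green_eq hs1 h ⟨hx.1.le, hx.2.le⟩).symm

/-- Green potentials are Hölder continuous of order `s - 1`. -/
lemma exists_abs_green_sub_le (hs1 : 1 < s) (hs2 : s < 2) (hh : MemLp h 2 muOm) :
    ∃ C, 0 ≤ C ∧ ∀ x ∈ Icc (0 : ℝ) 1, ∀ y ∈ Icc (0 : ℝ) 1,
      |green s h x - green s h y| ≤ C * |x - y| ^ (s - 1) := by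
  obtain ⟨A, hA, hk⟩ := abs_rk_sub_rk_le (by linarith : 0 < s) hs2.le
    (by linarith : 0 ≤ s - 1) (by linarith)
  obtain ⟨B, hB⟩ := exists_abs_fracInt_sub_le (by linarith : 1 / 2 < s) hs2.le
    (by linarith : 0 ≤ s - 1) (by linarith) (by linarith) hh
  refine ⟨|greenMass s h| * (A * 2) + |B|, by positivity, fun x hx y hy => ?_⟩
  rw [green_eq hs1 h hx, green_eq hs1 h hy, pot, pot]
  have h1 := hk x y
  simp only [sub_self, Real.rpow_zero] at h1
  have h2 : |greenMass s h * (rk s x - rk s y)| ≤ |greenMass s h| * (A * 2) * |x - y| ^ (s - 1) := by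
    rw [abs_mul]
    calc _ ≤ |greenMass s h| * (A * (|x - y| ^ (s - 1) * (1 + 1))) := by gcongr
      _ = _ := by ring
  have h3 := (hB x hx y hy).trans (mul_le_mul_of_nonneg_right (le_abs_self B)
    (by positivity : 0 ≤ |x - y| ^ (s - 1)))
  calc _ = |greenMass s h * (rk s x - rk s y) - (fracInt s (Om.indicator h) x -
        fracInt s (Om.indicator h) y)| := by congr 1; ring
    _ ≤ _ := (abs_sub _ _).trans (by rw [add_mul]; exact add_le_add h2 h3)

lemma continuousOn_green (hs1 : 1 < s) (hs2 : s < 2) (hh : MemLp h 2 muOm) :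
    ContinuousOn (green s h) (Icc 0 1) := by
  obtain ⟨C, -, hC⟩ := exists_abs_green_sub_le hs1 hs2 hh
  intro x hx
  rw [ContinuousWithinAt, tendsto_iff_dist_tendsto_zero]
  have ht : Tendsto (fun y : ℝ => C * |y - x| ^ (s - 1)) (nhdsWithin x (Icc 0 1)) (nhds 0) := by
    have : Continuous fun y : ℝ => C * |y - x| ^ (s - 1) :=
      continuous_const.mul (Continuous.rpow_const (by fun_prop) fun _ => Or.inr (by linarith))
    have h2 := (this.tendsto x).mono_left (nhdsWithin_le_nhds (s := Icc 0 1))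
    simpa [Real.zero_rpow (show s - 1 ≠ 0 by linarith)] using h2
  refine squeeze_zero' (Eventually.of_forall fun _ => dist_nonneg) ?_ ht
  filter_upwards [self_mem_nhdsWithin] with y hy
  rw [Real.dist_eq]
  exact hC y hy x hx

/-! ### Sobolev regularity of Green potentials -/

lemma hasWeakDeriv_zero {D : Set ℝ} {u : ℝ → ℝ} (hu : LocallyIntegrableOn u D) :
    HasWeakDeriv 0 D u u := ⟨hu, hu, fun φ _ _ _ => by simp⟩

lemma MemLp.locallyIntegrableOn {D : Set ℝ} {u : ℝ → ℝ} (hu : MemLp u 2 (volume.restrict D)) :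
    LocallyIntegrableOn u D :=
  locallyIntegrableOn_of_locallyIntegrable_restrict (hu.locallyIntegrable (by norm_num))

lemma memH_iff_of_lt_one {a : ℝ} (h0 : 0 < a) (h1 : a < 1) {D : Set ℝ} {u : ℝ → ℝ} :
    MemH a D u ↔ MemLp u 2 (volume.restrict D) ∧ slobodeckij a D u < ⊤ := by
  have hfl : ⌊a⌋₊ = 0 := Nat.floor_eq_zero.2 h1
  have hfr : Int.fract a = a := Int.fract_eq_self.2 ⟨h0.le, h1⟩
  unfold MemH
  rw [hfl, hfr]
  constructor
  · rintro ⟨w, rfl, h2, h3⟩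
    exact ⟨(h2 0 le_rfl).1, h3 h0.ne'⟩
  · rintro ⟨h2, h3⟩
    refine ⟨fun _ => u, rfl, fun k hk => ?_, fun _ => h3⟩
    rw [Nat.le_zero.1 hk]
    exact ⟨h2, hasWeakDeriv_zero (MemLp.locallyIntegrableOn h2)⟩

lemma slobodeckij_congr {r : ℝ} {D : Set ℝ} {u v : ℝ → ℝ} (h : u =ᵐ[volume.restrict D] v) :
    slobodeckij r D u = slobodeckij r D v := by
  unfold slobodeckij
  refine lintegral_congr_ae ?_
  filter_upwards [h] with x hx
  refine lintegral_congr_ae ?_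
  filter_upwards [h] with y hy
  rw [hx, hy]

lemma slobodeckij_pot_lt_top (c : ℝ) {τ r : ℝ} (hτ0 : 1 / 2 < τ) (hτ : τ ≤ 2) (hr0 : 0 < r)
    (hr1 : r < 1) (hr : r < τ - 1 / 2) (hh : MemLp h 2 muOm) :
    slobodeckij r Om (pot c h τ) < ⊤ :=
  slobodeckij_sub_lt_top (measurable_rk τ) c
    ((slobodeckij_mono (Ioo_subset_Ioo_left (by norm_num)) _).trans_lt
      (slobodeckij_rk_lt_top hτ hr0 hr1 hr))
    (slobodeckij_fracInt_lt_top hτ0 hτ hr0 hr1 hr hh)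

lemma MemH.congr_ae {a : ℝ} {u v : ℝ → ℝ} (h : MemH a Om u) (huv : u =ᵐ[muOm] v) :
    MemH a Om v := by
  obtain ⟨w, h0, h1, h2⟩ := h
  refine ⟨fun k => if k = 0 then v else w k, by simp, fun k hk => ?_, fun hf => ?_⟩
  · obtain ⟨h3, h4⟩ := h1 k hk
    by_cases hk0 : k = 0
    · subst hk0
      rw [h0] at h3
      have := h3.ae_eq huv
      exact ⟨by simpa using this, by simpa using hasWeakDeriv_zero (MemLp.locallyIntegrableOn this)⟩
    · simp only [hk0, if_false]
      exact ⟨h3, h4.congr_ae huv EventuallyEq.rfl⟩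
  · by_cases hk0 : ⌊a⌋₊ = 0
    · have := h2 hf
      rw [hk0, h0, slobodeckij_congr huv] at this
      simpa [hk0] using this
    · simpa [hk0] using h2 hf

/-- For `a < 1` the seminorm is that of a potential of order `s`. For `a ≥ 1` the first derivative
is the potential of order `s - 1`, and the same estimate applies to it with exponent `a - 1 < (s -
1) - 1/2`; here `a ≥ 1` forces `s - 1 > 1/2`. -/
lemma memH_green (hs1 : 1 < s) (hs2 : s < 2) (hh : MemLp h 2 muOm) {a : ℝ} (ha0 : 0 ≤ a)
    (ha : a < s - 1 / 2) : MemH a Om (green s h) := by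
  have hL := memLp_green hs1 hh
  have hge : green s h =ᵐ[muOm] pot (greenMass s h) h s := by
    filter_upwards [ae_restrict_mem measurableSet_Ioo] with x hx
    exact green_eq hs1 h ⟨hx.1.le, hx.2.le⟩
  have hd0 := hasWeakDeriv_zero (MemLp.locallyIntegrableOn hL)
  rcases ha0.eq_or_lt with h0 | h0
  · subst h0
    refine ⟨fun _ => green s h, rfl, fun k hk => ?_, fun hc => by simp at hc⟩
    simp only [Nat.floor_zero, Nat.le_zero] at hk
    subst hk
    exact ⟨hL, hd0⟩
  rcases lt_or_ge a 1 with h1 | h1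
  · rw [memH_iff_of_lt_one h0 h1, slobodeckij_congr hge]
    exact ⟨hL, slobodeckij_pot_lt_top _ (by linarith) hs2.le h0 h1 (by linarith) hh⟩
  · have hfl : ⌊a⌋₊ = 1 := by
      rw [Nat.floor_eq_iff (by linarith)]; norm_num; constructor <;> linarith
    have hfr : Int.fract a = a - 1 := by
      rw [← Int.fract_sub_one, Int.fract_eq_self]; constructor <;> linarith
    refine ⟨fun k => if k = 0 then green s h else pot (greenMass s h) h (s - 1), by simp,
      fun k hk => ?_, fun hf => ?_⟩
    · rw [hfl] at hk
      interval_cases k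
      · simpa using ⟨hL, hd0⟩
      · simp only [one_ne_zero, if_false]
        refine ⟨memLp_pot _ hh (by linarith), ?_⟩
        refine hasWeakDeriv_pot _ (MemLp.integrableOn_Om hh) (by linarith) fun x hx => ?_
        rw [green_eq hs1 h ⟨hx.1.le, hx.2.le⟩]; congr 1; ring
    · rw [hfr] at hf ⊢
      rw [hfl]
      simp only [one_ne_zero, if_false]
      have : 0 < a - 1 := lt_of_le_of_ne (by linarith) (Ne.symm hf)
      exact slobodeckij_pot_lt_top _ (by linarith) (by linarith) this (by linarith) (by linarith) hh

/-! ### Extension by zero -/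

lemma lintegral_Iic_one_div_rpow {p : ℝ} (hp : 0 < p) {x : ℝ} (hx : 0 < x) :
    ∫⁻ y in Iic (0 : ℝ), ENNReal.ofReal (1 / |x - y| ^ (1 + p)) = ENNReal.ofReal (x ^ (-p) / p) := by
  have e : ∫⁻ y in Iic (0 : ℝ), ENNReal.ofReal (1 / |x - y| ^ (1 + p)) =
      ∫⁻ t in Ici x, ENNReal.ofReal (t ^ (-(1 + p))) := by
    rw [← lintegral_indicator measurableSet_Iic, ← lintegral_indicator measurableSet_Ici,
      ← lintegral_sub_left_eq_self ((Ici x).indicator fun t => ENNReal.ofReal (t ^ (-(1 + p)))) x]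
    congr 1; ext y
    by_cases hy : y ≤ 0
    · rw [indicator_of_mem (mem_Iic.2 hy), indicator_of_mem (by simpa using hy),
        abs_of_pos (by linarith), Real.rpow_neg (by linarith), one_div]
    · rw [indicator_of_notMem (by simpa using hy), indicator_of_notMem (by simpa using hy)]
  rw [e, setLIntegral_congr Ioi_ae_eq_Ici.symm, ← ofReal_integral_eq_lintegral_ofReal
    (integrableOn_Ioi_rpow_of_lt (by linarith) hx), integral_Ioi_rpow_of_lt (by linarith) hx]
  · congr 1
    rw [show -(1 + p) + 1 = -p by ring, neg_div_neg_eq]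
  · filter_upwards [ae_restrict_mem measurableSet_Ioi] with t ht
    exact Real.rpow_nonneg (hx.trans ht).le _

lemma lintegral_Ici_one_div_rpow {p : ℝ} (hp : 0 < p) {x : ℝ} (hx : x < 1) :
    ∫⁻ y in Ici (1 : ℝ), ENNReal.ofReal (1 / |x - y| ^ (1 + p)) =
      ENNReal.ofReal ((1 - x) ^ (-p) / p) := by
  rw [← lintegral_Iic_one_div_rpow hp (sub_pos.2 hx), ← lintegral_indicator measurableSet_Iic,
    ← lintegral_indicator measurableSet_Ici, ← lintegral_sub_left_eq_self
      ((Iic (0 : ℝ)).indicator fun y => ENNReal.ofReal (1 / |1 - x - y| ^ (1 + p))) 1]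
  congr 1; ext y
  by_cases hy : 1 ≤ y
  · rw [indicator_of_mem (mem_Ici.2 hy), indicator_of_mem (by simpa using hy), abs_sub_comm]
    congr 4; ring
  · rw [indicator_of_notMem (by simpa using hy), indicator_of_notMem (by simpa using hy)]

/-- Integrating out the exterior variable leaves weights `x^(-s)` and `(1-x)^(-s)`. Decay of order
`s - 1` at both ends turns them into `x^(s-2)` and its reflection, integrable because `s > 1`. -/
lemma lintegral_sq_div_compl_lt_top {s C : ℝ} (hs1 : 1 < s) {u : ℝ → ℝ}
    (h0 : ∀ x ∈ Om, |u x| ≤ C * x ^ (s - 1)) (h1 : ∀ x ∈ Om, |u x| ≤ C * (1 - x) ^ (s - 1)) :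
    ∫⁻ x in Om, ∫⁻ y in Omᶜ, ENNReal.ofReal (u x ^ 2 / |x - y| ^ (1 + s)) < ⊤ := by
  have hpow : ∀ t : ℝ, 0 < t → (C * t ^ (s - 1)) ^ 2 * (t ^ (-s) / s) = C ^ 2 / s * t ^ (s - 2) := by
    intro t ht
    rw [mul_pow, ← Real.rpow_natCast (t ^ (s - 1)), ← Real.rpow_mul ht.le]
    have : t ^ ((s - 1) * ((2 : ℕ) : ℝ)) * t ^ (-s) = t ^ (s - 2) := by
      rw [← Real.rpow_add ht]; congr 1; push_cast; ring
    rw [← this]; ring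
  have hb : ∀ x ∈ Om, ∫⁻ y in Omᶜ, ENNReal.ofReal (u x ^ 2 / |x - y| ^ (1 + s)) ≤
      ENNReal.ofReal (C ^ 2 / s * x ^ (s - 2)) + ENNReal.ofReal (C ^ 2 / s * (1 - x) ^ (s - 2)) := by
    intro x hx
    have e : ∀ y, ENNReal.ofReal (u x ^ 2 / |x - y| ^ (1 + s)) =
        ENNReal.ofReal (u x ^ 2) * ENNReal.ofReal (1 / |x - y| ^ (1 + s)) := fun y => by
      rw [← ENNReal.ofReal_mul (by positivity)]; congr 1; ring
    simp_rw [e]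
    rw [lintegral_const_mul' _ _ ENNReal.ofReal_ne_top]
    have hx1 : 0 < 1 - x := by linarith [hx.2]
    have hsub : (Omᶜ : Set ℝ) ⊆ Iic 0 ∪ Ici 1 := by
      intro y hy
      by_contra hc
      simp only [mem_union, mem_Iic, mem_Ici, not_or, not_le] at hc
      exact hy hc
    calc _ ≤ ENNReal.ofReal (u x ^ 2) * (ENNReal.ofReal (x ^ (-s) / s) +
          ENNReal.ofReal ((1 - x) ^ (-s) / s)) := by
          gcongr
          refine (lintegral_mono_set hsub).trans ((lintegral_union_le _ _ _).trans ?_)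
          rw [lintegral_Iic_one_div_rpow (by linarith) hx.1,
            lintegral_Ici_one_div_rpow (by linarith) hx.2]
      _ ≤ _ := by
          rw [mul_add, ← ENNReal.ofReal_mul (by positivity), ← ENNReal.ofReal_mul (by positivity),
            ← hpow x hx.1, ← hpow (1 - x) hx1, ← sq_abs]
          have := hx.1
          gcongr
          · exact h0 x hx
          · exact h1 x hx
  have hfin : ∫⁻ x in Om, ENNReal.ofReal (C ^ 2 / s * x ^ (s - 2)) < ⊤ := by
    have hi := ((intervalIntegral.integrableOn_Ioo_rpow_iff one_pos).2
      (show -1 < s - 2 by linarith)).const_mul (C ^ 2 / s)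
    have := hi.2
    rwa [hasFiniteIntegral_iff_ofReal] at this
    filter_upwards [ae_restrict_mem measurableSet_Ioo] with t ht
    have := ht.1
    show 0 ≤ C ^ 2 / s * t ^ (s - 2)
    positivity
  have hrefl : ∫⁻ x in Om, ENNReal.ofReal (C ^ 2 / s * (1 - x) ^ (s - 2)) =
      ∫⁻ x in Om, ENNReal.ofReal (C ^ 2 / s * x ^ (s - 2)) := by
    rw [← lintegral_indicator measurableSet_Ioo, ← lintegral_indicator measurableSet_Ioo,
      ← lintegral_sub_left_eq_self (Om.indicator fun x => ENNReal.ofReal (C ^ 2 / s * x ^ (s - 2))) 1]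
    congr 1; ext x
    by_cases hx : x ∈ Om
    · rw [indicator_of_mem hx, indicator_of_mem]
      constructor <;> linarith [hx.1, hx.2]
    · rw [indicator_of_notMem hx, indicator_of_notMem]
      intro hc; exact hx (by constructor <;> linarith [hc.1, hc.2])
  calc _ ≤ ∫⁻ x in Om, (ENNReal.ofReal (C ^ 2 / s * x ^ (s - 2)) +
        ENNReal.ofReal (C ^ 2 / s * (1 - x) ^ (s - 2))) :=
        setLIntegral_mono' measurableSet_Ioo hb
    _ < ⊤ := by
        rw [lintegral_add_left (by fun_prop), hrefl]
        exact ENNReal.add_lt_top.2 ⟨hfin, hfin⟩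

/-- The plane splits into four rectangles: the interior one gives the seminorm on the interval, the
two mixed ones coincide by symmetry, and the exterior one contributes nothing. -/
lemma slobodeckij_indicator_le {r : ℝ} {u : ℝ → ℝ} (hu : AEMeasurable u muOm) :
    slobodeckij r univ (Om.indicator u) ≤ slobodeckij r Om u +
      2 * ∫⁻ x in Om, ∫⁻ y in Omᶜ, ENNReal.ofReal (u x ^ 2 / |x - y| ^ (1 + 2 * r)) := by
  have hU : AEMeasurable (Om.indicator u) volume := (aemeasurable_indicator_iff measurableSet_Ioo).2 hu
  have hF : AEMeasurable (fun p : ℝ × ℝ => ENNReal.ofReal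
      ((Om.indicator u p.1 - Om.indicator u p.2) ^ 2 / |p.1 - p.2| ^ (1 + 2 * r)))
      (volume.prod volume) := by
    have h1 : AEMeasurable (fun p : ℝ × ℝ => Om.indicator u p.1) (volume.prod volume) :=
      hU.comp_quasiMeasurePreserving Measure.quasiMeasurePreserving_fst
    have h2 : AEMeasurable (fun p : ℝ × ℝ => Om.indicator u p.2) (volume.prod volume) :=
      hU.comp_quasiMeasurePreserving Measure.quasiMeasurePreserving_snd
    exact (((h1.sub h2).pow_const 2).div (Measurable.aemeasurable (by fun_prop))).ennreal_ofReal
  set F : ℝ → ℝ → ℝ≥0∞ := fun x y => ENNReal.ofReal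
      ((Om.indicator u x - Om.indicator u y) ^ 2 / |x - y| ^ (1 + 2 * r)) with hFdef
  have hsymm : ∀ x y, F x y = F y x := fun x y => by
    simp only [hFdef, abs_sub_comm x y]; congr 2; ring
  set Q := ∫⁻ x in Om, ∫⁻ y in Omᶜ, ENNReal.ofReal (u x ^ 2 / |x - y| ^ (1 + 2 * r)) with hQ
  have e1 : ∫⁻ x in Om, ∫⁻ y in Om, F x y = slobodeckij r Om u :=
    setLIntegral_congr_fun measurableSet_Ioo fun x hx =>
      setLIntegral_congr_fun measurableSet_Ioo fun y hy => by
        simp only [hFdef, indicator_of_mem hx, indicator_of_mem hy]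
  have e2 : ∫⁻ x in Om, ∫⁻ y in Omᶜ, F x y = Q :=
    setLIntegral_congr_fun measurableSet_Ioo fun x hx =>
      setLIntegral_congr_fun measurableSet_Ioo.compl fun y hy => by
        simp only [hFdef, indicator_of_mem hx, indicator_of_notMem hy, sub_zero]
  have e3 : ∫⁻ x in Omᶜ, ∫⁻ y in Om, F x y = Q := by
    rw [lintegral_lintegral_swap, ← e2]
    · simp_rw [hsymm]
    · rw [Measure.prod_restrict]; exact hF.restrict
  have e4 : ∫⁻ x in Omᶜ, ∫⁻ y in Omᶜ, F x y = 0 := by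
    rw [setLIntegral_congr_fun (g := fun _ => 0) measurableSet_Ioo.compl, lintegral_zero]
    intro x hx
    simp only
    rw [setLIntegral_congr_fun (g := fun _ => 0) measurableSet_Ioo.compl, lintegral_zero]
    intro y hy
    simp only [hFdef, indicator_of_notMem hx, indicator_of_notMem hy]; simp
  have hsplit : ∀ x, ∫⁻ y, F x y = (∫⁻ y in Om, F x y) + ∫⁻ y in Omᶜ, F x y := fun x =>
    (lintegral_add_compl _ measurableSet_Ioo).symm
  have hm : ∀ A : Set ℝ, AEMeasurable (fun x => ∫⁻ y in A, F x y) volume := fun A => by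
    refine AEMeasurable.lintegral_prod_right' (f := fun p : ℝ × ℝ => F p.1 p.2) ?_
    exact hF.mono_ac (Measure.AbsolutelyContinuous.rfl.prod Measure.restrict_le_self.absolutelyContinuous)
  have : slobodeckij r univ (Om.indicator u) = ∫⁻ x, ∫⁻ y, F x y := by
    simp only [slobodeckij, Measure.restrict_univ, hFdef]
  rw [this, ← lintegral_add_compl _ measurableSet_Ioo (A := Om)]
  simp_rw [hsplit]
  rw [lintegral_add_left' (hm Om).restrict, lintegral_add_left' (hm Om).restrict, e1, e2, e3, e4,
    add_zero, two_mul, add_assoc]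

lemma memHTilde_half_iff (hs1 : 1 < s) (hs2 : s < 2) {u : ℝ → ℝ} : MemHTilde (s / 2) u ↔
    MemLp u 2 muOm ∧ slobodeckij (s / 2) univ (Om.indicator u) < ⊤ := by
  rw [MemHTilde, memH_iff_of_lt_one (by linarith) (by linarith),
    memH_iff_of_lt_one (by linarith) (by linarith), Measure.restrict_univ,
    memLp_indicator_iff_restrict measurableSet_Ioo]
  refine ⟨fun h => ⟨h.1.1, h.2.2⟩, fun h => ⟨⟨h.1, ?_⟩, h.1, h.2⟩⟩
  refine lt_of_eq_of_lt (slobodeckij_congr ?_)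
    ((slobodeckij_mono (subset_univ Om) (Om.indicator u)).trans_lt h.2)
  filter_upwards [ae_restrict_mem measurableSet_Ioo] with x hx
  rw [indicator_of_mem hx]

lemma memHTilde_green (hs1 : 1 < s) (hs2 : s < 2) (hh : MemLp h 2 muOm) :
    MemHTilde (s / 2) (green s h) := by
  have hL := memLp_green hs1 hh
  rw [memHTilde_half_iff hs1 hs2]
  refine ⟨hL, (slobodeckij_indicator_le hL.1.aemeasurable).trans_lt ?_⟩
  have hH := memH_green hs1 hs2 hh (by linarith : 0 ≤ s / 2) (by linarith)
  rw [memH_iff_of_lt_one (by linarith) (by linarith)] at hH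
  obtain ⟨C, -, hC⟩ := exists_abs_green_sub_le hs1 hs2 hh
  refine ENNReal.add_lt_top.2 ⟨hH.2, ENNReal.mul_lt_top (by simp) ?_⟩
  rw [show 2 * (s / 2) = s by ring]
  refine lintegral_sq_div_compl_lt_top hs1 (C := C) (fun x hx => ?_) fun x hx => ?_
  · have := hC x ⟨hx.1.le, hx.2.le⟩ 0 (left_mem_Icc.2 zero_le_one)
    rwa [green_zero hs1, sub_zero, sub_zero, abs_of_pos hx.1] at this
  · have := hC x ⟨hx.1.le, hx.2.le⟩ 1 (right_mem_Icc.2 zero_le_one)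
    rwa [green_one, sub_zero, abs_sub_comm x 1, abs_of_pos (sub_pos.2 hx.2)] at this

end

section

/-! ### The autocorrelation of the kernel -/

/-- The constant in the autocorrelation of the kernel of order `1 - α`. -/
def autoConst (α : ℝ) : ℝ := (∫⁻ t, ENNReal.ofReal (rk (1 - α) t * rk (1 - α) (t + 1))).toReal

variable {α : ℝ}

/-- The product is bounded by multiples of `t^(-α)` near zero and of `t^(-2α)` at infinity; `α < 1`
and `α > 1/2` make the respective integrals finite. -/
lemma lintegral_auto_ne_top (h1 : 1 / 2 < α) (h2 : α < 1) :
    ∫⁻ t, ENNReal.ofReal (rk (1 - α) t * rk (1 - α) (t + 1)) ≠ ⊤ := by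
  have hG := Real.Gamma_pos_of_pos (show 0 < 1 - α by linarith)
  set G := Real.Gamma (1 - α)
  have i1 : IntegrableOn (fun t : ℝ => t ^ (-α) / G ^ 2) (Ioc 0 1) := by
    have := (intervalIntegral.integrableOn_Ioo_rpow_iff one_pos).2 (show -1 < -α by linarith)
    exact ((integrableOn_Ioc_iff_integrableOn_Ioo (by simp)).2 this).div_const _
  have i2 : IntegrableOn (fun t : ℝ => t ^ (-(2 * α)) / G ^ 2) (Ioi 1) :=
    (integrableOn_Ioi_rpow_of_lt (by linarith) one_pos).div_const _
  have hi : IntegrableOn (fun t => rk (1 - α) t * rk (1 - α) (t + 1)) (Ioi 0) := by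
    rw [← Ioc_union_Ioi_eq_Ioi zero_le_one]
    refine IntegrableOn.union (i1.mono' (Measurable.aestronglyMeasurable (by fun_prop)) ?_)
      (i2.mono' (Measurable.aestronglyMeasurable (by fun_prop)) ?_)
    · filter_upwards [ae_restrict_mem measurableSet_Ioc] with t ht
      have h0 : 0 < t := ht.1
      rw [Real.norm_of_nonneg (mul_nonneg (rk_nonneg (by linarith) _) (rk_nonneg (by linarith) _)),
        rk_of_pos h0, rk_of_pos (by linarith : 0 < t + 1), show 1 - α - 1 = -α by ring]
      have : (t + 1) ^ (-α) ≤ 1 := Real.rpow_le_one_of_one_le_of_nonpos (by linarith) (by linarith)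
      rw [div_mul_div_comm, ← sq]
      gcongr
      exact mul_le_of_le_one_right (by positivity) this
    · filter_upwards [ae_restrict_mem measurableSet_Ioi] with t ht
      have h0 : 0 < t := one_pos.trans ht
      rw [Real.norm_of_nonneg (mul_nonneg (rk_nonneg (by linarith) _) (rk_nonneg (by linarith) _)),
        rk_of_pos h0, rk_of_pos (by linarith : 0 < t + 1), show 1 - α - 1 = -α by ring]
      have h3 : (t + 1) ^ (-α) ≤ t ^ (-α) :=
        Real.rpow_le_rpow_of_nonpos h0 (by linarith) (by linarith)
      have h4 : t ^ (-(2 * α)) = t ^ (-α) * t ^ (-α) := by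
        rw [← Real.rpow_add h0]; congr 1; ring
      rw [div_mul_div_comm, ← sq, h4]
      gcongr
  have h3 : Integrable (fun t => rk (1 - α) t * rk (1 - α) (t + 1)) := by
    refine (integrableOn_iff_integrable_of_support_subset ?_).1 hi
    intro t ht
    by_contra hc
    exact ht (by simp [rk_of_nonpos (not_lt.1 hc)])
  have := h3.2
  rw [hasFiniteIntegral_iff_ofReal (ae_of_all _ fun t =>
    mul_nonneg (rk_nonneg (by linarith) _) (rk_nonneg (by linarith) _))] at this
  exact this.ne

lemma autoConst_pos (h1 : 1 / 2 < α) (h2 : α < 1) : 0 < autoConst α := by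
  refine ENNReal.toReal_pos ?_ (lintegral_auto_ne_top h1 h2)
  intro hc
  rw [lintegral_eq_zero_iff (by fun_prop)] at hc
  have : ∀ᵐ t ∂(volume.restrict (Ioi (0 : ℝ))), False := by
    filter_upwards [ae_restrict_of_ae hc, ae_restrict_mem measurableSet_Ioi] with t ht h0
    have hG := Real.Gamma_pos_of_pos (show 0 < 1 - α by linarith)
    have h0' : 0 < t := h0
    simp only [Pi.zero_apply, ENNReal.ofReal_eq_zero] at ht
    rw [rk_of_pos h0', rk_of_pos (by linarith : 0 < t + 1)] at ht
    have : 0 < t ^ (1 - α - 1) / Real.Gamma (1 - α) * ((t + 1) ^ (1 - α - 1) / Real.Gamma (1 - α)) := by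
      positivity
    linarith
  rw [ae_iff] at this
  simp at this

/-- By translation and scaling the integral depends on `y - z` only through a power. Off the
diagonal this yields a positive semidefinite factorization of the kernel `|y - z|^(1-2α)`. -/
lemma lintegral_rk_mul_rk_auto (h1 : 1 / 2 < α) (h2 : α < 1) {y z : ℝ} (hyz : y ≠ z) :
    ∫⁻ x, ENNReal.ofReal (rk (1 - α) (x - y) * rk (1 - α) (x - z)) =
      ENNReal.ofReal (autoConst α * |y - z| ^ (1 - 2 * α)) := by
  wlog h : z < y generalizing y z
  · rw [abs_sub_comm, ← this hyz.symm (lt_of_le_of_ne (not_lt.1 h) hyz)]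
    simp_rw [mul_comm]
  have hL : 0 < y - z := sub_pos.2 h
  rw [← lintegral_add_right_eq_self _ y, lintegral_scale hL _ (by fun_prop)]
  have e : ∀ t, ENNReal.ofReal (rk (1 - α) ((y - z) * t + y - y) * rk (1 - α) ((y - z) * t + y - z)) =
      ENNReal.ofReal ((y - z) ^ (-(2 * α))) *
        ENNReal.ofReal (rk (1 - α) t * rk (1 - α) (t + 1)) := by
    intro t
    rw [← ENNReal.ofReal_mul (by positivity)]
    congr 1
    rcases le_or_gt t 0 with h0 | h0
    · rw [rk_of_nonpos h0, add_sub_cancel_right,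
        rk_of_nonpos (mul_nonpos_of_nonneg_of_nonpos hL.le h0)]; ring
    · have h3 : (y - z) * t + y - z = (y - z) * (t + 1) := by ring
      rw [add_sub_cancel_right, h3, rk_of_pos (mul_pos hL h0), rk_of_pos (mul_pos hL (by linarith)),
        rk_of_pos h0, rk_of_pos (by linarith : 0 < t + 1), Real.mul_rpow hL.le h0.le,
        Real.mul_rpow hL.le (by linarith)]
      have : (y - z) ^ (-(2 * α)) = (y - z) ^ (1 - α - 1) * (y - z) ^ (1 - α - 1) := by
        rw [← Real.rpow_add hL]; congr 1; ring
      rw [this]; ring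
  simp_rw [e]
  rw [lintegral_const_mul _ (by fun_prop), ← ENNReal.ofReal_toReal (lintegral_auto_ne_top h1 h2),
    ← autoConst, ← ENNReal.ofReal_mul (by positivity), ← ENNReal.ofReal_mul hL.le, abs_of_pos hL]
  congr 1
  have : (y - z) ^ (1 - 2 * α) = (y - z) * (y - z) ^ (-(2 * α)) := by
    nth_rw 2 [← Real.rpow_one (y - z)]
    rw [← Real.rpow_add hL]; congr 1
  rw [this]; ring

lemma ae_fst_ne_snd : ∀ᵐ p : ℝ × ℝ ∂(volume.prod volume), p.1 ≠ p.2 := by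
  rw [ae_iff]
  simp only [ne_eq, not_not]
  rw [Measure.measure_prod_null (measurableSet_eq_fun measurable_fst measurable_snd)]
  refine ae_of_all _ fun x => ?_
  have : (Prod.mk x ⁻¹' {p : ℝ × ℝ | p.1 = p.2}) = {x} := by ext; simp [eq_comm]
  simp [this]

/-- The `L²` norm of a fractional integral as a double integral. -/
theorem integral_sq_fracInt (h1 : 1 / 2 < α) (h2 : α < 1) {W : ℝ → ℝ}
    (hW : AEStronglyMeasurable W volume)
    (hi : Integrable (fun p : ℝ × ℝ => |p.1 - p.2| ^ (1 - 2 * α) * (W p.1 * W p.2))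
      (volume.prod volume)) :
    Integrable (fun x => fracInt (1 - α) W x ^ 2) ∧
      ∫ x, fracInt (1 - α) W x ^ 2 = autoConst α *
        ∫ p : ℝ × ℝ, |p.1 - p.2| ^ (1 - 2 * α) * (W p.1 * W p.2) ∂(volume.prod volume) := by
  have hα : 0 < 1 - α := by linarith
  have nn : ∀ x y z, 0 ≤ rk (1 - α) (x - y) * rk (1 - α) (x - z) := fun x y z =>
    mul_nonneg (rk_nonneg hα _) (rk_nonneg hα _)
  have hauto : ∀ y z, y ≠ z → Integrable (fun x => rk (1 - α) (x - y) * rk (1 - α) (x - z)) ∧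
      ∫ x, rk (1 - α) (x - y) * rk (1 - α) (x - z) = autoConst α * |y - z| ^ (1 - 2 * α) := by
    intro y z hyz
    have hl := lintegral_rk_mul_rk_auto h1 h2 hyz
    refine ⟨⟨Measurable.aestronglyMeasurable (by fun_prop), ?_⟩, ?_⟩
    · rw [hasFiniteIntegral_iff_ofReal (ae_of_all _ fun x => nn x y z), hl]
      exact ENNReal.ofReal_lt_top
    · rw [integral_eq_lintegral_of_nonneg_ae (ae_of_all _ fun x => nn x y z)
        (Measurable.aestronglyMeasurable (by fun_prop)), hl, ENNReal.toReal_ofReal]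
      exact mul_nonneg (autoConst_pos h1 h2).le (by positivity)
  set Φ : ℝ × (ℝ × ℝ) → ℝ := fun q =>
    (rk (1 - α) (q.1 - q.2.1) * W q.2.1) * (rk (1 - α) (q.1 - q.2.2) * W q.2.2) with hΦ
  have e : ∀ x y z, (rk (1 - α) (x - y) * W y) * (rk (1 - α) (x - z) * W z) =
      rk (1 - α) (x - y) * rk (1 - α) (x - z) * (W y * W z) := fun x y z => by ring
  have hm : AEStronglyMeasurable Φ (volume.prod (volume.prod volume)) := by
    refine AEStronglyMeasurable.mul (AEStronglyMeasurable.mul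
      (Measurable.aestronglyMeasurable (by fun_prop)) ?_)
      (AEStronglyMeasurable.mul (Measurable.aestronglyMeasurable (by fun_prop)) ?_)
    · exact (hW.comp_fst (ν := volume)).comp_snd
    · exact (hW.comp_snd (μ := volume)).comp_snd
  have hint : Integrable Φ (volume.prod (volume.prod volume)) := by
    rw [integrable_prod_iff' hm]
    constructor
    · filter_upwards [ae_fst_ne_snd] with p hp
      simp only [hΦ, e]
      exact (hauto p.1 p.2 hp).1.mul_const _
    · refine (hi.norm.const_mul (autoConst α)).congr ?_
      filter_upwards [ae_fst_ne_snd] with p hp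
      simp only [hΦ, e, norm_mul _ (W _ * W _)]
      simp_rw [Real.norm_of_nonneg (nn _ _ _)]
      rw [integral_mul_const, (hauto p.1 p.2 hp).2, Real.norm_of_nonneg (by positivity), mul_assoc]
  have hsq : ∀ x, ∫ p : ℝ × ℝ, Φ (x, p) ∂(volume.prod volume) = fracInt (1 - α) W x ^ 2 := by
    intro x
    simp only [hΦ]
    rw [integral_prod_mul (fun y => rk (1 - α) (x - y) * W y) (fun z => rk (1 - α) (x - z) * W z),
      sq, fracInt]
  refine ⟨?_, ?_⟩
  · simpa only [hsq] using hint.integral_prod_left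
  · have := integral_integral_swap (f := fun x p => Φ (x, p)) hint
    simp only [hsq] at this
    rw [this, ← integral_const_mul]
    refine integral_congr_ae ?_
    filter_upwards [ae_fst_ne_snd] with p hp
    simp only [hΦ, e]
    rw [integral_mul_const, (hauto p.1 p.2 hp).2, mul_assoc]

/-! ### Coercivity of the Green operator -/

lemma integrable_rk_mul_pot (c : ℝ) {h : ℝ → ℝ} (hh : IntegrableOn h Om) {a b : ℝ} (ha : 0 < a)
    (hb : 0 < b) (hab : 1 ≤ a + b) {x : ℝ} (hx : x ≤ 1) :
    Integrable fun y => rk a (x - y) * Om.indicator (pot c h b) y := by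
  have hH := integrable_indicator_Om hh
  have hi := integrable_rk_mul_of_one_le hab hH (indicator_Om_of_neg h) x
  have h1 : Integrable fun y => c * (rk a (x - y) * rk b (y - 0)) -
      rk a (x - y) * fracInt b (Om.indicator h) y :=
    ((integrable_rk_mul_rk ha hb x 0).const_mul c).sub (integrable_rk_mul_fracInt ha hb hH.1 hi)
  refine h1.congr (ae_of_all _ fun y => ?_)
  simp only [sub_zero]
  rcases le_or_gt x y with h | h
  · simp [rk_of_nonpos (sub_nonpos.2 h)]
  · by_cases hm : y ∈ Om
    · rw [indicator_of_mem hm, pot]; ring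
    · have hy0 : y ≤ 0 := by by_contra hc; exact hm ⟨not_le.1 hc, h.trans_le hx⟩
      rw [indicator_of_notMem hm, rk_of_nonpos hy0, fracInt_of_nonpos (indicator_Om_of_nonpos _) hy0]
      ring

/-- A potential subtracts its density, so the nonnegative majorant has density `-|h|`. -/
lemma abs_pot_le (c : ℝ) (h : ℝ → ℝ) {τ : ℝ} (hτ : 0 < τ) (x : ℝ) :
    |pot c h τ x| ≤ pot |c| (fun y => -|h y|) τ x := by
  have h1 : |fracInt τ (Om.indicator h) x| ≤ - fracInt τ (Om.indicator fun y => -|h y|) x := by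
    rw [fracInt_indicator, fracInt_indicator, ← integral_neg]
    refine (abs_integral_le_integral_abs).trans (le_of_eq ?_)
    congr 1; ext y
    rw [abs_mul, abs_of_nonneg (rk_nonneg hτ _)]; ring
  unfold pot
  calc _ ≤ |c * rk τ x| + |fracInt τ (Om.indicator h) x| := abs_sub _ _
    _ ≤ _ := by rw [abs_mul, abs_of_nonneg (rk_nonneg hτ _)]; linarith

lemma pot_one_le (c : ℝ) {h : ℝ → ℝ} (hh : IntegrableOn h Om) (x : ℝ) :
    pot |c| (fun y => -|h y|) 1 x ≤ |c| + ∫ y in Om, |h y| := by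
  have hk : ∀ t, rk 1 t ≤ 1 := fun t => by
    rcases le_or_gt t 0 with h | h
    · simp [rk_of_nonpos h]
    · simp [rk_one_of_pos h]
  have h1 : |c| * rk 1 x ≤ |c| := mul_le_of_le_one_right (abs_nonneg c) (hk x)
  have h2 : - fracInt 1 (Om.indicator fun y => -|h y|) x ≤ ∫ y in Om, |h y| := by
    rw [fracInt_indicator, ← integral_neg]
    refine integral_mono_of_nonneg (ae_of_all _ fun y => ?_) hh.abs (ae_of_all _ fun y => ?_)
    · simp only [Pi.zero_apply, mul_neg, neg_neg]
      exact mul_nonneg (rk_nonneg one_pos _) (abs_nonneg _)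
    · simp only [mul_neg, neg_neg]
      exact mul_le_of_le_one_left (abs_nonneg _) (hk _)
  unfold pot
  linarith

/-- The inner integral of the absolute value is dominated by a potential of order `(2 - s) + (s - 1)
= 1`, which is bounded. This works without `W` being square integrable, which may fail for `s ≤
3/2`. -/
lemma integrable_prod_pot {s : ℝ} (hs1 : 1 < s) (hs2 : s < 2) (c : ℝ) {h : ℝ → ℝ}
    (hh : IntegrableOn h Om) :
    Integrable (fun p : ℝ × ℝ => rk (2 - s) (p.1 - p.2) *
      (Om.indicator (pot c h (s - 1)) p.1 * Om.indicator (pot c h (s - 1)) p.2))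
      (volume.prod volume) := by
  set W := Om.indicator (pot c h (s - 1)) with hWdef
  have ha : 0 < 2 - s := by linarith
  have hb : 0 < s - 1 := by linarith
  have hW : Integrable W := integrable_indicator_Om (integrableOn_pot c hh hb)
  have hm : AEStronglyMeasurable (fun p : ℝ × ℝ => rk (2 - s) (p.1 - p.2) * (W p.1 * W p.2))
      (volume.prod volume) :=
    (Measurable.aestronglyMeasurable (by fun_prop)).mul (hW.1.comp_fst.mul hW.1.comp_snd)
  have e : ∀ z y, rk (2 - s) (z - y) * (W z * W y) = W z * (rk (2 - s) (z - y) * W y) :=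
    fun z y => by ring
  rw [integrable_prod_iff hm]
  constructor
  · refine ae_of_all _ fun z => ?_
    by_cases hz : z ∈ Om
    · simp only [e]
      exact (integrable_rk_mul_pot c hh ha hb (by linarith) hz.2.le).const_mul _
    · have : W z = 0 := indicator_of_notMem hz _
      simp [this]
  · refine (hW.norm.mul_const (|c| + ∫ y in Om, |h y|)).mono' hm.norm.integral_prod_right'
      (ae_of_all _ fun z => ?_)
    rw [Real.norm_of_nonneg (integral_nonneg fun _ => norm_nonneg _)]
    simp only [e, norm_mul (W _)]
    rw [integral_const_mul]
    by_cases hz : z ∈ Om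
    · gcongr
      refine le_trans ?_ (pot_one_le c hh z)
      have hhn : IntegrableOn (fun y => -|h y|) Om := hh.abs.neg
      have e2 := fracInt_pot |c| hhn ha hb (by linarith) hz.2.le
      rw [show 2 - s + (s - 1) = 1 by ring] at e2
      rw [← e2, fracInt]
      refine integral_mono (integrable_rk_mul_pot c hh ha hb (by linarith) hz.2.le).norm
        (integrable_rk_mul_pot |c| hhn ha hb (by linarith) hz.2.le) fun y => ?_
      simp only [norm_mul, Real.norm_of_nonneg (rk_nonneg ha _)]
      gcongr
      · exact rk_nonneg ha _
      · rw [hWdef, Real.norm_eq_abs]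
        by_cases hy : y ∈ Om
        · rw [indicator_of_mem hy, indicator_of_mem hy]; exact abs_pot_le c h hb y
        · rw [indicator_of_notMem hy, indicator_of_notMem hy, abs_zero]
    · rw [hWdef, indicator_of_notMem hz]; simp

/-- Integration by parts for two primitives; off the diagonal `rk 1 (x - y) + rk 1 (y - x) = 1`. -/
lemma integral_mul_fracInt_one_add {W H : ℝ → ℝ} (hW : Integrable W) (hH : Integrable H) :
    (∫ x, W x * fracInt 1 H x) + ∫ x, H x * fracInt 1 W x = (∫ x, W x) * ∫ x, H x := by
  have key : ∀ {A B : ℝ → ℝ}, Integrable A → Integrable B →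
      Integrable (fun p : ℝ × ℝ => A p.1 * (rk 1 (p.1 - p.2) * B p.2)) (volume.prod volume) := by
    intro A B hA hB
    refine (hA.mul_prod hB).mono (hA.1.comp_fst.mul
      ((Measurable.aestronglyMeasurable (by fun_prop)).mul hB.1.comp_snd)) (ae_of_all _ fun p => ?_)
    simp only [norm_mul]
    have : ‖rk 1 (p.1 - p.2)‖ ≤ 1 := by
      rw [Real.norm_of_nonneg (rk_nonneg one_pos _)]
      rcases le_or_gt (p.1 - p.2) 0 with h | h
      · simp [rk_of_nonpos h]
      · simp [rk_one_of_pos h]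
    gcongr
    exact mul_le_of_le_one_left (norm_nonneg _) this
  have e1 : ∫ x, W x * fracInt 1 H x = ∫ p : ℝ × ℝ, W p.1 * (rk 1 (p.1 - p.2) * H p.2)
      ∂(volume.prod volume) := by
    rw [integral_prod _ (key hW hH)]
    simp only [integral_const_mul, fracInt]
  have e2 : ∫ x, H x * fracInt 1 W x = ∫ p : ℝ × ℝ, H p.2 * (rk 1 (p.2 - p.1) * W p.1)
      ∂(volume.prod volume) := by
    have := integral_prod_swap (μ := (volume : Measure ℝ)) (ν := (volume : Measure ℝ))
      (fun p : ℝ × ℝ => H p.1 * (rk 1 (p.1 - p.2) * W p.2))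
    simp only [Prod.fst_swap, Prod.snd_swap] at this
    rw [this, integral_prod _ (key hH hW)]
    simp only [integral_const_mul, fracInt]
  have i2 : Integrable (fun p : ℝ × ℝ => H p.2 * (rk 1 (p.2 - p.1) * W p.1)) (volume.prod volume) :=
    (key hH hW).swap
  rw [e1, e2, ← integral_add (key hW hH) i2, ← integral_prod_mul]
  refine integral_congr_ae ?_
  filter_upwards [ae_fst_ne_snd] with p hp
  rcases lt_or_gt_of_ne hp with h | h
  · rw [rk_of_nonpos (by linarith : p.1 - p.2 ≤ 0), rk_one_of_pos (by linarith : 0 < p.2 - p.1)]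
    ring
  · rw [rk_of_nonpos (by linarith : p.2 - p.1 ≤ 0), rk_one_of_pos (by linarith : 0 < p.1 - p.2)]
    ring

/-- The quadratic form of the Green operator controls the maximum norm of the potential. -/
theorem exists_green_coercive {s : ℝ} (hs1 : 1 < s) (hs2 : s < 2) :
    ∃ c, 0 < c ∧ ∀ h : ℝ → ℝ, MemLp h 2 muOm → ∀ x ∈ Icc (0 : ℝ) 1,
      c * green s h x ^ 2 ≤ ∫ y in Om, green s h y * h y := by
  have ha : 0 < 2 - s := by linarith
  have hb : 0 < s - 1 := by linarith
  have hα1 : 1 / 2 < s / 2 := by linarith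
  have hα2 : s / 2 < 1 := by linarith
  have hG := Real.Gamma_pos_of_pos ha
  have hA := autoConst_pos hα1 hα2
  have hB := rkBound_pos hα1
  -- The three factors come from symmetrizing the kernel, from the autocorrelation identity and from
  -- the maximum bound for `I^(s/2)` on `L²`.
  refine ⟨1 / (2 * Real.Gamma (2 - s) * autoConst (s / 2) * rkBound (s / 2)), by positivity,
    fun h hh x hx => ?_⟩
  have hh1 := MemLp.integrableOn_Om hh
  set c := greenMass s h
  set W := Om.indicator (pot c h (s - 1)) with hWdef
  have hW : Integrable W := integrable_indicator_Om (integrableOn_pot c hh1 hb)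
  have hH := integrable_indicator_Om hh1
  have hfW : ∀ x ≤ 1, fracInt 1 W x = pot c h s x := fun x hx => by
    rw [hWdef, fracInt_pot c hh1 one_pos hb (by linarith) hx]; congr 1; ring
  have hprod : Integrable (fun p : ℝ × ℝ => rk (2 - s) (p.1 - p.2) * (W p.1 * W p.2))
      (volume.prod volume) := integrable_prod_pot hs1 hs2 c hh1
  have hprod' : Integrable (fun p : ℝ × ℝ => rk (2 - s) (p.2 - p.1) * (W p.2 * W p.1))
      (volume.prod volume) := hprod.swap
  -- `W` is the derivative of the Green potential, which vanishes at both ends. This is where the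
  -- boundary condition at `1` enters: it removes the boundary term in the integration by parts.
  have hW0 : ∫ x, W x = 0 := by
    have h1 : fracInt 1 W 1 = ∫ x, W x := by
      unfold fracInt
      congr 1; ext y
      by_cases hy : y < 1
      · rw [rk_one_of_pos (sub_pos.2 hy), one_mul]
      · rw [hWdef, indicator_of_notMem (fun hc => hy hc.2), mul_zero]
    rw [← h1, hfW 1 le_rfl, ← green_eq hs1 h (right_mem_Icc.2 zero_le_one), green_one]
  -- the quadratic form as a double integral
  have hform : ∫ y in Om, green s h y * h y = ∫ p : ℝ × ℝ, rk (2 - s) (p.1 - p.2) * (W p.1 * W p.2)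
      ∂(volume.prod volume) := by
    have e1 : ∫ y in Om, green s h y * h y = ∫ y, Om.indicator h y * fracInt 1 W y := by
      rw [← integral_indicator measurableSet_Ioo]
      congr 1; ext y
      by_cases hy : y ∈ Om
      · rw [indicator_of_mem hy, indicator_of_mem hy, hfW y hy.2.le,
          green_eq hs1 h ⟨hy.1.le, hy.2.le⟩, mul_comm]
      · rw [indicator_of_notMem hy, indicator_of_notMem hy, zero_mul]
    have e2 : ∫ p : ℝ × ℝ, rk (2 - s) (p.1 - p.2) * (W p.1 * W p.2) ∂(volume.prod volume) =
        ∫ z, W z * (c - fracInt 1 (Om.indicator h) z) := by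
      rw [integral_prod _ hprod]
      congr 1; ext z
      have : ∀ y, rk (2 - s) (z - y) * (W z * W y) = W z * (rk (2 - s) (z - y) * W y) :=
        fun y => by ring
      simp only [this]
      rw [integral_const_mul]
      by_cases hz : z ∈ Om
      · have e3 := fracInt_pot c hh1 ha hb (by linarith) hz.2.le
        rw [show 2 - s + (s - 1) = 1 by ring, pot, rk_one_of_pos hz.1, mul_one] at e3
        rw [← e3, fracInt]
      · rw [hWdef, indicator_of_notMem hz, zero_mul, zero_mul]
    have i1 : Integrable fun z => W z * fracInt 1 (Om.indicator h) z := by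
      have := hprod.integral_prod_left
      refine ((hW.mul_const c).sub this).congr (ae_of_all _ fun z => ?_)
      simp only [Pi.sub_apply]
      have : ∀ y, rk (2 - s) (z - y) * (W z * W y) = W z * (rk (2 - s) (z - y) * W y) :=
        fun y => by ring
      simp only [this]
      rw [integral_const_mul]
      by_cases hz : z ∈ Om
      · have e3 := fracInt_pot c hh1 ha hb (by linarith) hz.2.le
        rw [show 2 - s + (s - 1) = 1 by ring, pot, rk_one_of_pos hz.1, mul_one, fracInt] at e3
        rw [hWdef, e3]; ring
      · rw [hWdef, indicator_of_notMem hz]; ring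
    have e4 := integral_mul_fracInt_one_add hW hH
    simp_rw [e2, mul_sub]
    rw [integral_sub (hW.mul_const c) i1, integral_mul_const, e1]
    rw [hW0, zero_mul] at e4 ⊢
    linarith
  -- symmetrization
  have habs : ∀ p : ℝ × ℝ, |p.1 - p.2| ^ (1 - 2 * (s / 2)) * (W p.1 * W p.2) =
      Real.Gamma (2 - s) * (rk (2 - s) (p.1 - p.2) * (W p.1 * W p.2)) +
      Real.Gamma (2 - s) * (rk (2 - s) (p.2 - p.1) * (W p.2 * W p.1)) := by
    intro p
    have : |p.1 - p.2| ^ (1 - 2 * (s / 2)) = Real.Gamma (2 - s) * rk (2 - s) (p.1 - p.2) +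
        Real.Gamma (2 - s) * rk (2 - s) (p.2 - p.1) := by
      rw [show 1 - 2 * (s / 2) = 2 - s - 1 by ring]
      rcases lt_trichotomy p.1 p.2 with h | h | h
      · rw [rk_of_nonpos (by linarith : p.1 - p.2 ≤ 0), rk_of_pos (sub_pos.2 h), abs_sub_comm,
          abs_of_pos (sub_pos.2 h)]; field_simp; ring
      -- On the diagonal both sides are zero, by the convention that `0` to a nonzero power is `0`.
      · rw [h, sub_self, abs_zero, rk_of_nonpos le_rfl, Real.zero_rpow (by linarith)]; ring
      · rw [rk_of_nonpos (by linarith : p.2 - p.1 ≤ 0), rk_of_pos (sub_pos.2 h),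
          abs_of_pos (sub_pos.2 h)]; field_simp; ring
    rw [this]; ring
  have hi : Integrable (fun p : ℝ × ℝ => |p.1 - p.2| ^ (1 - 2 * (s / 2)) * (W p.1 * W p.2))
      (volume.prod volume) := by
    simp_rw [habs]
    exact (hprod.const_mul _).add (hprod'.const_mul _)
  have hsym : ∫ p : ℝ × ℝ, |p.1 - p.2| ^ (1 - 2 * (s / 2)) * (W p.1 * W p.2) ∂(volume.prod volume) =
      2 * Real.Gamma (2 - s) * ∫ y in Om, green s h y * h y := by
    simp_rw [habs]
    rw [integral_add (hprod.const_mul _) (hprod'.const_mul _), integral_const_mul,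
      integral_const_mul, hform]
    have := integral_prod_swap (μ := (volume : Measure ℝ)) (ν := (volume : Measure ℝ))
      (fun p : ℝ × ℝ => rk (2 - s) (p.1 - p.2) * (W p.1 * W p.2))
    simp only [Prod.fst_swap, Prod.snd_swap] at this
    rw [this]; ring
  obtain ⟨hI, hE⟩ := integral_sq_fracInt hα1 hα2 hW.1 hi
  rw [hsym] at hE
  have hD : MemLp (fracInt (1 - s / 2) W) 2 muOm := by
    rw [memLp_two_iff_integrable_sq]
    · exact hI.restrict
    · exact (integrableOn_fracInt_Om (by linarith) (integrableOn_pot c hh1 hb)).1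
  have hle : ∫ y in Om, fracInt (1 - s / 2) W y ^ 2 ≤ ∫ y, fracInt (1 - s / 2) W y ^ 2 :=
    setIntegral_le_integral hI (ae_of_all _ fun _ => sq_nonneg _)
  -- Writing the order-one integral of `W` as `I^(s/2) I^(1-s/2) W` exhibits the potential as an
  -- integral of order above `1/2` of an `L²` function whose norm is the quadratic form.
  have hgx : green s h x = fracInt (s / 2) (Om.indicator (fracInt (1 - s / 2) W)) x := by
    have hi1 := integrable_rk_mul_of_one_le le_rfl hW (indicator_Om_of_neg _) x
    rw [green_eq hs1 h hx, ← hfW x hx.2]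
    have := fracInt_fracInt (a := s / 2) (b := 1 - s / 2) (by linarith) (by linarith) hW.1 (x := x)
      (by rw [show s / 2 + (1 - s / 2) = 1 by ring]; exact hi1)
    rw [show s / 2 + (1 - s / 2) = 1 by ring] at this
    rw [← this]
    refine fracInt_congr (ae_of_all _ fun y hy => ?_)
    by_cases hm : y ∈ Om
    · rw [indicator_of_mem hm]
    · have hy0 : y ≤ 0 := by by_contra hc; exact hm ⟨not_le.1 hc, hy.trans_le hx.2⟩
      rw [indicator_of_notMem hm, fracInt_of_nonpos (indicator_Om_of_nonpos _) hy0]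
  have hfin := sq_fracInt_le hα1 hD hx.2
  rw [← hgx] at hfin
  rw [div_mul_eq_mul_div, one_mul, div_le_iff₀ (by positivity)]
  calc green s h x ^ 2 ≤ rkBound (s / 2) * ∫ y in Om, fracInt (1 - s / 2) W y ^ 2 := hfin
    _ ≤ rkBound (s / 2) * (autoConst (s / 2) * (2 * Real.Gamma (2 - s) *
        ∫ y in Om, green s h y * h y)) := by rw [← hE]; gcongr
    _ = _ := by ring

end

section

/-! ### Translation differences and the Slobodeckij seminorm -/

/-- The squared `L²` norm of the translation difference. -/
def diffSq (U : ℝ → ℝ) (t : ℝ) : ℝ≥0∞ := ∫⁻ y, ENNReal.ofReal ((U (y + t) - U y) ^ 2)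

variable {U : ℝ → ℝ} {s : ℝ}

lemma measurable_diffSq (hU : Measurable U) : Measurable (diffSq U) :=
  Measurable.lintegral_prod_right' (f := fun p : ℝ × ℝ => ENNReal.ofReal
    ((U (p.2 + p.1) - U p.2) ^ 2)) (by fun_prop)

lemma diffSq_zero (U : ℝ → ℝ) : diffSq U 0 = 0 := by simp [diffSq]

/-- The substitution `x = y + t` in the double integral. -/
lemma lintegral_diffSq (hU : Measurable U) (r : ℝ) :
    ∫⁻ t, diffSq U t * ENNReal.ofReal (1 / |t| ^ (1 + 2 * r)) = slobodeckij r univ U := by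
  unfold slobodeckij diffSq
  simp only [Measure.restrict_univ]
  have e : ∀ t, (∫⁻ y, ENNReal.ofReal ((U (y + t) - U y) ^ 2)) *
      ENNReal.ofReal (1 / |t| ^ (1 + 2 * r)) =
      ∫⁻ y, ENNReal.ofReal ((U (y + t) - U y) ^ 2 / |t| ^ (1 + 2 * r)) := by
    intro t
    rw [← lintegral_mul_const _ (by fun_prop)]
    congr 1; ext y
    rw [← ENNReal.ofReal_mul (by positivity)]; congr 1; ring
  simp_rw [e]
  rw [lintegral_lintegral_swap (Measurable.aemeasurable (by fun_prop)),
    lintegral_lintegral_swap (f := fun x y => ENNReal.ofReal ((U x - U y) ^ 2 / |x - y| ^ (1 + 2 * r)))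
      (Measurable.aemeasurable (by fun_prop))]
  congr 1; ext y
  rw [← lintegral_add_left_eq_self (fun x => ENNReal.ofReal ((U x - U y) ^ 2 / |x - y| ^ (1 + 2 * r))) y]
  simp

lemma diffSq_add_le (hU : Measurable U) (r t : ℝ) :
    diffSq U (r + t) ≤ 2 * diffSq U r + 2 * diffSq U t := by
  have h1 : diffSq U t = ∫⁻ y, ENNReal.ofReal ((U (y + (r + t)) - U (y + r)) ^ 2) := by
    unfold diffSq
    rw [← lintegral_add_right_eq_self _ r]
    simp only [add_assoc]
  rw [h1]
  unfold diffSq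
  rw [← lintegral_const_mul _ (by fun_prop), ← lintegral_const_mul _ (by fun_prop),
    ← lintegral_add_left (by fun_prop)]
  refine lintegral_mono fun y => ?_
  rw [show (2 : ℝ≥0∞) = ENNReal.ofReal 2 by simp, ← ENNReal.ofReal_mul (by norm_num),
    ← ENNReal.ofReal_mul (by norm_num), ← ENNReal.ofReal_add (by positivity) (by positivity)]
  refine ENNReal.ofReal_le_ofReal ?_
  nlinarith [sq_nonneg (U (y + (r + t)) - U (y + r) - (U (y + r) - U y))]

lemma diffSq_neg (U : ℝ → ℝ) (t : ℝ) : diffSq U (-t) = diffSq U t := by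
  unfold diffSq
  rw [← lintegral_add_right_eq_self _ t]
  congr 1; ext y
  rw [add_neg_cancel_right]; congr 1; ring

/-- Averaging `diffSq U t ≤ 2 diffSq U r + 2 diffSq U (t - r)` over `r ∈ (0,t)` gives `t · diffSq U
t ≤ 4 ∫₀ᵗ diffSq U`. On that range the Slobodeckij weight is at least `t^(-(1+2r))`, with `r` now
the order. -/
lemma diffSq_le (hU : Measurable U) {r : ℝ} (hr : 0 < r) (t : ℝ) :
    diffSq U t ≤ ENNReal.ofReal (4 * |t| ^ (2 * r)) * slobodeckij r univ U := by
  wlog ht : 0 < t generalizing t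
  · rcases (not_lt.1 ht).eq_or_lt with h | h
    · rw [h, diffSq_zero]; exact zero_le
    · rw [← diffSq_neg, ← abs_neg]; exact this (-t) (by linarith)
  rw [abs_of_pos ht]
  have h1 : ENNReal.ofReal t * diffSq U t ≤ 4 * ∫⁻ r in Ioo 0 t, diffSq U r := by
    have e1 : ∫⁻ _ in Ioo 0 t, diffSq U t = ENNReal.ofReal t * diffSq U t := by
      rw [setLIntegral_const, Real.volume_Ioo, sub_zero, mul_comm]
    have e2 : ∫⁻ r in Ioo 0 t, diffSq U (t - r) = ∫⁻ r in Ioo 0 t, diffSq U r := by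
      rw [← lintegral_indicator measurableSet_Ioo, ← lintegral_indicator measurableSet_Ioo,
        ← lintegral_sub_left_eq_self ((Ioo 0 t).indicator fun r => diffSq U r) t]
      congr 1; ext x
      by_cases hx : x ∈ Ioo 0 t
      · rw [indicator_of_mem hx, indicator_of_mem]
        constructor <;> linarith [hx.1, hx.2]
      · rw [indicator_of_notMem hx, indicator_of_notMem]
        intro hc; exact hx (by constructor <;> linarith [hc.1, hc.2])
    rw [← e1]
    calc _ ≤ ∫⁻ r in Ioo 0 t, (2 * diffSq U r + 2 * diffSq U (t - r)) := by
          refine lintegral_mono fun r => ?_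
          have := diffSq_add_le hU r (t - r)
          rwa [add_sub_cancel] at this
      _ = 2 * (∫⁻ r in Ioo 0 t, diffSq U r) + 2 * ∫⁻ r in Ioo 0 t, diffSq U r := by
          have hm := measurable_diffSq hU
          rw [lintegral_add_left (by fun_prop), lintegral_const_mul _ hm,
            lintegral_const_mul _ (by fun_prop), e2]
      _ = _ := by rw [← add_mul]; norm_num
  have h2 : ∫⁻ x in Ioo 0 t, diffSq U x ≤ ENNReal.ofReal (t ^ (1 + 2 * r)) * slobodeckij r univ U := by
    rw [← lintegral_diffSq hU, ← lintegral_const_mul' _ _ ENNReal.ofReal_ne_top]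
    refine le_trans (setLIntegral_mono' measurableSet_Ioo fun x hx => ?_) (setLIntegral_le_lintegral _ _)
    rw [mul_left_comm, ← ENNReal.ofReal_mul (by positivity)]
    refine le_mul_of_one_le_right zero_le ?_
    rw [← ENNReal.ofReal_one]
    refine ENNReal.ofReal_le_ofReal ?_
    have hx0 := hx.1
    rw [abs_of_pos hx.1, mul_one_div, le_div_iff₀ (by positivity), one_mul]
    exact Real.rpow_le_rpow hx.1.le hx.2.le (by linarith)
  have h3 : ENNReal.ofReal t * diffSq U t ≤
      ENNReal.ofReal t * (ENNReal.ofReal (4 * t ^ (2 * r)) * slobodeckij r univ U) := by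
    refine h1.trans ((mul_le_mul_right h2 4).trans (le_of_eq ?_))
    rw [← mul_assoc, ← mul_assoc, ← ENNReal.ofReal_mul ht.le,
      show (4 : ℝ≥0∞) = ENNReal.ofReal 4 by simp, ← ENNReal.ofReal_mul (by norm_num)]
    congr 2
    rw [Real.rpow_add ht, Real.rpow_one]; ring
  rwa [ENNReal.mul_le_mul_iff_right (by simpa using ht) ENNReal.ofReal_ne_top] at h3

/-! ### Second differences of powers -/

/-- By homogeneity this is Taylor's formula for `(1+η)^q + (1-η)^q` at `η = δ/t ≤ 1/2`, whose first
derivative vanishes at `0`. -/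
lemma exists_second_diff_rpow_le (q : ℝ) : ∃ C, 0 ≤ C ∧ ∀ t δ : ℝ, 0 < t → 0 ≤ δ → 2 * δ ≤ t →
    |(t + δ) ^ q + (t - δ) ^ q - 2 * t ^ q| ≤ C * δ ^ 2 * t ^ (q - 2) := by
  set f : ℝ → ℝ := fun η => (1 + η) ^ q + (1 - η) ^ q with hf
  have hd : ∀ η ∈ Icc (0 : ℝ) (1 / 2), ContDiffAt ℝ 2 f η := by
    intro η hη
    refine ContDiffAt.add (ContDiffAt.rpow_const_of_ne (by fun_prop) ?_)
      (ContDiffAt.rpow_const_of_ne (by fun_prop) ?_)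
    · linarith [hη.1]
    · have := hη.2; intro h; linarith
  obtain ⟨C, hC⟩ := exists_taylor_mean_remainder_bound (f := f) (a := 0) (b := 1 / 2) (n := 1)
    (by norm_num) (fun η hη => by exact_mod_cast (hd η hη).contDiffWithinAt)
  have hder : derivWithin f (Icc 0 (1 / 2)) 0 = 0 := by
    have : HasDerivAt f (1 * q * (1 + 0) ^ (q - 1) + (-1) * q * (1 - 0) ^ (q - 1)) 0 := by
      refine HasDerivAt.add ?_ ?_
      · exact ((hasDerivAt_id (0 : ℝ)).const_add 1).rpow_const (Or.inl (by norm_num))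
      · exact ((hasDerivAt_id (0 : ℝ)).const_sub 1).rpow_const (Or.inl (by norm_num))
    rw [this.hasDerivWithinAt.derivWithin (uniqueDiffOn_Icc (by norm_num) 0 (by norm_num))]
    simp
  refine ⟨|C|, abs_nonneg C, fun t δ ht hδ hδt => ?_⟩
  have hη : δ / t ∈ Icc (0 : ℝ) (1 / 2) :=
    ⟨by positivity, by rw [div_le_iff₀ ht]; linarith⟩
  have h1 := hC (δ / t) hη
  rw [taylorWithinEval_succ, taylor_within_zero_eval, iteratedDerivWithin_one, hder] at h1
  simp only [smul_zero, add_zero, sub_zero, hf, Real.one_rpow, Real.norm_eq_abs] at h1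
  have e1 : (t + δ) ^ q = t ^ q * (1 + δ / t) ^ q := by
    rw [← Real.mul_rpow ht.le (by linarith [hη.1])]; congr 1; field_simp
  have e2 : (t - δ) ^ q = t ^ q * (1 - δ / t) ^ q := by
    rw [← Real.mul_rpow ht.le (by linarith [hη.2])]; congr 1; field_simp
  have e3 : t ^ (q - 2) = t ^ q / t ^ 2 := by
    rw [Real.rpow_sub ht]; norm_cast
  have ptq : 0 < t ^ q := by positivity
  calc |(t + δ) ^ q + (t - δ) ^ q - 2 * t ^ q| =
      t ^ q * |(1 + δ / t) ^ q + (1 - δ / t) ^ q - (1 + 1)| := by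
        rw [e1, e2, ← abs_of_pos ptq, ← abs_mul, abs_of_pos ptq]; congr 1; ring
    _ ≤ t ^ q * (|C| * (δ / t) ^ 2) := by
        gcongr
        refine h1.trans ?_
        norm_num
        gcongr
        exact le_abs_self C
    _ = _ := by rw [e3, div_pow]; ring

/-- The second difference of the kernel `|t|^β`. -/
def secDiff (β δ t : ℝ) : ℝ := |t - δ| ^ β + |t + δ| ^ β - 2 * |t| ^ β

@[fun_prop]
lemma measurable_secDiff (β δ : ℝ) : Measurable (secDiff β δ) := by unfold secDiff; fun_prop

lemma exists_abs_secDiff_le (β : ℝ) : ∃ C, 0 ≤ C ∧ ∀ t δ : ℝ, 0 < δ → 2 * δ ≤ |t| →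
    |secDiff β δ t| ≤ C * δ ^ 2 * |t| ^ (β - 2) := by
  obtain ⟨C, hC0, hC⟩ := exists_second_diff_rpow_le β
  refine ⟨C, hC0, fun t δ hδ ht => ?_⟩
  have h1 := hC |t| δ (by linarith) hδ.le ht
  refine le_trans (le_of_eq ?_) h1
  unfold secDiff
  congr 1
  rcases le_or_gt 0 t with h | h
  · rw [abs_of_nonneg h] at ht ⊢
    rw [abs_of_nonneg (by linarith : 0 ≤ t - δ), abs_of_nonneg (by linarith : 0 ≤ t + δ)]
    ring
  · rw [abs_of_neg h] at ht ⊢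
    rw [abs_of_neg (by linarith : t - δ < 0), abs_of_neg (by linarith : t + δ < 0),
      show -(t - δ) = -t + δ by ring, show -(t + δ) = -t - δ by ring]

lemma lintegral_abs_rpow_Ioo {β : ℝ} {c : ℝ} (hc : 0 < c) :
    ∫⁻ t in Ioo (-c) c, ENNReal.ofReal (|t| ^ β) =
      ENNReal.ofReal (c ^ (β + 1)) * ∫⁻ t in Ioo (-1 : ℝ) 1, ENNReal.ofReal (|t| ^ β) := by
  rw [← lintegral_indicator measurableSet_Ioo, ← lintegral_indicator measurableSet_Ioo,
    lintegral_scale hc _ (Measurable.indicator (by fun_prop) measurableSet_Ioo),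
    ← lintegral_const_mul' _ _ ENNReal.ofReal_ne_top, ← lintegral_const_mul' _ _ ENNReal.ofReal_ne_top]
  congr 1; ext t
  by_cases ht : t ∈ Ioo (-1 : ℝ) 1
  · rw [indicator_of_mem ht, indicator_of_mem, ← ENNReal.ofReal_mul hc.le,
      ← ENNReal.ofReal_mul (by positivity), abs_mul, abs_of_pos hc,
      Real.mul_rpow hc.le (abs_nonneg t), Real.rpow_add hc, Real.rpow_one]
    · congr 1; ring
    · constructor <;> nlinarith [ht.1, ht.2]
  · rw [indicator_of_notMem ht, indicator_of_notMem, mul_zero, mul_zero]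
    intro hh
    refine ht ⟨?_, ?_⟩ <;> by_contra hcon <;> nlinarith [hh.1, hh.2]

/-- No cancellation is used near the singularity: each of the four powers is shifted by at most `δ`
and thus stays in `(-3δ, 3δ)`. -/
lemma lintegral_abs_secDiff_le {β δ : ℝ} (hδ : 0 < δ) :
    ∫⁻ t in Ioo (-(2 * δ)) (2 * δ), ENNReal.ofReal |secDiff β δ t| ≤
      4 * (ENNReal.ofReal ((3 * δ) ^ (β + 1)) *
        ∫⁻ t in Ioo (-1 : ℝ) 1, ENNReal.ofReal (|t| ^ β)) := by
  rw [← lintegral_abs_rpow_Ioo (by linarith : 0 < 3 * δ)]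
  have tr : ∀ e : ℝ, |e| ≤ δ → ∫⁻ t in Ioo (-(2 * δ)) (2 * δ), ENNReal.ofReal (|t + e| ^ β) ≤
      ∫⁻ t in Ioo (-(3 * δ)) (3 * δ), ENNReal.ofReal (|t| ^ β) := by
    intro e he
    rw [abs_le] at he
    rw [← lintegral_indicator measurableSet_Ioo, ← lintegral_indicator measurableSet_Ioo,
      ← lintegral_add_right_eq_self ((Ioo (-(3 * δ)) (3 * δ)).indicator _) e]
    refine lintegral_mono fun t => ?_
    by_cases ht : t ∈ Ioo (-(2 * δ)) (2 * δ)
    · rw [indicator_of_mem ht, indicator_of_mem]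
      constructor <;> linarith [ht.1, ht.2, he.1, he.2]
    · rw [indicator_of_notMem ht]; exact zero_le
  have t1 := tr (-δ) (by rw [abs_neg, abs_of_pos hδ])
  have t2 := tr δ (by rw [abs_of_pos hδ])
  have t3 := tr 0 (by rw [abs_zero]; exact hδ.le)
  set L := ∫⁻ t in Ioo (-(3 * δ)) (3 * δ), ENNReal.ofReal (|t| ^ β)
  calc _ ≤ ∫⁻ t in Ioo (-(2 * δ)) (2 * δ), (ENNReal.ofReal (|t + -δ| ^ β) +
        ENNReal.ofReal (|t + δ| ^ β) + 2 * ENNReal.ofReal (|t + 0| ^ β)) := by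
        refine lintegral_mono fun t => ?_
        rw [show (2 : ℝ≥0∞) = ENNReal.ofReal 2 by simp, ← ENNReal.ofReal_mul (by norm_num),
          ← ENNReal.ofReal_add (by positivity) (by positivity),
          ← ENNReal.ofReal_add (by positivity) (by positivity)]
        refine ENNReal.ofReal_le_ofReal ?_
        unfold secDiff
        rw [add_zero, ← sub_eq_add_neg, abs_le]
        have a1 : 0 ≤ |t - δ| ^ β := by positivity
        have a2 : 0 ≤ |t + δ| ^ β := by positivity
        have a3 : 0 ≤ |t| ^ β := by positivity
        constructor <;> linarith
    _ ≤ L + L + 2 * L := by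
        rw [lintegral_add_left (by fun_prop), lintegral_add_left (by fun_prop),
          lintegral_const_mul _ (by fun_prop)]
        gcongr
    _ = 4 * L := by ring

lemma integrableOn_abs_add_rpow {β : ℝ} (hβ : -1 < β) (e c : ℝ) :
    IntegrableOn (fun t : ℝ => |t + e| ^ β) (Ioo (-c) c) := by
  have h := integrableOn_abs_rpow hβ (c + |e|)
  rw [← integrable_indicator_iff measurableSet_Ioo] at h ⊢
  refine (h.comp_add_right e).mono (AEStronglyMeasurable.indicator
    (Measurable.aestronglyMeasurable (by fun_prop)) measurableSet_Ioo) (ae_of_all _ fun t => ?_)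
  by_cases ht : t ∈ Ioo (-c) c
  · rw [indicator_of_mem ht, indicator_of_mem]
    constructor <;> linarith [ht.1, ht.2, neg_abs_le e, le_abs_self e]
  · rw [indicator_of_notMem ht]; simp

lemma integrableOn_secDiff {β : ℝ} (hβ : -1 < β) (δ c : ℝ) :
    IntegrableOn (secDiff β δ) (Ioo (-c) c) := by
  have h1 := integrableOn_abs_add_rpow hβ (-δ) c
  have h2 := integrableOn_abs_add_rpow hβ δ c
  have h3 := (integrableOn_abs_rpow hβ c).const_mul 2
  simp only [← sub_eq_add_neg] at h1
  exact (h1.add h2).sub h3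

lemma intervalIntegral_abs_rpow {β : ℝ} (hβ : -1 < β) {a b : ℝ} (ha : 0 ≤ a) (hb : 0 ≤ b) :
    ∫ t in (-a)..b, |t| ^ β = (a ^ (β + 1) + b ^ (β + 1)) / (β + 1) := by
  have hii : ∀ x y : ℝ, IntervalIntegrable (fun t : ℝ => |t| ^ β) volume x y := by
    intro x y
    rw [intervalIntegrable_iff]
    refine (integrableOn_abs_rpow hβ (|x| + |y| + 1)).mono_set fun t ht => ?_
    rw [mem_uIoc] at ht
    rcases ht with h | h <;> constructor <;>
      linarith [h.1, h.2, neg_abs_le x, neg_abs_le y, le_abs_self x, le_abs_self y,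
        abs_nonneg x, abs_nonneg y]
  have hpos : ∀ c : ℝ, 0 ≤ c → ∫ t in (0 : ℝ)..c, |t| ^ β = c ^ (β + 1) / (β + 1) := by
    intro c hc
    rw [intervalIntegral.integral_congr (g := fun t : ℝ => t ^ β), integral_rpow (Or.inl hβ),
      Real.zero_rpow (by linarith), sub_zero]
    intro t ht
    rw [uIcc_of_le hc] at ht
    simp only [abs_of_nonneg ht.1]
  rw [← intervalIntegral.integral_add_adjacent_intervals (hii (-a) 0) (hii 0 b), hpos b hb]
  have := intervalIntegral.integral_comp_neg (a := 0) (b := a) (fun t : ℝ => |t| ^ β)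
  simp only [abs_neg, neg_zero] at this
  rw [← this, hpos a ha]; ring

/-- Integration produces a second difference of the power `β + 1` at the end point `2`. This point
is far from the singularity, so the result is of order `δ²` although `secDiff` itself is not. -/
lemma exists_neg_setIntegral_secDiff_le {β : ℝ} (hβ : -1 < β) : ∃ C, 0 ≤ C ∧ ∀ δ : ℝ, 0 < δ → δ ≤ 1 →
    -(∫ t in Ioo (-2 : ℝ) 2, secDiff β δ t) ≤ C * δ ^ 2 := by
  obtain ⟨C, hC0, hC⟩ := exists_second_diff_rpow_le (β + 1)
  have hp : 0 < β + 1 := by linarith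
  refine ⟨2 * (C * 2 ^ (β + 1 - 2)) / (β + 1), by positivity, fun δ hδ hδ1 => ?_⟩
  have h1 := hC 2 δ (by norm_num) hδ.le (by linarith)
  have hii : ∀ e : ℝ, IntervalIntegrable (fun t : ℝ => |t + e| ^ β) volume (-2) 2 := fun e => by
    rw [intervalIntegrable_iff_integrableOn_Ioo_of_le (by norm_num)]
    exact integrableOn_abs_add_rpow hβ e 2
  have e0 : ∀ t, secDiff β δ t = |t + -δ| ^ β + |t + δ| ^ β - 2 * |t + 0| ^ β := fun t => by
    rw [secDiff, add_zero, sub_eq_add_neg t δ]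
  have e1 : ∫ t in Ioo (-2 : ℝ) 2, secDiff β δ t =
      2 * ((2 + δ) ^ (β + 1) + (2 - δ) ^ (β + 1) - 2 * 2 ^ (β + 1)) / (β + 1) := by
    rw [← integral_Ioc_eq_integral_Ioo, ← intervalIntegral.integral_of_le (by norm_num)]
    simp_rw [e0]
    rw [intervalIntegral.integral_sub ((hii _).add (hii _)) ((hii _).const_mul 2),
      intervalIntegral.integral_add (hii _) (hii _), intervalIntegral.integral_const_mul,
      intervalIntegral.integral_comp_add_right (fun t => |t| ^ β),
      intervalIntegral.integral_comp_add_right (fun t => |t| ^ β),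
      intervalIntegral.integral_comp_add_right (fun t => |t| ^ β),
      show -2 + -δ = -(2 + δ) by ring, show -2 + δ = -(2 - δ) by ring,
      show (-2 + 0 : ℝ) = -2 by ring,
      intervalIntegral_abs_rpow hβ (by linarith) (by linarith),
      intervalIntegral_abs_rpow hβ (by linarith) (by linarith),
      intervalIntegral_abs_rpow hβ (by linarith) (by linarith)]
    rw [show 2 + -δ = 2 - δ by ring, add_zero]
    ring
  rw [e1, ← neg_div, ← mul_neg, div_mul_eq_mul_div]
  refine div_le_div_of_nonneg_right ?_ hp.le
  have := neg_le_of_abs_le h1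
  nlinarith

end

section

/-! ### Difference quotients of fractional integrals -/

/-- The range is split at `|t| = 2δ`. Near zero, `diffSq U` is of order `δ^(2r)` and the integral of
the second difference of order `δ^(2-2r)`. Farther out, the second difference is at most a multiple
of `δ²` times the Slobodeckij weight. -/
lemma exists_lintegral_diffSq_secDiff_le {r : ℝ} (hr0 : 0 < r) (hr1 : r < 1) :
    ∃ C, 0 ≤ C ∧ ∀ U : ℝ → ℝ, Measurable U → ∀ δ : ℝ, 0 < δ →
      ∫⁻ t in Ioo (-2 : ℝ) 2, diffSq U t * ENNReal.ofReal |secDiff (1 - 2 * r) δ t| ≤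
        ENNReal.ofReal (C * δ ^ 2) * slobodeckij r univ U := by
  obtain ⟨C, hC0, hC⟩ := exists_abs_secDiff_le (1 - 2 * r)
  set L := ∫⁻ t in Ioo (-1 : ℝ) 1, ENNReal.ofReal (|t| ^ (1 - 2 * r)) with hL
  have hLfin : L ≠ ⊤ := by
    have := (integrableOn_abs_rpow (show -1 < 1 - 2 * r by linarith) 1).2
    rw [hasFiniteIntegral_iff_ofReal (ae_of_all _ fun t => by positivity)] at this
    exact this.ne
  refine ⟨16 * 2 ^ (2 * r) * 3 ^ (2 - 2 * r) * L.toReal + C, by positivity, fun U hU δ hδ => ?_⟩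
  set S := slobodeckij r univ U
  have hsub : Ioo (-2 : ℝ) 2 ⊆ Ioo (-(2 * δ)) (2 * δ) ∪ {t : ℝ | 2 * δ ≤ |t|} := by
    intro t _
    by_cases h : |t| < 2 * δ
    · exact Or.inl (abs_lt.1 h)
    · exact Or.inr (not_lt.1 h)
  have hms : MeasurableSet {t : ℝ | 2 * δ ≤ |t|} := measurableSet_le measurable_const (by fun_prop)
  have hm := measurable_diffSq hU
  have p1 : ∫⁻ t in Ioo (-(2 * δ)) (2 * δ), diffSq U t * ENNReal.ofReal |secDiff (1 - 2 * r) δ t| ≤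
      ENNReal.ofReal (16 * 2 ^ (2 * r) * 3 ^ (2 - 2 * r) * L.toReal * δ ^ 2) * S := by
    calc _ ≤ ∫⁻ t in Ioo (-(2 * δ)) (2 * δ), ENNReal.ofReal (4 * (2 * δ) ^ (2 * r)) * S *
          ENNReal.ofReal |secDiff (1 - 2 * r) δ t| := by
          refine setLIntegral_mono' measurableSet_Ioo fun t ht => ?_
          refine mul_le_mul_left ((diffSq_le hU hr0 t).trans ?_) _
          gcongr
          exact (abs_lt.2 ht).le
      _ = ENNReal.ofReal (4 * (2 * δ) ^ (2 * r)) * S *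
          ∫⁻ t in Ioo (-(2 * δ)) (2 * δ), ENNReal.ofReal |secDiff (1 - 2 * r) δ t| :=
          lintegral_const_mul _ (by fun_prop)
      _ ≤ ENNReal.ofReal (4 * (2 * δ) ^ (2 * r)) * S *
          (4 * (ENNReal.ofReal ((3 * δ) ^ (1 - 2 * r + 1)) * L)) := by
          gcongr
          exact lintegral_abs_secDiff_le hδ
      _ = _ := by
          rw [← ENNReal.ofReal_toReal hLfin, ENNReal.toReal_ofReal ENNReal.toReal_nonneg,
            ← ENNReal.ofReal_mul (by positivity), show (4 : ℝ≥0∞) = ENNReal.ofReal 4 by simp,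
            ← ENNReal.ofReal_mul (by norm_num), mul_right_comm, ← ENNReal.ofReal_mul (by positivity)]
          congr 2
          rw [Real.mul_rpow (by norm_num) hδ.le, Real.mul_rpow (by norm_num) hδ.le,
            show 1 - 2 * r + 1 = 2 - 2 * r by ring]
          have : δ ^ (2 * r) * δ ^ (2 - 2 * r) = δ ^ 2 := by
            rw [← Real.rpow_add hδ, ← Real.rpow_natCast]; congr 1; push_cast; ring
          rw [← this]; ring
  have p2 : ∫⁻ t in {t : ℝ | 2 * δ ≤ |t|}, diffSq U t * ENNReal.ofReal |secDiff (1 - 2 * r) δ t| ≤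
      ENNReal.ofReal (C * δ ^ 2) * S := by
    calc _ ≤ ∫⁻ t in {t : ℝ | 2 * δ ≤ |t|}, ENNReal.ofReal (C * δ ^ 2) *
          (diffSq U t * ENNReal.ofReal (1 / |t| ^ (1 + 2 * r))) := by
          refine setLIntegral_mono' hms fun t ht => ?_
          rw [mul_left_comm, ← ENNReal.ofReal_mul (by positivity)]
          gcongr
          refine (hC t δ hδ ht).trans (le_of_eq ?_)
          rw [one_div, ← Real.rpow_neg (abs_nonneg t)]; congr 2; ring
      _ ≤ _ := by
          refine (setLIntegral_le_lintegral _ _).trans ?_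
          rw [lintegral_const_mul' _ _ ENNReal.ofReal_ne_top, lintegral_diffSq hU]
  refine (lintegral_mono_set hsub).trans ((lintegral_union_le _ _ _).trans ((add_le_add p1 p2).trans ?_))
  rw [← add_mul, ← ENNReal.ofReal_add (by positivity) (by positivity), add_mul _ C]

/-! ### Autocorrelations and the fractional energy of a backward difference. -/

/-- A measurable square integrable function that vanishes outside the unit interval and has finite
Slobodeckij seminorm of order `r` on the line. -/
structure Profile (r : ℝ) (U : ℝ → ℝ) : Prop where
  meas : Measurable U
  supp : ∀ x, x ∉ Om → U x = 0
  memLp : MemLp U 2 volume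
  slob : slobodeckij r univ U < ⊤

/-- The autocorrelation of `U`. -/
def autoCorr (U : ℝ → ℝ) (t : ℝ) : ℝ := ∫ y, U y * U (y + t)

lemma memLp_shift {U : ℝ → ℝ} (h : MemLp U 2 volume) (t : ℝ) :
    MemLp (fun y => U (y + t)) 2 volume :=
  h.comp_measurePreserving (measurePreserving_add_right volume t)

lemma integrable_shift_mul {U : ℝ → ℝ} (h : MemLp U 2 volume) (a b : ℝ) :
    Integrable fun y => U (y + a) * U (y + b) :=
  (memLp_shift h a).integrable_mul (memLp_shift h b)

lemma integral_shift_mul (U : ℝ → ℝ) (a b : ℝ) :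
    ∫ y, U (y + a) * U (y + b) = autoCorr U (b - a) := by
  unfold autoCorr
  rw [← integral_add_right_eq_self (fun y => U y * U (y + (b - a))) a]
  congr 1; ext y; congr 2; ring

lemma diffSq_toReal {U : ℝ → ℝ} (h : MemLp U 2 volume) (t : ℝ) :
    (diffSq U t).toReal = ∫ y, (U (y + t) - U y) ^ 2 := by
  have hm : AEStronglyMeasurable (fun y => (U (y + t) - U y) ^ 2) volume :=
    ((memLp_shift h t).1.sub h.1).pow 2
  rw [integral_eq_lintegral_of_nonneg_ae (ae_of_all _ fun y => sq_nonneg _) hm, diffSq]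

/-- Expanding the square of `U(y+t) - U(y)` splits the autocorrelation into a constant and a part
that the Slobodeckij seminorm controls. -/
lemma autoCorr_eq {U : ℝ → ℝ} (h : MemLp U 2 volume) (t : ℝ) :
    autoCorr U t = (∫ y, U y ^ 2) - (diffSq U t).toReal / 2 := by
  have h2 := memLp_shift h t
  have e1 := diffSq_toReal h t
  have e2 : ∫ y, U (y + t) ^ 2 = ∫ y, U y ^ 2 := integral_add_right_eq_self (fun y => U y ^ 2) t
  have i1 : Integrable fun y => U y * U (y + t) := h.integrable_mul h2
  have e3 : ∀ y, (U (y + t) - U y) ^ 2 = U (y + t) ^ 2 + U y ^ 2 - 2 * (U y * U (y + t)) :=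
    fun y => by ring
  have i2 : Integrable fun y => U (y + t) ^ 2 + U y ^ 2 := h2.integrable_sq.add h.integrable_sq
  rw [e1]
  simp_rw [e3]
  rw [integral_sub i2 (i1.const_mul 2), integral_add h2.integrable_sq h.integrable_sq, e2,
    integral_const_mul, autoCorr]
  ring

lemma diffSq_ne_top {U : ℝ → ℝ} (h : MemLp U 2 volume) (t : ℝ) : diffSq U t ≠ ⊤ := by
  have := ((memLp_shift h t).sub h).integrable_sq.2
  rw [hasFiniteIntegral_iff_ofReal (ae_of_all _ fun y => by positivity)] at this
  exact this.ne

lemma diffSq_toReal_le {U : ℝ → ℝ} (h : MemLp U 2 volume) (t : ℝ) :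
    (diffSq U t).toReal ≤ 4 * ∫ y, U y ^ 2 := by
  have h2 := memLp_shift h t
  have e1 := diffSq_toReal h t
  have e2 : ∫ y, U (y + t) ^ 2 = ∫ y, U y ^ 2 := integral_add_right_eq_self (fun y => U y ^ 2) t
  have e3 : ∫ y, (2 * U (y + t) ^ 2 + 2 * U y ^ 2) = 4 * ∫ y, U y ^ 2 := by
    rw [integral_add (h2.integrable_sq.const_mul 2) (h.integrable_sq.const_mul 2),
      integral_const_mul, integral_const_mul, e2]; ring
  rw [e1, ← e3]
  refine integral_mono (h2.sub h).integrable_sq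
    ((h2.integrable_sq.const_mul 2).add (h.integrable_sq.const_mul 2)) fun y => ?_
  nlinarith [sq_nonneg (U (y + t) + U y)]

lemma abs_autoCorr_le {U : ℝ → ℝ} (h : MemLp U 2 volume) (t : ℝ) :
    |autoCorr U t| ≤ ∫ y, U y ^ 2 := by
  rw [autoCorr_eq h t, abs_le]
  have h1 := diffSq_toReal_le h t
  have h2 : 0 ≤ (diffSq U t).toReal := ENNReal.toReal_nonneg
  constructor <;> linarith

lemma autoCorr_eq_zero {U : ℝ → ℝ} (hs : ∀ x, x ∉ Om → U x = 0) {t : ℝ} (ht : 1 ≤ |t|) :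
    autoCorr U t = 0 := by
  refine integral_eq_zero_of_ae (ae_of_all _ fun y => ?_)
  by_cases h1 : y ∈ Om
  · have : y + t ∉ Om := by
      intro h2
      have h3 : |t| < 1 := abs_lt.2 ⟨by linarith [h1.2, h2.1], by linarith [h1.1, h2.2]⟩
      linarith
    simp [hs _ this]
  · simp [hs _ h1]

lemma measurable_autoCorr {U : ℝ → ℝ} (hU : Measurable U) : Measurable (autoCorr U) := by
  have : Measurable fun p : ℝ × ℝ => U p.2 * U (p.2 + p.1) := by fun_prop
  exact (this.stronglyMeasurable.integral_prod_right').measurable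

lemma integrable_rpow_mul_autoCorr {U : ℝ → ℝ} (hU : Measurable U) (h : MemLp U 2 volume)
    (hs : ∀ x, x ∉ Om → U x = 0) {β : ℝ} (hβ : -1 < β) (e : ℝ) :
    Integrable fun t => |t + e| ^ β * autoCorr U t := by
  have i1 := ((integrable_indicator_iff measurableSet_Ioo).2
    (integrableOn_abs_add_rpow hβ e 2)).mul_const (∫ y, U y ^ 2)
  have hm := measurable_autoCorr hU
  refine i1.mono' (Measurable.aestronglyMeasurable (by fun_prop)) (ae_of_all _ fun t => ?_)
  rw [norm_mul, Real.norm_of_nonneg (by positivity), Real.norm_eq_abs]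
  by_cases ht : t ∈ Ioo (-2 : ℝ) 2
  · rw [indicator_of_mem ht]
    gcongr
    exact abs_autoCorr_le h t
  · have : 1 ≤ |t| := by
      by_contra hc
      have := abs_lt.1 (not_le.1 hc)
      exact ht ⟨by linarith [this.1], by linarith [this.2]⟩
    rw [indicator_of_notMem ht, autoCorr_eq_zero hs this]; simp

/-- Bounding `|W p.1 * W p.2|` by the sum of the squares leaves convolutions of the integrable
function `W²` with the truncated, hence integrable, kernel. -/
lemma integrable_prod_rpow_mul {W : ℝ → ℝ} (hWm : Measurable W) (hW : MemLp W 2 volume)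
    (hs : ∀ y, y ∉ Ioo (0 : ℝ) 2 → W y = 0) {β : ℝ} (hβ : -1 < β) :
    Integrable (fun p : ℝ × ℝ => |p.1 - p.2| ^ β * (W p.1 * W p.2)) (volume.prod volume) := by
  set k : ℝ → ℝ := (Ioo (-2 : ℝ) 2).indicator fun t => |t| ^ β with hk
  have ik : Integrable k := (integrable_indicator_iff measurableSet_Ioo).2 (integrableOn_abs_rpow hβ 2)
  have i1 : Integrable (fun p : ℝ × ℝ => W p.2 ^ 2 * k (p.1 - p.2)) (volume.prod volume) :=
    hW.integrable_sq.convolution_integrand (ContinuousLinearMap.mul ℝ ℝ) ik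
  have i2 : Integrable (fun p : ℝ × ℝ => W p.1 ^ 2 * k (p.2 - p.1)) (volume.prod volume) := i1.swap
  refine (i1.add i2).mono' (Measurable.aestronglyMeasurable (by fun_prop)) (ae_of_all _ fun p => ?_)
  have kn : ∀ t, 0 ≤ k t := fun t => indicator_nonneg (fun t _ => by positivity) t
  simp only [Pi.add_apply]
  by_cases h1 : p.1 ∈ Ioo (0 : ℝ) 2
  · by_cases h2 : p.2 ∈ Ioo (0 : ℝ) 2
    · have e1 : k (p.1 - p.2) = |p.1 - p.2| ^ β :=
        indicator_of_mem (by constructor <;> linarith [h1.1, h1.2, h2.1, h2.2]) _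
      have e2 : k (p.2 - p.1) = |p.1 - p.2| ^ β := by
        rw [abs_sub_comm]
        exact indicator_of_mem (by constructor <;> linarith [h1.1, h1.2, h2.1, h2.2]) _
      rw [e1, e2, norm_mul, Real.norm_of_nonneg (by positivity), norm_mul, Real.norm_eq_abs,
        Real.norm_eq_abs, ← add_mul, mul_comm]
      gcongr
      rw [← sq_abs (W p.1), ← sq_abs (W p.2)]
      nlinarith [sq_nonneg (|W p.1| - |W p.2|), sq_nonneg (|W p.1|), sq_nonneg (|W p.2|)]
    · rw [hs _ h2]
      simp only [mul_zero, norm_zero]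
      exact add_nonneg (mul_nonneg (sq_nonneg _) (kn _)) (mul_nonneg (sq_nonneg _) (kn _))
  · rw [hs _ h1]
    simp only [mul_zero, zero_mul, norm_zero]
    exact add_nonneg (mul_nonneg (sq_nonneg _) (kn _)) (mul_nonneg (sq_nonneg _) (kn _))

lemma integral_prod_shear {W : ℝ → ℝ} {β : ℝ}
    (hi : Integrable (fun p : ℝ × ℝ => |p.1 - p.2| ^ β * (W p.1 * W p.2)) (volume.prod volume)) :
    ∫ p : ℝ × ℝ, |p.1 - p.2| ^ β * (W p.1 * W p.2) ∂(volume.prod volume) =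
      ∫ t, |t| ^ β * autoCorr W t := by
  have hmp : MeasurePreserving (MeasurableEquiv.shearAddRight ℝ) (volume.prod volume)
      (volume.prod (volume : Measure ℝ)) := measurePreserving_prod_add volume volume
  rw [← hmp.integral_comp']
  have hi' := (hmp.integrable_comp hi.1).2 hi
  have e : ∀ q : ℝ × ℝ, (MeasurableEquiv.shearAddRight ℝ) q = (q.1, q.1 + q.2) := fun q => rfl
  simp only [Function.comp_def, e, sub_add_cancel_left, abs_neg] at hi' ⊢
  rw [integral_prod_symm _ hi']
  congr 1; ext t
  simp only
  rw [integral_const_mul, autoCorr]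

variable {s : ℝ} {U : ℝ → ℝ}

/-- The backward difference of `U`. -/
def backDiff (U : ℝ → ℝ) (δ y : ℝ) : ℝ := U y - U (y - δ)

lemma measurable_backDiff (hU : Measurable U) (δ : ℝ) : Measurable (backDiff U δ) := by
  unfold backDiff; fun_prop

lemma memLp_backDiff (h : MemLp U 2 volume) (δ : ℝ) : MemLp (backDiff U δ) 2 volume := by
  have := memLp_shift h (-δ)
  exact h.sub this

lemma autoCorr_backDiff (h : MemLp U 2 volume) (δ t : ℝ) :
    autoCorr (backDiff U δ) t = 2 * autoCorr U t - autoCorr U (t + δ) - autoCorr U (t - δ) := by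
  have e : ∀ y, backDiff U δ y * backDiff U δ (y + t) =
      U (y + 0) * U (y + t) - U (y + 0) * U (y + (t - δ)) - U (y + -δ) * U (y + t)
        + U (y + -δ) * U (y + (t - δ)) := fun y => by
    unfold backDiff
    rw [add_zero, ← sub_eq_add_neg, ← add_sub_assoc]; ring
  have i := integrable_shift_mul h
  have j1 : Integrable fun y => U (y + 0) * U (y + t) - U (y + 0) * U (y + (t - δ)) :=
    (i 0 t).sub (i 0 (t - δ))
  have j2 : Integrable fun y => U (y + 0) * U (y + t) - U (y + 0) * U (y + (t - δ)) -
      U (y + -δ) * U (y + t) := j1.sub (i (-δ) t)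
  rw [autoCorr]
  simp_rw [e]
  rw [integral_add j2 (i _ _), integral_sub j1 (i _ _), integral_sub (i _ _) (i _ _)]
  simp only [integral_shift_mul]
  rw [show t - -δ = t + δ by ring, show t - δ - -δ = t by ring, sub_zero, sub_zero]
  ring

/-- Discrete integration by parts: the autocorrelation of a difference is minus a second difference
of the autocorrelation, and translation invariance moves it onto the power kernel. -/
lemma integral_rpow_autoCorr_backDiff (hP : Profile (s / 2) U) (hs1 : 1 < s) (hs2 : s < 2) (δ : ℝ) :
    ∫ t, |t| ^ (1 - s) * autoCorr (backDiff U δ) t =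
      -∫ t in Ioo (-2 : ℝ) 2, secDiff (1 - s) δ t * autoCorr U t := by
  have i := integrable_rpow_mul_autoCorr hP.meas hP.memLp hP.supp (show -1 < 1 - s by linarith)
  have i0 : Integrable fun t => |t| ^ (1 - s) * autoCorr U t := by simpa using i 0
  have ip : Integrable fun t => |t| ^ (1 - s) * autoCorr U (t + δ) := by
    have := (i (-δ)).comp_add_right δ
    simpa using this
  have im : Integrable fun t => |t| ^ (1 - s) * autoCorr U (t - δ) := by
    have := (i δ).comp_add_right (-δ)
    simpa [← sub_eq_add_neg] using this
  have ep : ∫ t, |t| ^ (1 - s) * autoCorr U (t + δ) = ∫ t, |t + -δ| ^ (1 - s) * autoCorr U t := by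
    rw [← integral_add_right_eq_self (fun t => |t + -δ| ^ (1 - s) * autoCorr U t) δ]
    simp
  have em : ∫ t, |t| ^ (1 - s) * autoCorr U (t - δ) = ∫ t, |t + δ| ^ (1 - s) * autoCorr U t := by
    rw [← integral_add_right_eq_self (fun t => |t + δ| ^ (1 - s) * autoCorr U t) (-δ)]
    simp [← sub_eq_add_neg]
  have hset : ∫ t in Ioo (-2 : ℝ) 2, secDiff (1 - s) δ t * autoCorr U t =
      ∫ t, secDiff (1 - s) δ t * autoCorr U t := by
    refine setIntegral_eq_integral_of_forall_compl_eq_zero fun t ht => ?_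
    rw [autoCorr_eq_zero hP.supp, mul_zero]
    by_contra hc
    have := abs_lt.1 (not_le.1 hc)
    exact ht ⟨by linarith [this.1], by linarith [this.2]⟩
  have e1 : ∀ t, |t| ^ (1 - s) * autoCorr (backDiff U δ) t = 2 * (|t| ^ (1 - s) * autoCorr U t) -
      |t| ^ (1 - s) * autoCorr U (t + δ) - |t| ^ (1 - s) * autoCorr U (t - δ) := fun t => by
    rw [autoCorr_backDiff hP.memLp]; ring
  have e2 : ∀ t, secDiff (1 - s) δ t * autoCorr U t = |t + -δ| ^ (1 - s) * autoCorr U t +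
      |t + δ| ^ (1 - s) * autoCorr U t - 2 * (|t| ^ (1 - s) * autoCorr U t) := fun t => by
    rw [secDiff, sub_eq_add_neg t δ]; ring
  have j1 : Integrable fun t => 2 * (|t| ^ (1 - s) * autoCorr U t) -
      |t| ^ (1 - s) * autoCorr U (t + δ) := (i0.const_mul 2).sub ip
  have j2 : Integrable fun t => |t + -δ| ^ (1 - s) * autoCorr U t + |t + δ| ^ (1 - s) * autoCorr U t :=
    (i (-δ)).add (i δ)
  rw [hset]
  simp_rw [e1, e2]
  rw [integral_sub j1 im, integral_sub (i0.const_mul 2) ip, integral_sub j2 (i0.const_mul 2),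
    integral_add (i (-δ)) (i δ), ep, em]
  ring

/-- The difference quotients of the fractional integral are bounded in `L²`. -/
theorem exists_integral_sq_fracInt_backDiff_le (hP : Profile (s / 2) U) (hs1 : 1 < s) (hs2 : s < 2) :
    ∃ K, 0 ≤ K ∧ ∀ δ : ℝ, 0 < δ → δ ≤ 1 →
      Integrable (fun x => fracInt (1 - s / 2) (backDiff U δ) x ^ 2) ∧
      ∫ x, fracInt (1 - s / 2) (backDiff U δ) x ^ 2 ≤ K * δ ^ 2 := by
  have hβ : -1 < 1 - s := by linarith
  obtain ⟨C1, hC1, h1⟩ := exists_lintegral_diffSq_secDiff_le (show 0 < s / 2 by linarith)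
    (by linarith)
  obtain ⟨C2, hC2, h2⟩ := exists_neg_setIntegral_secDiff_le hβ
  have hA := autoConst_pos (show 1 / 2 < s / 2 by linarith) (by linarith)
  set R0 := ∫ y, U y ^ 2 with hR0
  have hR0n : 0 ≤ R0 := integral_nonneg fun _ => sq_nonneg _
  set S := slobodeckij (s / 2) univ U with hS
  refine ⟨autoConst (s / 2) * (R0 * C2 + C1 * S.toReal), by positivity, fun δ hδ hδ1 => ?_⟩
  have hWs : ∀ y, y ∉ Ioo (0 : ℝ) 2 → backDiff U δ y = 0 := by
    intro y hy
    have a1 : U y = 0 := hP.supp y fun hc => hy ⟨hc.1, by linarith [hc.2]⟩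
    have a2 : U (y - δ) = 0 := hP.supp _ fun hc => hy ⟨by linarith [hc.1], by linarith [hc.2]⟩
    rw [backDiff, a1, a2, sub_zero]
  have e0 : 1 - 2 * (s / 2) = 1 - s := by ring
  have hi := integrable_prod_rpow_mul (measurable_backDiff hP.meas δ) (memLp_backDiff hP.memLp δ)
    hWs hβ
  obtain ⟨hI, hE⟩ := integral_sq_fracInt (α := s / 2) (by linarith) (by linarith)
    (measurable_backDiff hP.meas δ).aestronglyMeasurable (by rw [e0]; exact hi)
  refine ⟨hI, ?_⟩
  rw [e0, integral_prod_shear hi, integral_rpow_autoCorr_backDiff hP hs1 hs2] at hE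
  rw [hE, mul_assoc]
  refine mul_le_mul_of_nonneg_left ?_ hA.le
  have iM := integrableOn_secDiff hβ δ 2
  have hF := h1 U hP.meas δ hδ
  rw [e0] at hF
  have iF : IntegrableOn (fun t => secDiff (1 - s) δ t * (diffSq U t).toReal) (Ioo (-2) 2) := by
    refine (iM.abs.mul_const (4 * R0)).mono' ?_ (ae_of_all _ fun t => ?_)
    · have := measurable_diffSq hP.meas
      exact Measurable.aestronglyMeasurable (by fun_prop)
    · rw [norm_mul, Real.norm_eq_abs, Real.norm_of_nonneg ENNReal.toReal_nonneg]
      gcongr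
      exact diffSq_toReal_le hP.memLp t
  have hFr : ∫ t in Ioo (-2 : ℝ) 2, secDiff (1 - s) δ t * (diffSq U t).toReal ≤
      C1 * δ ^ 2 * S.toReal := by
    calc _ ≤ ∫ t in Ioo (-2 : ℝ) 2, ‖secDiff (1 - s) δ t * (diffSq U t).toReal‖ :=
          (Real.le_norm_self _).trans (norm_integral_le_integral_norm _)
      _ = (∫⁻ t in Ioo (-2 : ℝ) 2, diffSq U t * ENNReal.ofReal |secDiff (1 - s) δ t|).toReal := by
          rw [integral_eq_lintegral_of_nonneg_ae (ae_of_all _ fun _ => norm_nonneg _) iF.norm.1]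
          congr 2; ext t
          rw [norm_mul, Real.norm_eq_abs, Real.norm_of_nonneg ENNReal.toReal_nonneg,
            ENNReal.ofReal_mul (abs_nonneg _), ENNReal.ofReal_toReal (diffSq_ne_top hP.memLp t),
            mul_comm]
      _ ≤ (ENNReal.ofReal (C1 * δ ^ 2) * S).toReal :=
          ENNReal.toReal_mono (ENNReal.mul_ne_top ENNReal.ofReal_ne_top hP.slob.ne) hF
      _ = _ := by rw [ENNReal.toReal_mul, ENNReal.toReal_ofReal (by positivity)]
  -- The constant part of the autocorrelation meets only the integral of the second difference, and
  -- the remainder is weighted by `diffSq U`; each is of order `δ²`.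
  have e2 : ∫ t in Ioo (-2 : ℝ) 2, secDiff (1 - s) δ t * autoCorr U t =
      (∫ t in Ioo (-2 : ℝ) 2, secDiff (1 - s) δ t) * R0 -
        (∫ t in Ioo (-2 : ℝ) 2, secDiff (1 - s) δ t * (diffSq U t).toReal) * (1 / 2) := by
    rw [← integral_mul_const, ← integral_mul_const, ← integral_sub (iM.mul_const _) (iF.mul_const _)]
    congr 1; ext t
    rw [autoCorr_eq hP.memLp]; ring
  rw [e2]
  have h3 := mul_le_mul_of_nonneg_left (h2 δ hδ hδ1) hR0n
  have h4 : 0 ≤ C1 * δ ^ 2 * S.toReal := by positivity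
  linarith

end

section

/-! ### Existence of half-order derivatives -/

/-- Banach–Alaoglu along the hyperfilter. No subsequence is needed: the ultrafilter limit of a
pairing equals its sequential limit whenever the latter exists. -/
lemma exists_weak_limit {H : Type*} [NormedAddCommGroup H] [InnerProductSpace ℝ H] [CompleteSpace H]
    (d : ℕ → H) {C : ℝ} (hd : ∀ n, ‖d n‖ ≤ C) :
    ∃ e : H, ∀ x l, Tendsto (fun n => inner ℝ (d n) x) atTop (nhds l) → inner ℝ e x = l := by
  let F : ℕ → WeakDual ℝ H := fun n =>
    StrongDual.toWeakDual (InnerProductSpace.toDual ℝ H (d n))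
  have hK := WeakDual.isCompact_closedBall (𝕜 := ℝ) (E := H) 0 C
  rw [isCompact_iff_ultrafilter_le_nhds] at hK
  obtain ⟨L, -, hL⟩ := hK ((hyperfilter ℕ).map F) (by
    rw [le_principal_iff]
    show F ⁻¹' _ ∈ (hyperfilter ℕ : Filter ℕ)
    refine univ_mem' fun n => ?_
    simpa [F] using hd n)
  refine ⟨(InnerProductSpace.toDual ℝ H).symm (WeakDual.toStrongDual L), fun x l hl => ?_⟩
  have h1 : Tendsto (fun n => F n x) (hyperfilter ℕ : Filter ℕ) (nhds (L x)) :=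
    ((WeakDual.eval_continuous x).tendsto L).comp hL
  have h2 : Tendsto (fun n => F n x) (hyperfilter ℕ : Filter ℕ) (nhds l) := by
    refine Tendsto.mono_left ?_ Nat.hyperfilter_le_atTop
    simpa [F] using hl
  rw [InnerProductSpace.toDual_symm_apply]
  exact tendsto_nhds_unique h1 h2

lemma inner_toLp {X : Type*} [MeasurableSpace X] {μ : Measure X} {f g : X → ℝ} (hf : MemLp f 2 μ)
    (hg : MemLp g 2 μ) : inner ℝ (hf.toLp f) (hg.toLp g) = ∫ x, f x * g x ∂μ := by
  rw [L2.inner_def]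
  refine integral_congr_ae ?_
  filter_upwards [hf.coeFn_toLp, hg.coeFn_toLp] with x h1 h2
  rw [h1, h2]
  simp [mul_comm]

lemma norm_toLp_sq {X : Type*} [MeasurableSpace X] {μ : Measure X} {f : X → ℝ} (hf : MemLp f 2 μ) :
    ‖hf.toLp f‖ ^ 2 = ∫ x, f x ^ 2 ∂μ := by
  rw [← real_inner_self_eq_norm_sq, inner_toLp]
  simp only [sq]

/-- For orders below one the convolution integral need not converge everywhere. Almost every `x < n`
is covered by Fubini applied to the iterated integral of order `1 + σ` at `n`, and `n` is arbitrary.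
-/
lemma ae_integrable_rk_mul {σ : ℝ} (hσ : 0 < σ) {W : ℝ → ℝ} (hW : Integrable W)
    (hs : ∀ z < 0, W z = 0) : ∀ᵐ x, Integrable fun y => rk σ (x - y) * W y := by
  have h : ∀ n : ℕ, ∀ᵐ x, x < (n : ℝ) → Integrable fun y => rk σ (x - y) * W y := by
    intro n
    have := (integrable_prod_rk one_pos hσ hW.1 (x := n)
      (integrable_rk_mul_of_one_le (by linarith) hW hs n)).prod_right_ae
    filter_upwards [this] with x hx hxn
    simpa only [rk_one_of_pos (sub_pos.2 hxn), one_mul] using hx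
  filter_upwards [ae_all_iff.2 h] with x hx
  obtain ⟨n, hn⟩ := exists_nat_gt x
  exact hx n hn

variable {s : ℝ} {U : ℝ → ℝ}

lemma Profile.integrable {r : ℝ} (hP : Profile r U) : Integrable U := by
  have h : IntegrableOn U Om := MemLp.integrableOn_Om (hP.memLp.restrict Om)
  refine (integrableOn_iff_integrable_of_support_subset fun x hx => ?_).1 h
  by_contra hc
  exact hx (hP.supp x hc)

lemma Profile.integrableOn_fracInt {r σ : ℝ} (hP : Profile r U) (hσ : 0 < σ) (b : ℝ) :
    IntegrableOn (fracInt σ U) (Iio b) :=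
  FracBVP.integrableOn_fracInt hσ hP.integrable
    (fun z hz => hP.supp z fun hc => by linarith [hc.1]) b

lemma Profile.fracInt_backDiff {r σ : ℝ} (hP : Profile r U) (hσ : 0 < σ) (δ : ℝ) :
    ∀ᵐ x, fracInt σ (backDiff U δ) x = fracInt σ U x - fracInt σ U (x - δ) := by
  have h1 := ae_integrable_rk_mul hσ hP.integrable
    (fun z hz => hP.supp z fun hc => by linarith [hc.1])
  have h2 : ∀ᵐ x : ℝ, Integrable fun y => rk σ (x - δ - y) * U y :=
    (measurePreserving_sub_right volume δ).quasiMeasurePreserving.ae h1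
  filter_upwards [h1, h2] with x hx1 hx2
  have hx3 : Integrable fun y => rk σ (x - y) * U (y - δ) := by
    refine (hx2.comp_sub_right δ).congr (ae_of_all _ fun y => ?_)
    simp only
    congr 2; ring
  have e : fracInt σ U (x - δ) = ∫ y, rk σ (x - y) * U (y - δ) := by
    rw [fracInt, ← integral_sub_right_eq_self (fun y => rk σ (x - δ - y) * U y) δ]
    congr 1; ext y; congr 2; ring
  rw [e]
  unfold fracInt backDiff
  rw [← integral_sub hx1 hx3]
  simp_rw [mul_sub]

/-- Fractional integration commutes with translation, so the difference passes to the test function.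
The half-line `Iio 1` holds the supports of `φ` and of `φ(· + δ)`, the latter possibly reaching left
of `0`. -/
lemma Profile.integral_fracInt_backDiff_mul {r σ : ℝ} (hP : Profile r U) (hσ : 0 < σ) {δ : ℝ}
    (hδ : 0 < δ) {φ : ℝ → ℝ} (hφ : IsTest φ) :
    ∫ x in Om, fracInt σ (backDiff U δ) x * φ x =
      ∫ x in Iio 1, fracInt σ U x * (φ x - φ (x + δ)) := by
  have hV := hP.integrableOn_fracInt hσ 1
  obtain ⟨C, hC⟩ := hφ.exists_bound
  have hφ1 : ∀ x, ¬ x < 1 → φ x = 0 := fun x hx => hφ.eq_zero fun hc => hx hc.2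
  have i1 : IntegrableOn (fun x => fracInt σ U x * φ x) (Iio 1) := hφ.integrable_mul hV
  have i2 : IntegrableOn (fun x => fracInt σ U x * φ (x + δ)) (Iio 1) :=
    hV.mul_bdd (Continuous.aestronglyMeasurable (by have := hφ.continuous; fun_prop))
      (ae_of_all _ fun x => hC (x + δ))
  have s1 : ∀ x, x ∉ Iio (1 : ℝ) → fracInt σ U x * φ x = 0 := fun x hx => by
    rw [hφ1 x hx, mul_zero]
  have s2 : ∀ x, x ∉ Iio (1 : ℝ) → fracInt σ U x * φ (x + δ) = 0 := fun x hx => by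
    rw [hφ1 (x + δ) fun hc => hx (show x < 1 by linarith), mul_zero]
  have j1 : Integrable fun x => fracInt σ U x * φ x :=
    (integrableOn_iff_integrable_of_support_subset fun x hx => by_contra fun hc => hx (s1 x hc)).1 i1
  have j2 : Integrable fun x => fracInt σ U x * φ (x + δ) :=
    (integrableOn_iff_integrable_of_support_subset fun x hx => by_contra fun hc => hx (s2 x hc)).1 i2
  have j3 : Integrable fun x => fracInt σ U (x - δ) * φ x := by
    simpa using j2.comp_sub_right δ
  have e3 : ∫ x, fracInt σ U (x - δ) * φ x = ∫ x, fracInt σ U x * φ (x + δ) := by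
    rw [← integral_sub_right_eq_self (fun x => fracInt σ U x * φ (x + δ)) δ]
    simp
  rw [hφ.setIntegral_mul]
  have e4 : ∫ x, fracInt σ (backDiff U δ) x * φ x =
      ∫ x, (fracInt σ U x * φ x - fracInt σ U (x - δ) * φ x) := by
    refine integral_congr_ae ?_
    filter_upwards [hP.fracInt_backDiff hσ δ] with x hx
    rw [hx, sub_mul]
  rw [e4, integral_sub j1 j3, e3, ← setIntegral_eq_integral_of_forall_compl_eq_zero s1,
    ← setIntegral_eq_integral_of_forall_compl_eq_zero s2, ← integral_sub i1 i2]
  simp_rw [mul_sub]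

lemma Profile.tendsto_diffQuot {r σ : ℝ} (hP : Profile r U) (hσ : 0 < σ) {φ : ℝ → ℝ}
    (hφ : IsTest φ) :
    Tendsto (fun n : ℕ => ∫ x in Om, (((n : ℝ) + 1) *
      fracInt σ (backDiff U (1 / ((n : ℝ) + 1))) x) * φ x) atTop
      (nhds (-∫ x in Om, fracInt σ U x * deriv φ x)) := by
  have hV := hP.integrableOn_fracInt hσ 1
  obtain ⟨K, hK⟩ := hφ.smooth.lipschitzWith_of_hasCompactSupport hφ.compact (by simp)
  have hlim : -∫ x in Om, fracInt σ U x * deriv φ x = ∫ x in Iio 1, fracInt σ U x * (-deriv φ x) := by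
    rw [hφ.deriv.setIntegral_mul, ← integral_neg,
      ← setIntegral_eq_integral_of_forall_compl_eq_zero (s := Iio (1 : ℝ))]
    · simp only [mul_neg]
    · intro x hx
      rw [hφ.deriv.eq_zero fun hc => hx hc.2]; simp
  rw [hlim]
  have hn : ∀ n : ℕ, 0 < 1 / ((n : ℝ) + 1) := fun n => by positivity
  have heq : ∀ n : ℕ, ∫ x in Om, (((n : ℝ) + 1) * fracInt σ (backDiff U (1 / ((n : ℝ) + 1))) x) * φ x =
      ∫ x in Iio 1, fracInt σ U x * (((n : ℝ) + 1) * (φ x - φ (x + 1 / ((n : ℝ) + 1)))) := by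
    intro n
    simp_rw [mul_assoc]
    rw [integral_const_mul, hP.integral_fracInt_backDiff_mul hσ (hn n) hφ, ← integral_const_mul]
    congr 1; ext x; ring
  simp_rw [heq]
  refine tendsto_integral_of_dominated_convergence (fun x => ‖fracInt σ U x‖ * K) (fun n => ?_)
    (hV.norm.mul_const _) (fun n => ae_of_all _ fun x => ?_) (ae_of_all _ fun x => ?_)
  · refine hV.1.mul (Continuous.aestronglyMeasurable ?_)
    have := hφ.continuous
    fun_prop
  · rw [norm_mul]
    gcongr
    have := hK.dist_le_mul x (x + 1 / ((n : ℝ) + 1))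
    rw [Real.dist_eq, Real.dist_eq, sub_add_cancel_left, abs_neg, abs_of_pos (hn n)] at this
    rw [norm_mul, Real.norm_of_nonneg (by positivity), Real.norm_eq_abs]
    calc _ ≤ ((n : ℝ) + 1) * (K * (1 / ((n : ℝ) + 1))) := by gcongr
      _ = K := by field_simp
  · refine Tendsto.const_mul _ ?_
    have hd : HasDerivAt φ (deriv φ x) x := ((hφ.smooth.differentiable (by simp)) x).hasDerivAt
    have h1 := hd.tendsto_slope_zero_right
    have h2 : Tendsto (fun n : ℕ => 1 / ((n : ℝ) + 1)) atTop (nhdsWithin 0 (Ioi 0)) :=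
      tendsto_nhdsWithin_iff.2 ⟨tendsto_one_div_add_atTop_nhds_zero_nat,
        Eventually.of_forall fun n => hn n⟩
    refine ((h1.comp h2).neg).congr fun n => ?_
    simp only [Function.comp_apply, smul_eq_mul, one_div, inv_inv]
    ring

/-- Functions in `H̃^{s/2}` have a square integrable left derivative of order `s/2`. -/
theorem exists_hasLeftRLDeriv {u : ℝ → ℝ} (hs1 : 1 < s) (hs2 : s < 2) (hu : MemHTilde (s / 2) u) :
    ∃ d, HasLeftRLDeriv (s / 2) u d := by
  rw [memHTilde_half_iff hs1 hs2] at hu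
  obtain ⟨hL, hS⟩ := hu
  -- Replacing `u` by a measurable representative changes neither the seminorm nor the fractional
  -- integral.
  set v := hL.1.mk u with hv
  have huv : u =ᵐ[muOm] v := hL.1.ae_eq_mk
  have hind : Om.indicator u =ᵐ[volume] Om.indicator v := by
    filter_upwards [(ae_restrict_iff' measurableSet_Ioo).1 huv] with x hx
    by_cases h : x ∈ Om
    · rw [indicator_of_mem h, indicator_of_mem h, hx h]
    · rw [indicator_of_notMem h, indicator_of_notMem h]
  set U := Om.indicator v with hU
  have hP : Profile (s / 2) U := by
    refine ⟨hL.1.stronglyMeasurable_mk.measurable.indicator measurableSet_Ioo,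
      fun x hx => indicator_of_notMem hx _,
      (memLp_indicator_iff_restrict measurableSet_Ioo).2 (hL.ae_eq huv), ?_⟩
    rwa [← slobodeckij_congr (u := Om.indicator u) (by simpa using hind)]
  have hσ : 0 < 1 - s / 2 := by linarith
  obtain ⟨K, hK0, hK⟩ := exists_integral_sq_fracInt_backDiff_le hP hs1 hs2
  set D : ℕ → ℝ → ℝ := fun n x =>
    ((n : ℝ) + 1) * fracInt (1 - s / 2) (backDiff U (1 / ((n : ℝ) + 1))) x with hD
  have hδ : ∀ n : ℕ, 0 < 1 / ((n : ℝ) + 1) ∧ 1 / ((n : ℝ) + 1) ≤ 1 := fun n =>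
    ⟨by positivity, by rw [div_le_one (by positivity)]; linarith [Nat.cast_nonneg (α := ℝ) n]⟩
  have hmeas : ∀ δ, StronglyMeasurable (fracInt (1 - s / 2) (backDiff U δ)) := by
    intro δ
    have hm := measurable_backDiff hP.meas δ
    have : Measurable fun p : ℝ × ℝ => rk (1 - s / 2) (p.1 - p.2) * backDiff U δ p.2 := by fun_prop
    exact this.stronglyMeasurable.integral_prod_right'
  have hDL : ∀ n, MemLp (D n) 2 muOm := fun n => by
    refine MemLp.const_mul ?_ _
    rw [memLp_two_iff_integrable_sq (hmeas _).aestronglyMeasurable]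
    exact (hK _ (hδ n).1 (hδ n).2).1.restrict
  have hDn : ∀ n, ‖(hDL n).toLp (D n)‖ ≤ Real.sqrt K := fun n => by
    refine Real.le_sqrt_of_sq_le ?_
    rw [norm_toLp_sq]
    simp only [hD, mul_pow]
    rw [integral_const_mul]
    obtain ⟨k1, k2⟩ := hK _ (hδ n).1 (hδ n).2
    have k3 := setIntegral_le_integral (s := Om) k1 (ae_of_all _ fun _ => sq_nonneg _)
    calc _ ≤ ((n : ℝ) + 1) ^ 2 * (K * (1 / ((n : ℝ) + 1)) ^ 2) := by
          gcongr
          exact k3.trans k2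
      _ = K := by field_simp
  obtain ⟨e, he⟩ := exists_weak_limit _ hDn
  have heL : MemLp e 2 muOm := Lp.memLp e
  have hVi : IntegrableOn (fracInt (1 - s / 2) U) Om :=
    (hP.integrableOn_fracInt hσ 1).mono_set fun x hx => hx.2
  have hleft : leftInt (1 - s / 2) u =ᵐ[muOm] fracInt (1 - s / 2) U := by
    filter_upwards [ae_restrict_mem measurableSet_Ioo] with x hx
    rw [leftInt_eq_fracInt _ _ ⟨hx.1.le, hx.2.le⟩]
    exact fracInt_congr (hind.mono fun y hy _ => hy)
  refine ⟨e, heL, ?_⟩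
  rw [floor_half hs2]
  simp only [zero_add, Nat.cast_one]
  refine HasWeakDeriv.congr_ae ?_ hleft.symm EventuallyEq.rfl
  rw [hasWeakDeriv_iff]
  refine ⟨hVi.locallyIntegrableOn, MemLp.locallyIntegrableOn heL, fun φ hφ => ?_⟩
  have hφL : MemLp φ 2 muOm :=
    (hφ.continuous.memLp_of_hasCompactSupport hφ.compact).restrict _
  have h1 := he (hφL.toLp φ) (-∫ x in Om, fracInt (1 - s / 2) U x * deriv φ x) (by
    simp_rw [inner_toLp]
    exact hP.tendsto_diffQuot hσ hφ)
  rw [← Lp.toLp_coeFn e heL, inner_toLp] at h1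
  rw [iteratedDeriv_one, h1]
  ring

end

section

/-! ### Reflection -/

lemma measurePreserving_reflect : MeasurePreserving (fun x : ℝ => 1 - x) muOm muOm := by
  have h := (Measure.measurePreserving_sub_left (volume : Measure ℝ) 1).restrict_preimage
    (measurableSet_Ioo (a := (0 : ℝ)) (b := 1))
  have e : (fun x : ℝ => 1 - x) ⁻¹' Om = Om := by
    ext x; simp only [mem_preimage, mem_Ioo]
    constructor <;> rintro ⟨h1, h2⟩ <;> constructor <;> linarith
  rwa [e] at h

lemma setIntegral_reflect (F : ℝ → ℝ) : ∫ x in Om, F (1 - x) = ∫ x in Om, F x :=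
  measurePreserving_reflect.integral_comp
    (MeasurableEquiv.subLeft (1 : ℝ)).measurableEmbedding F

lemma MemLp.reflect {w : ℝ → ℝ} (hw : MemLp w 2 muOm) : MemLp (fun x => w (1 - x)) 2 muOm :=
  hw.comp_measurePreserving measurePreserving_reflect

lemma IntegrableOn.reflect {w : ℝ → ℝ} (hw : IntegrableOn w Om) :
    IntegrableOn (fun x => w (1 - x)) Om :=
  (measurePreserving_reflect.integrable_comp hw.1).2 hw

lemma ae_reflect {p : ℝ → Prop} (h : ∀ᵐ x ∂muOm, p x) : ∀ᵐ x ∂muOm, p (1 - x) :=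
  measurePreserving_reflect.quasiMeasurePreserving.ae h

lemma indicator_reflect (u : ℝ → ℝ) (x : ℝ) :
    Om.indicator (fun y => u (1 - y)) x = Om.indicator u (1 - x) := by
  by_cases h : x ∈ Om
  · rw [indicator_of_mem h, indicator_of_mem (show 1 - x ∈ Om from ⟨by linarith [h.2], by linarith [h.1]⟩)]
  · rw [indicator_of_notMem h, indicator_of_notMem]
    exact fun hc => h ⟨by linarith [hc.2], by linarith [hc.1]⟩

lemma slobodeckij_reflect (r : ℝ) (u : ℝ → ℝ) :
    slobodeckij r univ (Om.indicator fun x => u (1 - x)) = slobodeckij r univ (Om.indicator u) := by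
  unfold slobodeckij
  simp only [Measure.restrict_univ, indicator_reflect]
  rw [← lintegral_sub_left_eq_self _ (1 : ℝ)]
  refine lintegral_congr fun x => ?_
  rw [← lintegral_sub_left_eq_self _ (1 : ℝ)]
  refine lintegral_congr fun y => ?_
  rw [sub_sub_cancel, sub_sub_cancel, abs_sub_comm x y]
  congr 4; ring

lemma IsTest.reflect {φ : ℝ → ℝ} (h : IsTest φ) : IsTest fun x => φ (1 - x) := by
  have hc := h.compact.comp_homeomorph (Homeomorph.subLeft (1 : ℝ))
  refine ⟨h.smooth.comp (contDiff_const.sub contDiff_id), hc, ?_⟩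
  have h1 : tsupport (fun x => φ (1 - x)) ⊆ (fun x : ℝ => 1 - x) ⁻¹' tsupport φ :=
    tsupport_comp_subset_preimage φ (by fun_prop)
  intro x hx
  have := h.supp (h1 hx)
  exact ⟨by linarith [this.2], by linarith [this.1]⟩

lemma HasWeakDeriv.reflect {v w : ℝ → ℝ} (h : HasWeakDeriv 1 Om v w) (hv : IntegrableOn v Om)
    (hw : IntegrableOn w Om) :
    HasWeakDeriv 1 Om (fun x => v (1 - x)) (fun x => -w (1 - x)) := by
  rw [hasWeakDeriv_iff] at h ⊢
  refine ⟨(IntegrableOn.reflect hv).locallyIntegrableOn, (IntegrableOn.reflect hw).neg.locallyIntegrableOn, fun φ hφ => ?_⟩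
  have h1 := h.2.2 _ hφ.reflect
  rw [← setIntegral_reflect, ← setIntegral_reflect (fun x => w x * _)] at h1
  simp only [iteratedDeriv_one, deriv_comp_const_sub, sub_sub_cancel, mul_neg, integral_neg,
    neg_mul, pow_one, one_mul, neg_neg] at h1 ⊢
  linarith

lemma rightInt_reflect (σ : ℝ) (u : ℝ → ℝ) (x : ℝ) :
    rightInt σ (fun y => u (1 - y)) x = leftInt σ u (1 - x) := by
  unfold rightInt leftInt
  congr 1
  have := intervalIntegral.integral_comp_sub_left (a := x) (b := 1)
    (fun y => (1 - x - y) ^ (σ - 1) * u y) 1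
  rw [sub_self] at this
  rw [← this]
  congr 1; ext y; congr 2; ring

variable {s : ℝ} {u v h : ℝ → ℝ}

lemma MemHTilde.reflect (hs1 : 1 < s) (hs2 : s < 2) (hu : MemHTilde (s / 2) u) :
    MemHTilde (s / 2) fun x => u (1 - x) := by
  rw [memHTilde_half_iff hs1 hs2] at hu ⊢
  exact ⟨MemLp.reflect hu.1, by rw [slobodeckij_reflect]; exact hu.2⟩

lemma integrableOn_leftInt {σ : ℝ} (hσ : 0 < σ) (hu : IntegrableOn u Om) :
    IntegrableOn (leftInt σ u) Om :=
  (integrableOn_fracInt_Om hσ hu).congr_fun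
    (fun _ hx => (leftInt_eq_fracInt σ u ⟨hx.1.le, hx.2.le⟩).symm) measurableSet_Ioo

lemma hasLeftRLDeriv_half_iff (hs2 : s < 2) {d : ℝ → ℝ} : HasLeftRLDeriv (s / 2) u d ↔
    MemLp d 2 muOm ∧ HasWeakDeriv 1 Om (leftInt (1 - s / 2) u) d := by
  simp [HasLeftRLDeriv, floor_half hs2]

lemma hasRightRLDeriv_half_iff (hs2 : s < 2) {d : ℝ → ℝ} : HasRightRLDeriv (s / 2) u d ↔
    MemLp d 2 muOm ∧ HasWeakDeriv 1 Om (rightInt (1 - s / 2) u) (fun x => -d x) := by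
  simp [HasRightRLDeriv, floor_half hs2]

lemma HasLeftRLDeriv.reflect (hs2 : s < 2) {d : ℝ → ℝ} (hu : IntegrableOn u Om)
    (h : HasLeftRLDeriv (s / 2) u d) :
    HasRightRLDeriv (s / 2) (fun x => u (1 - x)) (fun x => d (1 - x)) := by
  rw [hasLeftRLDeriv_half_iff hs2] at h
  rw [hasRightRLDeriv_half_iff hs2, funext (rightInt_reflect _ u)]
  exact ⟨MemLp.reflect h.1, h.2.reflect (integrableOn_leftInt (by linarith) hu)
    (MemLp.integrableOn_Om h.1)⟩

lemma HasLeftRLDeriv.ae_unique (hs2 : s < 2) {d e : ℝ → ℝ} (hd : HasLeftRLDeriv (s / 2) u d)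
    (he : HasLeftRLDeriv (s / 2) u e) : d =ᵐ[muOm] e := by
  rw [hasLeftRLDeriv_half_iff hs2] at hd he
  exact hd.2.ae_unique he.2 (MemLp.integrableOn_Om hd.1) (MemLp.integrableOn_Om he.1)

lemma HasRightRLDeriv.ae_unique (hs2 : s < 2) {d e : ℝ → ℝ} (hd : HasRightRLDeriv (s / 2) u d)
    (he : HasRightRLDeriv (s / 2) u e) : d =ᵐ[muOm] e := by
  rw [hasRightRLDeriv_half_iff hs2] at hd he
  filter_upwards [hd.2.ae_unique he.2 (MemLp.integrableOn_Om hd.1).neg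
    (MemLp.integrableOn_Om he.1).neg] with x hx
  linarith

lemma MemHTilde.hasLeftRLDeriv (hs1 : 1 < s) (hs2 : s < 2) (hu : MemHTilde (s / 2) u) :
    HasLeftRLDeriv (s / 2) u (leftRLDeriv (s / 2) u) := by
  have h := exists_hasLeftRLDeriv hs1 hs2 hu
  rw [leftRLDeriv, dif_pos h]
  exact h.choose_spec

lemma MemHTilde.memLp (hs1 : 1 < s) (hs2 : s < 2) (hu : MemHTilde (s / 2) u) : MemLp u 2 muOm :=
  ((memHTilde_half_iff hs1 hs2).1 hu).1

/-- Both derivatives are chosen arbitrarily, so they can be compared only through almost everywhere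
uniqueness. This reduces all statements on right derivatives to left ones. -/
lemma MemHTilde.rightRLDeriv_ae_eq (hs1 : 1 < s) (hs2 : s < 2) (hv : MemHTilde (s / 2) v) :
    rightRLDeriv (s / 2) v =ᵐ[muOm]
      fun x => leftRLDeriv (s / 2) (fun y => v (1 - y)) (1 - x) := by
  have hr := hv.reflect hs1 hs2
  have h := (hr.hasLeftRLDeriv hs1 hs2).reflect hs2 (MemLp.integrableOn_Om (hr.memLp hs1 hs2))
  simp only [sub_sub_cancel] at h
  have h' : ∃ d, HasRightRLDeriv (s / 2) v d := ⟨_, h⟩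
  refine HasRightRLDeriv.ae_unique hs2 ?_ h
  rw [rightRLDeriv, dif_pos h']
  exact h'.choose_spec

lemma formA_eq (hs1 : 1 < s) (hs2 : s < 2) (u : ℝ → ℝ) (hv : MemHTilde (s / 2) v) :
    formA s u v = -∫ x in Om, leftRLDeriv (s / 2) u x *
      leftRLDeriv (s / 2) (fun y => v (1 - y)) (1 - x) := by
  unfold formA
  congr 1
  refine integral_congr_ae ?_
  filter_upwards [hv.rightRLDeriv_ae_eq hs1 hs2] with x hx
  rw [hx]

lemma formA_reflect (hs1 : 1 < s) (hs2 : s < 2) (hu : MemHTilde (s / 2) u)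
    (hv : MemHTilde (s / 2) v) :
    formA s (fun x => v (1 - x)) (fun x => u (1 - x)) = formA s u v := by
  rw [formA_eq hs1 hs2 _ hv, formA_eq hs1 hs2 _ (hu.reflect hs1 hs2), ← setIntegral_reflect]
  simp only [sub_sub_cancel]
  congr 1
  refine integral_congr_ae (ae_of_all _ fun x => mul_comm _ _)

/-! ### Representation of functions in the energy space -/

/-- The interaction of `(0, η)` with the negative half-line, where the extension is zero, would
contribute at least `ε² ∫ x^(-s)/s`, and this diverges at `0` for `s > 1`. This serves as a trace
statement. -/
lemma not_ae_le_abs (hs1 : 1 < s) (hs2 : s < 2) (hu : MemHTilde (s / 2) u) {η ε : ℝ} (hη : 0 < η)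
    (hη1 : η ≤ 1) (hε : 0 < ε) : ¬ ∀ᵐ x, x ∈ Ioo 0 η → ε ≤ |u x| := by
  intro h
  rw [memHTilde_half_iff hs1 hs2] at hu
  have hs0 : 0 < s := by linarith
  have h1 : ∫⁻ x in Ioo 0 η, ENNReal.ofReal (ε ^ 2) * ENNReal.ofReal (x ^ (-s) / s) < ⊤ := by
    refine lt_of_le_of_lt ?_ hu.2
    unfold slobodeckij
    simp only [Measure.restrict_univ]
    refine le_trans (lintegral_mono_ae ?_) (setLIntegral_le_lintegral (Ioo 0 η) _)
    filter_upwards [(ae_restrict_iff' measurableSet_Ioo).2 h, ae_restrict_mem measurableSet_Ioo]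
      with x hx hx'
    refine le_trans ?_ (setLIntegral_le_lintegral (Iic (0 : ℝ)) _)
    rw [← lintegral_Iic_one_div_rpow hs0 hx'.1, ← lintegral_const_mul' _ _ ENNReal.ofReal_ne_top]
    refine setLIntegral_mono' measurableSet_Iic fun y hy => ?_
    rw [← ENNReal.ofReal_mul (by positivity)]
    refine ENNReal.ofReal_le_ofReal ?_
    rw [indicator_of_mem (show x ∈ Om from ⟨hx'.1, hx'.2.trans_le hη1⟩),
      indicator_Om_of_nonpos u y hy, sub_zero, mul_one_div, mul_div_cancel₀ s two_ne_zero,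
      ← sq_abs (u x)]
    gcongr
  rw [lintegral_const_mul' _ _ ENNReal.ofReal_ne_top] at h1
  have h2 : ∫⁻ x in Ioo 0 η, ENNReal.ofReal (x ^ (-s) / s) < ⊤ := by
    rcases ENNReal.mul_lt_top_iff.1 h1 with h | h | h
    · exact h.2
    · exact absurd (ENNReal.ofReal_eq_zero.1 h) (by have := sq_pos_of_pos hε; linarith)
    · rw [h]; simp
  have h3 : IntegrableOn (fun x : ℝ => x ^ (-s) / s) (Ioo 0 η) := by
    refine ⟨by fun_prop, ?_⟩
    rw [hasFiniteIntegral_iff_ofReal]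
    · exact h2
    · filter_upwards [ae_restrict_mem measurableSet_Ioo] with x hx
      have := hx.1
      simp only [Pi.zero_apply]
      positivity
  have h4 : IntegrableOn (fun x : ℝ => x ^ (-s)) (Ioo 0 η) := by
    refine (h3.const_mul s).congr (ae_of_all _ fun x => ?_)
    simp only
    field_simp
  rw [intervalIntegral.integrableOn_Ioo_rpow_iff hη] at h4
  linarith

/-- From `I^(1-s/2) u = c + I¹ d`, applying `I^(s/2)` shows that `u` and the potential have the same
primitive; functions with equal primitives agree almost everywhere. -/
lemma HasLeftRLDeriv.exists_ae_eq_pot (hs1 : 1 < s) (hs2 : s < 2) (hu : IntegrableOn u Om)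
    {d : ℝ → ℝ} (h : HasLeftRLDeriv (s / 2) u d) :
    ∃ c, u =ᵐ[muOm] pot c (fun x => -d x) (s / 2) := by
  rw [hasLeftRLDeriv_half_iff hs2] at h
  have hd := MemLp.integrableOn_Om h.1
  have hσ : 0 < 1 - s / 2 := by linarith
  have hα : 0 < s / 2 := by linarith
  obtain ⟨c, hc⟩ := h.2.exists_ae_eq (integrableOn_leftInt hσ hu) hd
  refine ⟨c, ?_⟩
  have hdn : IntegrableOn (fun x => -d x) Om := hd.neg
  have hp := integrableOn_pot c hdn hα
  have hn : (Om.indicator fun x => -d x) = fun x => -Om.indicator d x := by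
    ext x; by_cases hx : x ∈ Om <;> simp [hx]
  have hU := integrable_indicator_Om hu
  have key : ∀ x ∈ Om, fracInt 1 (Om.indicator u) x =
      fracInt 1 (Om.indicator (pot c (fun x => -d x) (s / 2))) x := by
    intro x hx
    have e1 := fracInt_fracInt hα hσ hU.1 (x := x)
      (integrable_rk_mul_of_one_le (by linarith) hU (indicator_Om_of_neg u) x)
    have e2 := fracInt_pot c hdn hα one_pos (by linarith) hx.2.le
    have e3 := fracInt_pot c hdn one_pos hα (by linarith) hx.2.le
    rw [add_sub_cancel] at e1
    rw [add_comm] at e3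
    rw [← e1, e3.trans e2.symm]
    refine fracInt_congr ?_
    filter_upwards [(ae_restrict_iff' measurableSet_Ioo).1 hc] with y hy hyx
    by_cases h0 : 0 < y
    · have hyO : y ∈ Om := ⟨h0, hyx.trans hx.2⟩
      rw [← leftInt_eq_fracInt _ _ ⟨hyO.1.le, hyO.2.le⟩, hy hyO, indicator_of_mem hyO]
      simp only [pot, hn, rk_one_of_pos h0]
      simp only [fracInt, mul_neg, integral_neg]
      ring
    · rw [fracInt_of_nonpos (indicator_Om_of_nonpos u) (not_lt.1 h0),
        indicator_Om_of_nonpos _ _ (not_lt.1 h0)]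
  have hz := ae_eq_zero_of_fracInt_one (hu.sub hp) (fun x hx => by
    have e : Om.indicator (u - pot c (fun x => -d x) (s / 2)) =
        fun y => Om.indicator u y - Om.indicator (pot c (fun x => -d x) (s / 2)) y := by
      ext y; by_cases hy : y ∈ Om <;> simp [hy]
    rw [e]
    unfold fracInt at key ⊢
    simp_rw [mul_sub]
    rw [integral_sub (integrable_rk_mul_of_one_le le_rfl hU (indicator_Om_of_neg u) x)
      (integrable_rk_mul_of_one_le le_rfl (integrable_indicator_Om hp) (indicator_Om_of_neg _) x),
      key x hx, sub_self])
  filter_upwards [hz] with x hx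
  simpa [sub_eq_zero] using hx

lemma exists_abs_fracInt_le {σ : ℝ} (hσ : 1 / 2 < σ) {w : ℝ → ℝ} (hw : MemLp w 2 muOm) :
    ∃ B, ∀ x ≤ 1, |fracInt σ (Om.indicator w) x| ≤ B :=
  ⟨_, fun _ hx => Real.abs_le_sqrt (sq_fracInt_le hσ hw hx)⟩

/-- A function in `H̃^{s/2}` is the fractional integral of its derivative. -/
theorem MemHTilde.ae_eq_fracInt (hs1 : 1 < s) (hs2 : s < 2) (hu : MemHTilde (s / 2) u) :
    u =ᵐ[muOm] fracInt (s / 2) (Om.indicator (leftRLDeriv (s / 2) u)) := by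
  have hd := hu.hasLeftRLDeriv hs1 hs2
  obtain ⟨c, hc⟩ := hd.exists_ae_eq_pot hs1 hs2 (MemLp.integrableOn_Om (hu.memLp hs1 hs2))
  set d := leftRLDeriv (s / 2) u
  have hn : (Om.indicator fun x => -d x) = fun x => -Om.indicator d x := by
    ext x; by_cases hx : x ∈ Om <;> simp [hx]
  have hpot : ∀ x, pot c (fun x => -d x) (s / 2) x =
      c * rk (s / 2) x + fracInt (s / 2) (Om.indicator d) x := by
    intro x
    simp only [pot, hn, fracInt, mul_neg, integral_neg]
    ring
  suffices hc0 : c = 0 by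
    filter_upwards [hc] with x hx
    rw [hx, hpot, hc0]; ring
  by_contra hc0
  obtain ⟨B, hB⟩ := exists_abs_fracInt_le (σ := s / 2) (by linarith) hd.1
  have hG : 0 < Real.Gamma (s / 2) := Real.Gamma_pos_of_pos (by linarith)
  have ht : Tendsto (fun x : ℝ => x ^ (s / 2 - 1)) (nhdsWithin 0 (Ioi 0)) atTop :=
    tendsto_rpow_neg_nhdsGT_zero (by linarith)
  -- Past this threshold the singular term `c x^(s/2-1)/Γ(s/2)` is at least `B + 1` in absolute
  -- value, while the regular part stays below `B`; so `|u| ≥ 1` near `0`, contradicting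
  -- `not_ae_le_abs`.
  have hev := ht.eventually_ge_atTop ((B + 1) / |c| * Real.Gamma (s / 2))
  obtain ⟨η, hη0, hη⟩ := mem_nhdsGT_iff_exists_Ioo_subset.1 hev
  refine not_ae_le_abs hs1 hs2 hu (lt_min hη0 one_pos) (min_le_right η 1) one_pos ?_
  filter_upwards [(ae_restrict_iff' measurableSet_Ioo).1 hc] with x hx hx'
  have hx1 : x < 1 := hx'.2.trans_le (min_le_right _ _)
  have hx2 : (B + 1) / |c| * Real.Gamma (s / 2) ≤ x ^ (s / 2 - 1) :=
    hη ⟨hx'.1, hx'.2.trans_le (min_le_left _ _)⟩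
  rw [hx ⟨hx'.1, hx1⟩, hpot, rk_of_pos hx'.1]
  have h1 : B + 1 ≤ |c * (x ^ (s / 2 - 1) / Real.Gamma (s / 2))| := by
    rw [abs_mul, abs_of_nonneg (by have := hx'.1; positivity : 0 ≤ x ^ (s / 2 - 1) / Real.Gamma (s / 2))]
    rw [← le_div_iff₀ hG, div_le_iff₀' (abs_pos.2 hc0)] at hx2
    exact hx2
  have h2 := hB x hx1.le
  have h3 := abs_sub_abs_le_abs_add (c * (x ^ (s / 2 - 1) / Real.Gamma (s / 2)))
    (fracInt (s / 2) (Om.indicator d) x)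
  linarith

/-- By Hölder continuity a nonzero value at `1` would keep `|u|` above half of it nearby, which
`not_ae_le_abs` excludes for the reflected function. -/
theorem MemHTilde.fracInt_one_eq_zero (hs1 : 1 < s) (hs2 : s < 2) (hu : MemHTilde (s / 2) u) :
    fracInt (s / 2) (Om.indicator (leftRLDeriv (s / 2) u)) 1 = 0 := by
  have hd := (hu.hasLeftRLDeriv hs1 hs2).1
  have hrep := ae_reflect (hu.ae_eq_fracInt hs1 hs2)
  set d := leftRLDeriv (s / 2) u
  by_contra hL
  set l := |fracInt (s / 2) (Om.indicator d) 1|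
  have hl : 0 < l := abs_pos.2 hL
  set θ := (s / 2 - 1 / 2) / 2 with hθ
  obtain ⟨C, hC⟩ := exists_abs_fracInt_sub_le (σ := s / 2) (θ := θ) (by linarith) (by linarith)
    (by linarith) (by linarith) (by linarith) hd
  have ht : Tendsto (fun x : ℝ => C * x ^ θ) (nhdsWithin 0 (Ioi 0)) (nhds 0) := by
    have h1 : ContinuousAt (fun x : ℝ => C * x ^ θ) 0 :=
      (Real.continuousAt_rpow_const _ _ (Or.inr (by linarith))).const_mul C
    have h2 := h1.tendsto
    rw [Real.zero_rpow (by linarith), mul_zero] at h2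
    exact h2.mono_left nhdsWithin_le_nhds
  have hev := ht.eventually_lt_const (half_pos hl)
  obtain ⟨η, hη0, hη⟩ := mem_nhdsGT_iff_exists_Ioo_subset.1 hev
  refine not_ae_le_abs hs1 hs2 (hu.reflect hs1 hs2) (lt_min hη0 one_pos) (min_le_right η 1)
    (half_pos hl) ?_
  filter_upwards [(ae_restrict_iff' measurableSet_Ioo).1 hrep] with x hx hx'
  have hx1 : x < 1 := hx'.2.trans_le (min_le_right _ _)
  have hx2 : C * x ^ θ < l / 2 := hη ⟨hx'.1, hx'.2.trans_le (min_le_left _ _)⟩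
  rw [hx ⟨hx'.1, hx1⟩]
  have h1 := hC 1 ⟨zero_le_one, le_rfl⟩ (1 - x) ⟨by linarith, by linarith [hx'.1]⟩
  rw [sub_sub_cancel, abs_of_pos hx'.1] at h1
  have h2 := abs_sub_abs_le_abs_sub (fracInt (s / 2) (Om.indicator d) 1)
    (fracInt (s / 2) (Om.indicator d) (1 - x))
  change l - _ ≤ _ at h2
  linarith

/-- The embedding into bounded functions. It makes the energy space all of `H̃^(s/2)` and allows the
local Lipschitz condition to be used. -/
lemma MemHTilde.exists_ae_abs_le (hs1 : 1 < s) (hs2 : s < 2) (hu : MemHTilde (s / 2) u) :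
    ∃ B, 0 < B ∧ ∀ᵐ x ∂muOm, |u x| ≤ B := by
  obtain ⟨B, hB⟩ := exists_abs_fracInt_le (σ := s / 2) (by linarith) (hu.hasLeftRLDeriv hs1 hs2).1
  refine ⟨max B 1, by positivity, ?_⟩
  filter_upwards [hu.ae_eq_fracInt hs1 hs2, ae_restrict_mem measurableSet_Ioo] with x hx hx'
  rw [hx]
  exact (hB x hx'.2.le).trans (le_max_left _ _)

/-! ### The bilinear form on Green potentials -/

/-- Fubini; the kernel argument `1 - x - y` is symmetric, so left integration is self-adjoint for
the pairing with a reflected factor. -/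
lemma integral_fracInt_mul {σ : ℝ} (hσ : 1 / 2 < σ) {k : ℝ → ℝ} (hh : MemLp h 2 muOm)
    (hk : MemLp k 2 muOm) :
    ∫ x in Om, fracInt σ (Om.indicator h) x * k (1 - x) =
      ∫ y in Om, h y * fracInt σ (Om.indicator k) (1 - y) := by
  have hk' := MemLp.reflect hk
  have hi : Integrable (fun p : ℝ × ℝ => rk σ (p.1 - p.2) * h p.2 * k (1 - p.1))
      (muOm.prod muOm) := by
    have hm : AEStronglyMeasurable (fun p : ℝ × ℝ => rk σ (p.1 - p.2) * h p.2 * k (1 - p.1))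
        (muOm.prod muOm) := by
      refine (AEStronglyMeasurable.mul ?_ ?_).mul ?_
      · exact ((measurable_rk σ).comp (by fun_prop)).aestronglyMeasurable
      · exact hh.1.comp_snd
      · exact hk'.1.comp_fst
    rw [integrable_prod_iff hm]
    constructor
    · filter_upwards [ae_restrict_mem measurableSet_Ioo] with x hx
      exact (integrable_rk_mul hσ hh hx.2.le).mul_const _
    · have hint : Integrable (fun x => fracInt σ (Om.indicator fun y => |h y|) x * |k (1 - x)|) muOm :=
        (memLp_fracInt hσ hh.norm).integrable_mul hk'.norm
      refine hint.congr (ae_of_all _ fun x => ?_)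
      simp only [norm_mul, integral_mul_const, fracInt_indicator, Real.norm_eq_abs,
        abs_of_nonneg (rk_nonneg (by linarith : 0 < σ) _)]
  have e1 : ∀ x, fracInt σ (Om.indicator h) x * k (1 - x) =
      ∫ y in Om, rk σ (x - y) * h y * k (1 - x) := fun x => by
    rw [fracInt_indicator, integral_mul_const]
  simp_rw [e1]
  rw [integral_integral_swap hi]
  refine integral_congr_ae (ae_of_all _ fun y => ?_)
  simp only
  rw [fracInt_indicator, ← integral_const_mul, ← setIntegral_reflect]
  refine integral_congr_ae (ae_of_all _ fun x => ?_)
  simp only [sub_sub_cancel]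
  rw [show 1 - x - y = 1 - y - x by ring]
  ring

/-- The derivative of the potential is its point-mass term minus `I^(s/2) h`. Pairing the point mass
with the derivative of `v` gives the boundary value of the reflected `v` at `1`, which is zero. In
the other term the half integral moves across and rebuilds `v`. -/
theorem formA_green (hs1 : 1 < s) (hs2 : s < 2) (hh : MemLp h 2 muOm)
    (hv : MemHTilde (s / 2) v) : formA s (green s h) v = ∫ x in Om, h x * v x := by
  have hr := hv.reflect hs1 hs2
  have hrep := ae_reflect (hr.ae_eq_fracInt hs1 hs2)
  have hone := hr.fracInt_one_eq_zero hs1 hs2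
  have he := (hr.hasLeftRLDeriv hs1 hs2).1
  have hd := ((memHTilde_green hs1 hs2 hh).hasLeftRLDeriv hs1 hs2).ae_unique hs2
    (hasLeftRLDeriv_half_green hs1 hs2 hh)
  rw [formA_eq hs1 hs2 _ hv]
  set e := leftRLDeriv (s / 2) fun y => v (1 - y)
  have hα : 1 / 2 < s / 2 := by linarith
  set m := greenMass s h
  have i1 : IntegrableOn (fun x => m * (rk (s / 2) x * e (1 - x))) Om :=
    ((memLp_rk_Om hα).integrable_mul (MemLp.reflect he)).const_mul m
  have i2 : IntegrableOn (fun x => fracInt (s / 2) (Om.indicator h) x * e (1 - x)) Om :=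
    (memLp_fracInt hα hh).integrable_mul (MemLp.reflect he)
  have e1 : ∫ x in Om, leftRLDeriv (s / 2) (green s h) x * e (1 - x) =
      ∫ x in Om, (m * (rk (s / 2) x * e (1 - x)) -
        fracInt (s / 2) (Om.indicator h) x * e (1 - x)) := by
    refine integral_congr_ae ?_
    filter_upwards [hd] with x hx
    rw [hx, pot]; ring
  have e2 : ∫ x in Om, rk (s / 2) x * e (1 - x) = 0 := by
    rw [← hone, fracInt_indicator, ← setIntegral_reflect]
    simp
  rw [e1, integral_sub i1 i2, integral_const_mul, e2, integral_fracInt_mul hα hh he]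
  simp only [mul_zero, zero_sub, neg_neg]
  refine integral_congr_ae ?_
  filter_upwards [hrep] with x hx
  rw [← hx, sub_sub_cancel]

end

section

/-! ### The nonlinearity -/

variable {g : ℝ → ℝ → ℝ} {u : ℝ → ℝ} {s : ℝ}

/-- A Carathéodory function agrees for almost every `x` with a jointly measurable one. -/
lemma NonlinAssumption.exists_measurable (hg : NonlinAssumption g) :
    ∃ k : ℝ → ℝ → ℝ, Measurable (fun p : ℝ × ℝ => k p.1 p.2) ∧ ∀ᵐ x ∂muOm, ∀ t, g x t = k x t := by
  -- Representatives are fixed only at rational `t`, so the exceptional sets remain negligible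
  -- together; continuity in `t` then determines the function at all real `t`.
  have hgood : ∀ᵐ x ∂muOm, Continuous (g x) ∧ ∀ q : ℚ, g x q = (hg.measurable q).mk _ x :=
    hg.continuous.and (ae_all_iff.2 fun q => (hg.measurable q).ae_eq_mk)
  obtain ⟨S, hS, hSm, hS0⟩ : ∃ S, (∀ x ∈ S, Continuous (g x) ∧
      ∀ q : ℚ, g x q = (hg.measurable q).mk _ x) ∧ MeasurableSet S ∧ ∀ᵐ x ∂muOm, x ∈ S := by
    refine ⟨(toMeasurable muOm {x | ¬ (Continuous (g x) ∧
      ∀ q : ℚ, g x q = (hg.measurable q).mk _ x)})ᶜ, fun x hx => ?_,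
      (measurableSet_toMeasurable _ _).compl, ?_⟩
    · by_contra hc
      exact hx (subset_toMeasurable _ _ hc)
    · rw [ae_iff]
      simp only [mem_compl_iff, not_not, ofPred_mem_eq]
      rw [measure_toMeasurable]
      exact ae_iff.1 hgood
  have hcont : ∀ x, Continuous (S.indicator g x) := fun x => by
    by_cases hx : x ∈ S
    · rw [indicator_of_mem hx]; exact (hS x hx).1
    · rw [indicator_of_notMem hx]; exact continuous_zero
  have hrat : ∀ q : ℚ, Measurable fun x => S.indicator g x (q : ℝ) := fun q => by
    have e : (fun x => S.indicator g x (q : ℝ)) = S.indicator ((hg.measurable q).mk _) := by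
      ext x
      by_cases hx : x ∈ S
      · rw [indicator_of_mem hx, indicator_of_mem hx, (hS x hx).2]
      · rw [indicator_of_notMem hx, indicator_of_notMem hx]; rfl
    rw [e]
    exact (hg.measurable q).measurable_mk.indicator hSm
  have hmeas : ∀ t : ℝ, Measurable fun x => S.indicator g x t := fun t => by
    obtain ⟨q, hq⟩ := mem_closure_iff_seq_limit.1 (Rat.denseRange_cast (𝕜 := ℝ) t)
    choose r hr using hq.1
    refine measurable_of_tendsto_metrizable (fun n => hrat (r n)) ?_
    rw [tendsto_pi_nhds]
    intro x
    simp_rw [hr]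
    exact ((hcont x).tendsto t).comp hq.2
  refine ⟨S.indicator g, ?_, ?_⟩
  · have := measurable_uncurry_of_continuous_of_measurable (u := fun t x => S.indicator g x t)
      hcont hmeas
    exact this.comp measurable_swap
  · filter_upwards [hS0] with x hx t
    rw [indicator_of_mem hx]

lemma NonlinAssumption.aestronglyMeasurable_comp (hg : NonlinAssumption g)
    (hu : AEStronglyMeasurable u muOm) : AEStronglyMeasurable (fun x => g x (u x)) muOm := by
  obtain ⟨k, hk, hgk⟩ := hg.exists_measurable
  refine (hk.comp_aemeasurable (aemeasurable_id.prodMk hu.aemeasurable)).aestronglyMeasurable.congr ?_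
  filter_upwards [hgk] with x hx
  exact (hx _).symm

lemma NonlinAssumption.aestronglyMeasurable_primG (hg : NonlinAssumption g)
    (hu : AEStronglyMeasurable u muOm) :
    AEStronglyMeasurable (fun x => primG g x (u x)) muOm := by
  obtain ⟨k, hk, hgk⟩ := hg.exists_measurable
  have hm : Measurable fun p : ℝ × ℝ => 
      {p : ℝ × ℝ | 0 < p.2 ∧ p.2 ≤ |p.1|}.indicator (1 : ℝ × ℝ → ℝ) p := by
    refine measurable_one.indicator ?_
    exact (measurableSet_lt measurable_const measurable_snd).inter
      (measurableSet_le measurable_snd (by fun_prop))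
  have h1 : Measurable fun q : (ℝ × ℝ) × ℝ =>
      {p : ℝ × ℝ | 0 < p.2 ∧ p.2 ≤ |p.1|}.indicator (1 : ℝ × ℝ → ℝ) (q.1.2, q.2) * k q.1.1 q.2 :=
    (hm.comp ((measurable_snd.comp measurable_fst).prodMk measurable_snd)).mul
      (hk.comp ((measurable_fst.comp measurable_fst).prodMk measurable_snd))
  have h2 := (h1.stronglyMeasurable.integral_prod_right' (ν := (volume : Measure ℝ))).measurable
  refine (h2.comp_aemeasurable
    (aemeasurable_id.prodMk hu.aemeasurable)).aestronglyMeasurable.congr ?_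
  filter_upwards [hgk] with x hx
  simp only [Function.comp_apply, id]
  rw [primG, intervalIntegral.integral_of_le (abs_nonneg _), ← integral_indicator measurableSet_Ioc]
  congr 1
  ext r
  by_cases hr : r ∈ Ioc 0 |u x|
  · rw [indicator_of_mem hr, indicator_of_mem (show (u x, r) ∈ {p : ℝ × ℝ | 0 < p.2 ∧ p.2 ≤ |p.1|} from hr), hx]
    simp
  · rw [indicator_of_notMem hr, indicator_of_notMem (show (u x, r) ∉ {p : ℝ × ℝ | 0 < p.2 ∧ p.2 ≤ |p.1|} from hr)]
    simp

lemma exists_lipschitz_bound (hlip : LocLipschitz g) {M : ℝ} (hM : 0 < M) :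
    ∃ l, 0 < l ∧ ∀ᵐ x ∂muOm, ∀ t₁ t₂ : ℝ, |t₁| ≤ M → |t₂| ≤ M →
      |g x t₁ - g x t₂| ≤ l * |t₁ - t₂| := by
  obtain ⟨l, hl⟩ := hlip M hM
  refine ⟨max l 1, by positivity, ?_⟩
  filter_upwards [hl] with x hx t₁ t₂ h1 h2
  exact (hx t₁ t₂ h1 h2).trans (by gcongr; exact le_max_left _ _)

lemma exists_bound_of_locLipschitz (hg : NonlinAssumption g) (hlip : LocLipschitz g) {M : ℝ}
    (hM : 0 < M) : ∃ B, 0 ≤ B ∧ ∀ᵐ x ∂muOm, ∀ t : ℝ, |t| ≤ M → |g x t| ≤ B := by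
  obtain ⟨l, hl0, hl⟩ := exists_lipschitz_bound hlip hM
  refine ⟨l * M, by positivity, ?_⟩
  filter_upwards [hl, hg.zero] with x hx h0 t ht
  have := hx t 0 ht (by simpa using hM.le)
  rw [h0, sub_zero, sub_zero] at this
  exact this.trans (by gcongr)

lemma memLp_comp_of_bounded (hg : NonlinAssumption g) (hlip : LocLipschitz g)
    (hu : AEStronglyMeasurable u muOm) {M : ℝ} (hM : 0 < M) (hb : ∀ᵐ x ∂muOm, |u x| ≤ M) :
    MemLp (fun x => g x (u x)) 2 muOm := by
  obtain ⟨B, -, hB⟩ := exists_bound_of_locLipschitz hg hlip hM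
  refine MemLp.of_bound (hg.aestronglyMeasurable_comp hu) B ?_
  filter_upwards [hB, hb] with x h1 h2
  exact h1 _ h2

lemma integrable_primG_of_bounded (hg : NonlinAssumption g) (hlip : LocLipschitz g)
    (hu : AEStronglyMeasurable u muOm) {M : ℝ} (hM : 0 < M) (hb : ∀ᵐ x ∂muOm, |u x| ≤ M) :
    Integrable (fun x => primG g x (u x)) muOm := by
  obtain ⟨B, hB0, hB⟩ := exists_bound_of_locLipschitz hg hlip hM
  refine Integrable.of_bound (hg.aestronglyMeasurable_primG hu) (B * M) ?_
  filter_upwards [hB, hb] with x h1 h2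
  have := intervalIntegral.norm_integral_le_of_norm_le_const (a := 0) (b := |u x|) (f := g x)
    (C := B) (fun r hr => h1 r (by
      rw [uIoc_of_le (abs_nonneg _)] at hr
      rw [abs_of_pos hr.1]
      exact hr.2.trans h2))
  rw [sub_zero, abs_abs] at this
  exact this.trans (by gcongr)

/-- Every function in `H̃^{s/2}` belongs to the energy space. -/
lemma MemHTilde.memU (hs1 : 1 < s) (hs2 : s < 2) (hg : NonlinAssumption g)
    (hlip : LocLipschitz g) (hu : MemHTilde (s / 2) u) : MemU s g u := by
  obtain ⟨B, hB0, hB⟩ := hu.exists_ae_abs_le hs1 hs2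
  exact ⟨hu, integrable_primG_of_bounded hg hlip (hu.memLp hs1 hs2).1 hB0 hB⟩

lemma MemHTilde.memLp_comp (hs1 : 1 < s) (hs2 : s < 2) (hg : NonlinAssumption g)
    (hlip : LocLipschitz g) (hu : MemHTilde (s / 2) u) : MemLp (fun x => g x (u x)) 2 muOm := by
  obtain ⟨B, hB0, hB⟩ := hu.exists_ae_abs_le hs1 hs2
  exact memLp_comp_of_bounded hg hlip (hu.memLp hs1 hs2).1 hB0 hB

variable {f h : ℝ → ℝ}

lemma formB_add (hs1 : 1 < s) (hs2 : s < 2) (hg : NonlinAssumption g) (hlip : LocLipschitz g)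
    (hf : MemLp f 2 muOm) {v : ℝ → ℝ} (hu : MemHTilde (s / 2) u) (hv : MemHTilde (s / 2) v) :
    ∫ x in Om, f x * v x = (∫ x in Om, (f x - g x (u x)) * v x) + formB g u v := by
  have hv2 := hv.memLp hs1 hs2
  have hgu := hu.memLp_comp hs1 hs2 hg hlip
  rw [formB, ← integral_add]
  · congr 1; ext x; ring
  · exact (hf.sub hgu).integrable_mul hv2
  · exact hgu.integrable_mul hv2

/-- A weak solution is the Green potential of its right-hand side. -/
theorem IsWeakSolution.ae_eq_green (hs1 : 1 < s) (hs2 : s < 2) (hg : NonlinAssumption g)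
    (hlip : LocLipschitz g) (hf : MemLp f 2 muOm) (hu : IsWeakSolution s g f u) :
    u =ᵐ[muOm] green s (fun x => f x - g x (u x)) := by
  have huT := hu.1.1
  have hh : MemLp (fun x => f x - g x (u x)) 2 muOm := hf.sub (huT.memLp_comp hs1 hs2 hg hlip)
  set h := fun x => f x - g x (u x) with hhd
  have hG := memHTilde_green hs1 hs2 hh
  have key : ∀ p, MemLp p 2 muOm → ∫ x in Om, p x * u x = ∫ x in Om, p x * green s h x := by
    intro p hp
    have hp' := MemLp.reflect hp
    have hv0 := memHTilde_green hs1 hs2 hp'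
    have hv := hv0.reflect hs1 hs2
    -- The reflected Green potential of the reflected `p` solves the adjoint problem. As a test
    -- function it turns the form in its first argument into the pairing with `p`.
    have hA : ∀ w, MemHTilde (s / 2) w →
        formA s w (fun x => green s (fun y => p (1 - y)) (1 - x)) = ∫ x in Om, p x * w x := by
      intro w hw
      rw [← formA_reflect hs1 hs2 hw hv]
      simp only [sub_sub_cancel]
      rw [formA_green hs1 hs2 hp' (hw.reflect hs1 hs2), ← setIntegral_reflect]
      simp only [sub_sub_cancel]
    have h1 := hu.2 _ (hv.memU hs1 hs2 hg hlip)
    rw [formB_add hs1 hs2 hg hlip hf huT hv, hA u huT] at h1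
    have h2 := formA_green hs1 hs2 hh hv
    rw [hA _ hG] at h2
    rw [h2]
    exact add_right_cancel h1
  have hu2 := huT.memLp hs1 hs2
  have hG2 := hG.memLp hs1 hs2
  have hd : MemLp (fun x => u x - green s h x) 2 muOm := hu2.sub hG2
  -- The identity is applied with `p` equal to the difference of the two functions.
  have hz : ∫ x in Om, (u x - green s h x) ^ 2 = 0 := by
    have h1 := key _ hd
    have i1 : Integrable (fun x => (u x - green s h x) * u x) muOm := hd.integrable_mul hu2
    have i2 : Integrable (fun x => (u x - green s h x) * green s h x) muOm := hd.integrable_mul hG2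
    rw [← sub_eq_zero, ← integral_sub i1 i2] at h1
    rw [← h1]
    congr 1; ext x
    ring
  rw [integral_eq_zero_iff_of_nonneg (fun _ => sq_nonneg _) hd.integrable_sq] at hz
  filter_upwards [hz] with x hx
  have : (u x - green s h x) ^ 2 = 0 := hx
  have := pow_eq_zero_iff (two_ne_zero) |>.1 this
  linarith

end

section

/-! ### A fixed point theorem of Hammerstein type -/

section Hilbert

variable {H : Type*} [NormedAddCommGroup H] [InnerProductSpace ℝ H] [CompleteSpace H]

/-- Lax–Milgram: monotonicity of `K` makes `1 + l K` coercive with constant one. -/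
lemma exists_add_smul_eq (K : H →L[ℝ] H) (hK : ∀ h, 0 ≤ inner ℝ (K h) h) {l : ℝ} (hl : 0 ≤ l)
    (w : H) : ∃ h, h + l • K h = w := by
  let A : H →L[ℝ] H := ContinuousLinearMap.id ℝ H + l • K
  let B : H →L[ℝ] H →L[ℝ] ℝ := LinearMap.mkContinuous₂
    (LinearMap.mk₂ ℝ (fun v w => inner ℝ (A v) w)
      (fun x y z => by rw [map_add, inner_add_left])
      (fun c x y => by rw [map_smul, real_inner_smul_left, smul_eq_mul])
      (fun x y z => inner_add_right _ _ _)
      (fun c x y => by rw [real_inner_smul_right, smul_eq_mul])) ‖A‖ (fun x y => by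
        rw [LinearMap.mk₂_apply]
        exact (norm_inner_le_norm _ _).trans (by gcongr; exact A.le_opNorm x))
  have hB : ∀ v w, B v w = inner ℝ (A v) w := fun v w => rfl
  have hco : IsCoercive B := ⟨1, one_pos, fun v => by
    rw [hB]
    simp only [A, add_apply, ContinuousLinearMap.id_apply,
      smul_apply, inner_add_left, real_inner_smul_left,
      real_inner_self_eq_norm_mul_norm, one_mul]
    have := mul_nonneg hl (hK v)
    linarith⟩
  refine ⟨hco.continuousLinearEquivOfBilin.symm w, ?_⟩
  refine ext_inner_right ℝ fun z => ?_
  have := hco.continuousLinearEquivOfBilin_apply (hco.continuousLinearEquivOfBilin.symm w) z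
  rw [ContinuousLinearEquiv.apply_symm_apply, hB] at this
  exact this.symm

/-- If `K` is linear with `⟪K h, h⟫ ≥ c ‖K h‖²` and `l - N` is `l`-Lipschitz, then the equation
`u = K (f - N u)` has a solution. -/
theorem exists_eq_map_sub (K : H →L[ℝ] H) {c l : ℝ} (hc : 0 < c) (hl : 0 < l)
    (hK : ∀ h, c * ‖K h‖ ^ 2 ≤ inner ℝ (K h) h) (N : H → H)
    (hN : ∀ u v, ‖(l • u - N u) - (l • v - N v)‖ ≤ l * ‖u - v‖) (f : H) :
    ∃ u, u = K (f - N u) := by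
  have hK0 : ∀ h, 0 ≤ inner ℝ (K h) h := fun h => le_trans (by positivity) (hK h)
  choose R hR using exists_add_smul_eq K hK0 hl.le
  -- Pairing `K h` with `h + l K h` gives at least `(c + l)‖K h‖²`; the strict gain over `l` comes
  -- from `c`.
  have hb : ∀ h, ‖K h‖ ≤ (c + l)⁻¹ * ‖h + l • K h‖ := by
    intro h
    have h1 : inner ℝ (K h) (h + l • K h) = inner ℝ (K h) h + l * ‖K h‖ ^ 2 := by
      rw [inner_add_right, real_inner_smul_right, real_inner_self_eq_norm_sq]
    have h2 := real_inner_le_norm (K h) (h + l • K h)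
    rw [← div_eq_inv_mul, le_div_iff₀ (by positivity)]
    rcases (norm_nonneg (K h)).eq_or_lt with h0 | h0
    · rw [← h0, zero_mul]; positivity
    · refine le_of_mul_le_mul_left ?_ h0
      nlinarith [hK h]
  have hcl : 0 < c + l := by positivity
  let q : NNReal := ⟨(c + l)⁻¹ * l, by positivity⟩
  -- Adding `l u` to both sides of the equation leaves the `l`-Lipschitz map `l - N` on the right,
  -- while `K (1 + l K)⁻¹` has norm at most `1/(c + l)`. The factor is `l/(c + l) < 1`.
  have hcon : ContractingWith q fun u => K (R (f + (l • u - N u))) := by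
    refine ⟨?_, LipschitzWith.of_dist_le_mul fun u v => ?_⟩
    · rw [← NNReal.coe_lt_one]
      show (c + l)⁻¹ * l < 1
      rw [← div_eq_inv_mul, div_lt_one hcl]
      linarith
    · rw [dist_eq_norm, dist_eq_norm, ← map_sub]
      refine (hb _).trans ?_
      rw [map_sub, smul_sub, sub_add_sub_comm, hR, hR, add_sub_add_left_eq_sub]
      show _ ≤ (c + l)⁻¹ * l * _
      rw [mul_assoc]
      gcongr
      exact hN u v
  have hfix := hcon.fixedPoint_isFixedPt
  set u := ContractingWith.fixedPoint _ hcon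
  have hfix' : K (R (f + (l • u - N u))) = u := hfix
  have h1 := hR (f + (l • u - N u))
  rw [hfix'] at h1
  refine ⟨u, ?_⟩
  have h2 : R (f + (l • u - N u)) = f - N u := by
    rw [← add_left_inj (l • u), h1]; abel
  rw [← h2, hfix']

end Hilbert

/-! ### The Green operator on square integrable functions -/

variable {s : ℝ} {f h k : ℝ → ℝ}

lemma green_congr (hhk : h =ᵐ[muOm] k) {x : ℝ} (hx : x ∈ Icc (0 : ℝ) 1) :
    green s h x = green s k x := by
  have : ∀ x ∈ Icc (0 : ℝ) 1, leftInt s h x = leftInt s k x := fun x hx => by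
    rw [leftInt_eq_fracInt _ _ hx, leftInt_eq_fracInt _ _ hx, fracInt_indicator, fracInt_indicator]
    refine integral_congr_ae ?_
    filter_upwards [hhk] with y hy
    rw [hy]
  rw [green, green, this x hx, this 1 ⟨zero_le_one, le_rfl⟩]

lemma leftInt_add (hs : 1 < s) (hh : MemLp h 2 muOm) (hk : MemLp k 2 muOm) {x : ℝ}
    (hx : x ∈ Icc (0 : ℝ) 1) : leftInt s (fun y => h y + k y) x = leftInt s h x + leftInt s k x := by
  simp only [leftInt_eq_fracInt _ _ hx, fracInt_indicator, mul_add]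
  exact integral_add (integrable_rk_mul (by linarith) hh hx.2) (integrable_rk_mul (by linarith) hk hx.2)

lemma leftInt_const_mul (s c : ℝ) (h : ℝ → ℝ) (x : ℝ) :
    leftInt s (fun y => c * h y) x = c * leftInt s h x := by
  unfold leftInt
  simp_rw [mul_left_comm _ c, intervalIntegral.integral_const_mul]
  ring

lemma green_add (hs : 1 < s) (hh : MemLp h 2 muOm) (hk : MemLp k 2 muOm) {x : ℝ}
    (hx : x ∈ Icc (0 : ℝ) 1) : green s (fun y => h y + k y) x = green s h x + green s k x := by
  rw [green, green, green, leftInt_add hs hh hk hx, leftInt_add hs hh hk ⟨zero_le_one, le_rfl⟩]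
  ring

lemma green_const_mul (s c : ℝ) (h : ℝ → ℝ) (x : ℝ) :
    green s (fun y => c * h y) x = c * green s h x := by
  rw [green, green, leftInt_const_mul, leftInt_const_mul]
  ring

instance : IsProbabilityMeasure muOm := ⟨by simp⟩

lemma exists_green_integral_coercive (hs1 : 1 < s) (hs2 : s < 2) :
    ∃ c, 0 < c ∧ (∀ h : ℝ → ℝ, MemLp h 2 muOm → ∀ x ∈ Icc (0 : ℝ) 1,
      c * green s h x ^ 2 ≤ ∫ y in Om, green s h y * h y) ∧
      ∀ h : ℝ → ℝ, MemLp h 2 muOm →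
        c * ∫ x in Om, green s h x ^ 2 ≤ ∫ y in Om, green s h y * h y := by
  obtain ⟨c, hc, hco⟩ := exists_green_coercive hs1 hs2
  refine ⟨c, hc, hco, fun h hh => ?_⟩
  rw [← integral_const_mul]
  calc ∫ x in Om, c * green s h x ^ 2 ≤ ∫ _ in Om, ∫ y in Om, green s h y * h y := by
        refine setIntegral_mono_on ((memLp_green hs1 hh).integrable_sq.const_mul c)
          (integrable_const _) measurableSet_Ioo fun x hx => hco h hh x ⟨hx.1.le, hx.2.le⟩
    _ = _ := by simp

/-- The Green operator on `L²(0,1)`. -/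
theorem exists_greenCLM (hs1 : 1 < s) (hs2 : s < 2) :
    ∃ (c : ℝ) (K : Lp ℝ 2 muOm →L[ℝ] Lp ℝ 2 muOm), 0 < c ∧
      (∀ h : ℝ → ℝ, MemLp h 2 muOm → ∀ x ∈ Icc (0 : ℝ) 1,
        c * green s h x ^ 2 ≤ ∫ y in Om, green s h y * h y) ∧
      (∀ h : ℝ → ℝ, MemLp h 2 muOm →
        c * ∫ x in Om, green s h x ^ 2 ≤ ∫ y in Om, green s h y * h y) ∧
      (∀ h, c * ‖K h‖ ^ 2 ≤ inner ℝ (K h) h) ∧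
      ∀ h, (K h : ℝ → ℝ) =ᵐ[muOm] green s h := by
  obtain ⟨c, hc, hco, hco2⟩ := exists_green_integral_coercive hs1 hs2
  have hm : ∀ h : Lp ℝ 2 muOm, MemLp (green s h) 2 muOm := fun h => memLp_green hs1 (Lp.memLp h)
  have hmem : ∀ᵐ x ∂muOm, x ∈ Icc (0 : ℝ) 1 := by
    filter_upwards [ae_restrict_mem measurableSet_Ioo] with x hx using ⟨hx.1.le, hx.2.le⟩
  let K0 : Lp ℝ 2 muOm →ₗ[ℝ] Lp ℝ 2 muOm :=
    { toFun := fun h => (hm h).toLp _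
      map_add' := fun h k => by
        rw [← MemLp.toLp_add, MemLp.toLp_eq_toLp_iff]
        filter_upwards [hmem] with x hx
        rw [green_congr (Lp.coeFn_add h k) hx]
        exact green_add hs1 (Lp.memLp h) (Lp.memLp k) hx
      map_smul' := fun r h => by
        rw [RingHom.id_apply, ← MemLp.toLp_const_smul, MemLp.toLp_eq_toLp_iff]
        filter_upwards [hmem] with x hx
        rw [green_congr (Lp.coeFn_smul r h) hx]
        exact green_const_mul s r h x }
  have hK0 : ∀ h, K0 h = (hm h).toLp _ := fun h => rfl
  have hin : ∀ h, c * ‖K0 h‖ ^ 2 ≤ inner ℝ (K0 h) h := fun h => by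
    have h2 := hco2 h (Lp.memLp h)
    rw [← norm_toLp_sq (hm h), ← inner_toLp (hm h) (Lp.memLp h), Lp.toLp_coeFn] at h2
    exact h2
  have hbd : ∀ h, ‖K0 h‖ ≤ c⁻¹ * ‖h‖ := fun h => by
    have h2 := real_inner_le_norm (K0 h) h
    rw [← div_eq_inv_mul, le_div_iff₀ hc]
    rcases (norm_nonneg (K0 h)).eq_or_lt with h0 | h0
    · rw [← h0, zero_mul]; positivity
    · refine le_of_mul_le_mul_left ?_ h0
      nlinarith [hin h]
  exact ⟨c, K0.mkContinuous _ hbd, hc, hco, hco2, hin, fun h => MemLp.coeFn_toLp (hm h)⟩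

/-! ### Existence of solutions -/

variable {g : ℝ → ℝ → ℝ}

/-- Truncation to `[-M, M]`. -/
def clamp (M t : ℝ) : ℝ := max (-M) (min t M)

lemma abs_clamp_le {M : ℝ} (hM : 0 ≤ M) (t : ℝ) : |clamp M t| ≤ M :=
  abs_le.2 ⟨le_max_left _ _, max_le (by linarith) (min_le_right _ _)⟩

lemma clamp_eq {M t : ℝ} (ht : |t| ≤ M) : clamp M t = t := by
  rw [abs_le] at ht
  rw [clamp, min_eq_left ht.2, max_eq_right ht.1]

lemma continuous_clamp (M : ℝ) : Continuous (clamp M) := by unfold clamp; fun_prop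

lemma monotone_clamp (M : ℝ) : Monotone (clamp M) := fun _ _ h =>
  max_le_max_left _ (min_le_min_right _ h)

lemma abs_clamp_sub_le (M a b : ℝ) : |clamp M a - clamp M b| ≤ |a - b| :=
  (abs_max_sub_max_le_max (-M) (min a M) (-M) (min b M)).trans (by
    refine max_le (by simp) ((abs_min_sub_min_le_max a M b M).trans ?_)
    simp)

/-- The increment of `φ` lies between `0` and `l` times that of the argument, and hence so does the
increment of `l t - φ t`. Monotonicity avoids the constant `2l`. -/
lemma abs_linear_sub_le {φ : ℝ → ℝ} (hφ : Monotone φ) {l : ℝ} {a b : ℝ}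
    (hL : |φ a - φ b| ≤ l * |a - b|) : |(l * a - φ a) - (l * b - φ b)| ≤ l * |a - b| := by
  rcases le_total a b with hab | hab
  · have h1 := hφ hab
    rw [abs_of_nonpos (by linarith : a - b ≤ 0)] at hL ⊢
    rw [abs_le] at hL ⊢
    constructor <;> nlinarith
  · have h1 := hφ hab
    rw [abs_of_nonneg (by linarith : 0 ≤ a - b)] at hL ⊢
    rw [abs_le] at hL ⊢
    constructor <;> nlinarith

/-- Solvability of the truncated problem. -/
lemma exists_truncated (K : Lp ℝ 2 muOm →L[ℝ] Lp ℝ 2 muOm) {c : ℝ} (hc : 0 < c)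
    (hK : ∀ h, c * ‖K h‖ ^ 2 ≤ inner ℝ (K h) h) (hKg : ∀ h, (K h : ℝ → ℝ) =ᵐ[muOm] green s h)
    (hg : NonlinAssumption g) (hlip : LocLipschitz g) (hf : MemLp f 2 muOm) {M : ℝ} (hM : 0 < M) :
    ∃ h : ℝ → ℝ, MemLp h 2 muOm ∧
      h =ᵐ[muOm] fun x => f x - g x (clamp M (green s h x)) := by
  obtain ⟨l, hl0, hl⟩ := exists_lipschitz_bound hlip hM
  have hmN : ∀ u : Lp ℝ 2 muOm, MemLp (fun x => g x (clamp M (u x))) 2 muOm := fun u =>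
    memLp_comp_of_bounded hg hlip
      ((continuous_clamp M).comp_aestronglyMeasurable (Lp.aestronglyMeasurable u)) hM
      (ae_of_all _ fun x => abs_clamp_le hM.le _)
  obtain ⟨u, hu⟩ := exists_eq_map_sub K hc hl0 hK (fun u => (hmN u).toLp _) (fun u v => by
    rw [← Real.norm_of_nonneg hl0.le, ← norm_smul, Real.norm_of_nonneg hl0.le]
    refine Lp.norm_le_norm_of_ae_le ?_
    filter_upwards [Lp.coeFn_sub (l • u - (hmN u).toLp _) (l • v - (hmN v).toLp _),
      Lp.coeFn_sub (l • u) ((hmN u).toLp _), Lp.coeFn_sub (l • v) ((hmN v).toLp _),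
      Lp.coeFn_smul l u, Lp.coeFn_smul l v, (hmN u).coeFn_toLp, (hmN v).coeFn_toLp,
      Lp.coeFn_smul l (u - v), Lp.coeFn_sub u v, hl, hg.strictMono]
      with x e1 e2 e3 e4 e5 e6 e7 e8 e9 hx hmono
    rw [e1, e8]
    simp only [Pi.sub_apply, Pi.smul_apply, e2, e3, e4, e5, e6, e7, e9, smul_eq_mul, norm_mul,
      Real.norm_eq_abs, abs_of_pos hl0]
    refine abs_linear_sub_le (φ := fun t => g x (clamp M t))
      (hmono.monotone.comp (monotone_clamp M)) ?_
    refine (hx _ _ (abs_clamp_le hM.le _) (abs_clamp_le hM.le _)).trans ?_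
    exact mul_le_mul_of_nonneg_left (abs_clamp_sub_le _ _ _) hl0.le) (hf.toLp f)
  refine ⟨_, Lp.memLp (hf.toLp f - (hmN u).toLp _), ?_⟩
  have h1 := hKg (hf.toLp f - (hmN u).toLp _)
  rw [← hu] at h1
  filter_upwards [h1, Lp.coeFn_sub (hf.toLp f) ((hmN u).toLp _), hf.coeFn_toLp,
    (hmN u).coeFn_toLp] with x e1 e2 e3 e4
  rw [← e1, e2, Pi.sub_apply, e3, e4]

/-- Pairing the truncated equation with its own potential discards the nonlinear term, which has a
good sign, and coercivity bounds the potential by a quantity free of the truncation level. -/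
theorem exists_green_solution (hs1 : 1 < s) (hs2 : s < 2) (hg : NonlinAssumption g)
    (hlip : LocLipschitz g) (hf : MemLp f 2 muOm) :
    ∃ h : ℝ → ℝ, MemLp h 2 muOm ∧ h =ᵐ[muOm] fun x => f x - g x (green s h x) := by
  obtain ⟨c, K, hc, hco, hco2, hK, hKg⟩ := exists_greenCLM hs1 hs2
  set F := ∫ x in Om, f x ^ 2
  have hF : 0 ≤ F := integral_nonneg fun _ => sq_nonneg _
  -- The a priori bound is `√F / c`; the extra `1` keeps the level positive when `f = 0`.
  have hM : 0 < Real.sqrt F / c + 1 := by positivity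
  obtain ⟨h, hh, hfix⟩ := exists_truncated K hc hK hKg hg hlip hf hM
  set M := Real.sqrt F / c + 1
  refine ⟨h, hh, ?_⟩
  have hG := memLp_green hs1 hh
  set A := ∫ x in Om, green s h x * f x
  have hle : ∫ x in Om, green s h x * h x ≤ A := by
    refine integral_mono_ae (hG.integrable_mul hh) (hG.integrable_mul hf) ?_
    filter_upwards [hfix, hg.strictMono, hg.zero] with x hx hmono h0
    have hclamp0 : clamp M 0 = 0 := clamp_eq (by simpa using hM.le)
    have hnn : 0 ≤ green s h x * g x (clamp M (green s h x)) := by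
      rcases le_total 0 (green s h x) with hp | hp
      · refine mul_nonneg hp ?_
        rw [← h0, ← hclamp0]
        exact hmono.monotone (monotone_clamp M hp)
      · refine mul_nonneg_of_nonpos_of_nonpos hp ?_
        rw [← h0, ← hclamp0]
        exact hmono.monotone (monotone_clamp M hp)
    change green s h x * h x ≤ green s h x * f x
    rw [hx, mul_sub]
    linarith
  have hCS : A ^ 2 ≤ (∫ x in Om, green s h x ^ 2) * F := sq_integral_mul_le hG hf
  have hA1 : c * ∫ x in Om, green s h x ^ 2 ≤ A := (hco2 h hh).trans hle
  have hQ : 0 ≤ ∫ x in Om, green s h x ^ 2 := integral_nonneg fun _ => sq_nonneg _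
  have hA0 : 0 ≤ A := le_trans (by positivity) hA1
  -- With `Q = ‖green s h‖²`, Cauchy–Schwarz gives `A² ≤ Q F` and coercivity gives `c Q ≤ A`, so one
  -- factor `A` cancels.
  have hA : c * A ≤ F := by
    rcases hA0.eq_or_lt with h0 | h0
    · rw [← h0, mul_zero]; exact hF
    · refine le_of_mul_le_mul_left ?_ h0
      nlinarith
  have hb : ∀ x ∈ Icc (0 : ℝ) 1, |green s h x| ≤ M := by
    intro x hx
    have h1 := (hco h hh x hx).trans hle
    have h2 : (c * green s h x) ^ 2 ≤ F := by nlinarith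
    have h3 := Real.abs_le_sqrt h2
    rw [abs_mul, abs_of_pos hc, ← le_div_iff₀' hc] at h3
    exact h3.trans (by simp [M])
  filter_upwards [hfix, ae_restrict_mem measurableSet_Ioo] with x hx hxO
  rw [clamp_eq (hb x ⟨hxO.1.le, hxO.2.le⟩)] at hx
  exact hx

/-- Existence of a solution that is at once strong, weak and a solution of the integral
equation. -/
theorem exists_solution (hs1 : 1 < s) (hs2 : s < 2) (hg : NonlinAssumption g)
    (hlip : LocLipschitz g) (hf : MemLp f 2 muOm) :
    ∃ u : ℝ → ℝ, IsStrongSolution s g f u ∧ IsWeakSolution s g f u ∧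
      ∀ x ∈ Icc (0 : ℝ) 1, IntegralEqAt s g f u x := by
  obtain ⟨h, hh, hfix⟩ := exists_green_solution hs1 hs2 hg hlip hf
  have hT := memHTilde_green hs1 hs2 hh
  refine ⟨green s h, ⟨continuousOn_green hs1 hs2 hh, green_zero hs1 h, green_one s h, _,
    hasLeftRLDeriv_green hs1 hs2 hh, ?_⟩, ⟨hT.memU hs1 hs2 hg hlip, fun v hv => ?_⟩,
    fun x hx => green_congr hfix hx⟩
  · filter_upwards [hfix] with x hx
    rw [hx]
    ring
  · rw [formA_green hs1 hs2 hh hv.1, formB_add hs1 hs2 hg hlip hf hT hv.1]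
    congr 1
    refine integral_congr_ae ?_
    filter_upwards [hfix] with x hx
    rw [← hx]

end

end

end FracBVP

theorem theorem3p3 (s : ℝ) (hs1 : 1 < s) (hs2 : s < 2)
    (g : ℝ → ℝ → ℝ) (hg : FracBVP.NonlinAssumption g) (hlip : FracBVP.LocLipschitz g)
    (f : ℝ → ℝ) (hf : MeasureTheory.MemLp f 2 FracBVP.muOm) :
    (∃ u : ℝ → ℝ, FracBVP.IsStrongSolution s g f u ∧ FracBVP.IsWeakSolution s g f u ∧
      ∀ x ∈ Set.Icc (0 : ℝ) 1, FracBVP.IntegralEqAt s g f u x) ∧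
    (∀ u : ℝ → ℝ, FracBVP.IsWeakSolution s g f u →
      (∀ᵐ x ∂FracBVP.muOm, FracBVP.IntegralEqAt s g f u x) ∧
      ∀ a : ℝ, 0 ≤ a → a < s - 1 / 2 → FracBVP.MemUReg a s g u) := by
  refine ⟨FracBVP.exists_solution hs1 hs2 hg hlip hf, fun u hu => ?_⟩
  have hgr := hu.ae_eq_green hs1 hs2 hg hlip hf
  refine ⟨hgr, fun a ha0 ha => ⟨?_, hu.1⟩⟩
  exact (FracBVP.memH_green hs1 hs2
    (hf.sub (hu.1.1.memLp_comp hs1 hs2 hg hlip)) ha0 ha).congr_ae hgr.symm
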